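/- Let $n \ge 0$ and let superspace $\mathbb{Q}[\mathbf{x}_n,\boldsymbol\theta_n]$ be the unital associative $\mathbb{Q}$-algebra generated by $x_1,\dots,x_n,\theta_1,\dots,\theta_n$ subject to $x_ix_j=x_jx_i$, $x_i\theta_j=\theta_jx_i$, $\theta_i\theta_j=-\theta_j\theta_i$, bigraded by $x$-degree and $\theta$-degree, with the diagonal $\mathfrak{S}_n$-action $w\cdot x_i=x_{w(i)}$, $w\cdot\theta_i=\theta_{w(i)}$. For $0\le k\le n$ put $$\rho_{n,k} := \Big(\sum_{w\in\mathfrak{S}_k}\mathrm{sign}(w)\, x_{w(1)}^{k-1}x_{w(2)}^{k-2}\cdots x_{w(k)}^{0}\Big)\cdot\theta_{k+1}\theta_{k+2}\cdots\theta_n .$$ Let $M_n$ be the smallest linear subspace of $\mathbb{Q}[\mathbf{x}_n,\boldsymbol\theta_n]$ that contains $\rho_{n,0},\dots,\rho_{n,n}$ and is closed under the action of $\mathfrak{S}_n$ and under the partial derivatives $\partial/\partial x_1,\dots,\partial/\partial x_n$ (which treat the $\theta_i$ as constants). Let $S_n := \mathbb{Q}[\mathbf{x}_n,\boldsymbol\theta_n]/J_n$,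 where $J_n$ is the two-sided ideal generated by $x_1\theta_1,\dots,x_n\theta_n$ and the elementary symmetric polynomials $e_1(\mathbf{x}_n),\dots,e_n(\mathbf{x}_n)$. Then $M_n$ and $S_n$ are bigraded $\mathfrak{S}_n$-modules with finite-dimensional pieces (by the bigrading inherited from superspace), and they are isomorphic as bigraded $\mathfrak{S}_n$-modules. Moreover $$\mathrm{grFrob}(M_n;q,z) := \sum_{i,j\ge 0}\mathrm{Frob}\big((M_n)_{i,j}\big)\,q^iz^j = \sum_{r=0}^n z^r\cdot e_r(\mathbf{x})\cdot \mathrm{rev}_q\, Q'_{(1^{n-r})}(\mathbf{x};q).$$ Here $(M_n)_{i,j}$ is the part of $x$-degree $i$ and $\theta$-degree $j$; $\mathbf{x}=(x_1,x_2,\dots)$ is an infinite variable set; $\mathrm{Frob}(V)=\frac1{n!}\sum_{w\in\mathfrak{S}_n}\chi_V(w)\,p_{\lambda(w)}(\mathbf{x})$ is the Frobenius characteristic, with $\lambda(w)$ the cycle type of $w$; $e_r(\mathbf{x})$ is the elementary symmetric function; $Q'_\lambda(\mathbf{x};q)=\prod_{i<j}\frac{1-R_{ij}}{1-qR_{ij}}\,h_\lambda(\mathbf{x})$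 is the Hall–Littlewood $Q'$-function, with $R_{ij}$ the operator that raises the $i$-th and lowers the $j$-th index of $h_\lambda=h_{\lambda_1}h_{\lambda_2}\cdots$ by one (and $h_m=0$ for $m<0$); and $\mathrm{rev}_q(r_dq^d+\dots+r_1q+r_0)=r_0q^d+\dots+r_{d-1}q+r_d$ when $r_d\ne0$. -/

import Mathlib

open scoped TensorProduct

noncomputable section

namespace SuperVandermonde

/-! ### Superspace -/

/-- Superspace of rank `n`: the `ℚ`-algebra `ℚ[x_1,…,x_n] ⊗ ⋀(θ_1,…,θ_n)`. The `x`-variables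
commute with each other and with the `θ`-variables, and the `θ`-variables anticommute. -/
abbrev Superspace (n : ℕ) : Type :=
  MvPolynomial (Fin n) ℚ ⊗[ℚ] ExteriorAlgebra ℚ (Fin n → ℚ)

/-- Polynomials in the `x`-variables, viewed in superspace. -/
def polyIncl (n : ℕ) : MvPolynomial (Fin n) ℚ →ₐ[ℚ] Superspace n :=
  Algebra.TensorProduct.includeLeft

/-- The commuting variable `x_i`. -/
def xVar {n : ℕ} (i : Fin n) : Superspace n := polyIncl n (MvPolynomial.X i)

/-- The anticommuting variable `θ_i`. -/
def thetaVar {n : ℕ} (i : Fin n) : Superspace n :=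
  1 ⊗ₜ[ℚ] ExteriorAlgebra.ι ℚ (Pi.single i 1)

/-- The linear map `ℚ^n → ℚ^n` that sends the `i`-th basis vector to the `w i`-th one. -/
def permVec {n : ℕ} (w : Equiv.Perm (Fin n)) : (Fin n → ℚ) →ₗ[ℚ] (Fin n → ℚ) :=
  LinearMap.funLeft ℚ ℚ w.symm

/-- The algebra endomorphism of superspace with `x_i ↦ x_{w(i)}` and `θ_i ↦ θ_{w(i)}`. -/
def permAlgHom {n : ℕ} (w : Equiv.Perm (Fin n)) : Superspace n →ₐ[ℚ] Superspace n :=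
  Algebra.TensorProduct.map (MvPolynomial.rename w) (ExteriorAlgebra.map (permVec w))

theorem permAlgHom_tmul {n : ℕ} (w : Equiv.Perm (Fin n)) (f : MvPolynomial (Fin n) ℚ)
    (g : ExteriorAlgebra ℚ (Fin n → ℚ)) :
    permAlgHom w (f ⊗ₜ[ℚ] g) =
      MvPolynomial.rename w f ⊗ₜ[ℚ] ExteriorAlgebra.map (permVec w) g := rfl

theorem permVec_single {n : ℕ} (w : Equiv.Perm (Fin n)) (i : Fin n) :
    permVec w (Pi.single i 1) = Pi.single (w i) 1 := by
  ext j
  simp [permVec, LinearMap.funLeft_apply, Pi.single_apply, Equiv.symm_apply_eq]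

theorem permAlgHom_xVar {n : ℕ} (w : Equiv.Perm (Fin n)) (i : Fin n) :
    permAlgHom w (xVar i) = xVar (w i) := by
  simp [xVar, polyIncl, permAlgHom]

theorem permAlgHom_thetaVar {n : ℕ} (w : Equiv.Perm (Fin n)) (i : Fin n) :
    permAlgHom w (thetaVar i) = thetaVar (w i) := by
  simp [thetaVar, permAlgHom, permVec_single]

/-- The diagonal action of the symmetric group on superspace. -/
def superRep (n : ℕ) : Representation ℚ (Equiv.Perm (Fin n)) (Superspace n) where
  toFun w := (permAlgHom w).toLinearMap
  map_one' := by
    have h : permVec (1 : Equiv.Perm (Fin n)) = LinearMap.id := rfl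
    refine TensorProduct.ext' fun f g => ?_
    simp only [AlgHom.toLinearMap_apply, permAlgHom_tmul, h, ExteriorAlgebra.map_id,
      Equiv.Perm.coe_one, MvPolynomial.rename_id]
    rfl
  map_mul' v w := by
    have h : permVec (v * w) = permVec v ∘ₗ permVec w := rfl
    refine TensorProduct.ext' fun f g => ?_
    simp only [AlgHom.toLinearMap_apply, permAlgHom_tmul, h, Module.End.mul_apply,
      MvPolynomial.rename_rename, Equiv.Perm.coe_mul, ← ExteriorAlgebra.map_comp_map,
      AlgHom.comp_apply]

/-- Partial differentiation with respect to `x_i`; the `θ`-variables are constants. -/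
def partialX {n : ℕ} (i : Fin n) : Superspace n →ₗ[ℚ] Superspace n :=
  LinearMap.rTensor (ExteriorAlgebra ℚ (Fin n → ℚ))
    (MvPolynomial.pderiv (R := ℚ) i).toLinearMap

/-- Superpolynomials that are homogeneous of `x`-degree `i` and `θ`-degree `j`. -/
def bidegreeSubmodule (n i j : ℕ) : Submodule ℚ (Superspace n) :=
  LinearMap.range (TensorProduct.map (MvPolynomial.homogeneousSubmodule (Fin n) ℚ i).subtype
    (⋀[ℚ]^j (Fin n → ℚ)).subtype)

theorem superRep_mem_bidegree {n i j : ℕ} (w : Equiv.Perm (Fin n)) {v : Superspace n}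
    (hv : v ∈ bidegreeSubmodule n i j) : superRep n w v ∈ bidegreeSubmodule n i j := by
  obtain ⟨t, rfl⟩ := hv
  induction t with
  | zero => simp
  | add a b ha hb => rw [map_add, map_add]; exact add_mem ha hb
  | tmul f g =>
    have hf : MvPolynomial.rename w f.1 ∈ MvPolynomial.homogeneousSubmodule (Fin n) ℚ i :=
      (MvPolynomial.IsHomogeneous.rename_isHomogeneous
        ((MvPolynomial.mem_homogeneousSubmodule _ _).1 f.2))
    have hg : ExteriorAlgebra.map (permVec w) g.1 ∈ ⋀[ℚ]^j (Fin n → ℚ) := by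
      have h1 : (LinearMap.range (ExteriorAlgebra.ι ℚ (M := Fin n → ℚ))).map
          (ExteriorAlgebra.map (permVec w)).toLinearMap ≤
            LinearMap.range (ExteriorAlgebra.ι ℚ (M := Fin n → ℚ)) := by
        rintro _ ⟨_, ⟨y, rfl⟩, rfl⟩
        exact ⟨permVec w y, by simp⟩
      have h2 : (⋀[ℚ]^j (Fin n → ℚ)).map (ExteriorAlgebra.map (permVec w)).toLinearMap ≤
          ⋀[ℚ]^j (Fin n → ℚ) := by
        rw [Submodule.map_pow]
        exact pow_le_pow_left' h1 j
      exact h2 ⟨g.1, g.2, rfl⟩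
    exact ⟨⟨_, hf⟩ ⊗ₜ[ℚ] ⟨_, hg⟩, rfl⟩

/-! ### The space `M_n` -/

/-- The Vandermonde of the first `k` of the `x`-variables,
`ε_k · (x_1^{k-1} ⋯ x_{k-1}^1 x_k^0)`. -/
def vandermondePoly (n : ℕ) (k : Fin (n + 1)) : MvPolynomial (Fin n) ℚ :=
  ∑ w : Equiv.Perm (Fin k), (Equiv.Perm.sign w : ℤ) •
    ∏ i : Fin k, MvPolynomial.X (Fin.castLE (Nat.lt_succ_iff.mp k.2) (w i)) ^ (k - 1 - i : ℕ)

/-- The superpolynomial `ρ_{n,k}`, the Vandermonde of `x_1, …, x_k` times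
`θ_{k+1} θ_{k+2} ⋯ θ_n` (factors in this order). -/
def rho (n : ℕ) (k : Fin (n + 1)) : Superspace n :=
  polyIncl n (vandermondePoly n k) *
    (((List.finRange n).filter fun i : Fin n => (k : ℕ) ≤ i).map thetaVar).prod

/-- The smallest linear subspace of superspace that contains all `ρ_{n,k}` and is closed under
the symmetric group and under the `x`-derivatives. -/
def mSubmodule (n : ℕ) : Submodule ℚ (Superspace n) :=
  sInf {N | (∀ k : Fin (n + 1), rho n k ∈ N) ∧
    (∀ w : Equiv.Perm (Fin n), ∀ f ∈ N, superRep n w f ∈ N) ∧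
    (∀ i : Fin n, ∀ f ∈ N, partialX i f ∈ N)}

/-- `M_n` as a subrepresentation of superspace. -/
def mSub (n : ℕ) : Subrepresentation (superRep n) where
  toSubmodule := mSubmodule n
  apply_mem_toSubmodule w v hv := by
    simp only [mSubmodule, Submodule.mem_sInf] at hv ⊢
    exact fun N hN => hN.2.1 w v (hv N hN)

/-- The action of the symmetric group on `M_n`. -/
abbrev mRep (n : ℕ) : Representation ℚ (Equiv.Perm (Fin n)) (mSub n).toSubmodule :=
  (mSub n).toRepresentation

/-- The part of `M_n` of `x`-degree `i` and `θ`-degree `j`. -/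
def mPiece (n i j : ℕ) : Subrepresentation (mRep n) where
  toSubmodule := (bidegreeSubmodule n i j).comap (mSub n).toSubmodule.subtype
  apply_mem_toSubmodule w _ hv := superRep_mem_bidegree w hv

/-! ### The quotient ring `S_n` -/

/-- The generators `x_1 θ_1, …, x_n θ_n, e_1, …, e_n` of the ideal `J_n`. -/
def jGenerators (n : ℕ) : Set (Superspace n) :=
  Set.range (fun i : Fin n => xVar i * thetaVar i) ∪
    {f | ∃ d, 1 ≤ d ∧ d ≤ n ∧ f = polyIncl n (MvPolynomial.esymm (Fin n) ℚ d)}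

/-- The two-sided ideal `J_n` of superspace. -/
def jTwoSided (n : ℕ) : TwoSidedIdeal (Superspace n) := TwoSidedIdeal.span (jGenerators n)

abbrev jIdeal (n : ℕ) : Ideal (Superspace n) := (jTwoSided n).asIdeal

/-- The quotient ring `S_n` of superspace by `J_n`. -/
abbrev SQuot (n : ℕ) : Type := Superspace n ⧸ jIdeal n

theorem permAlgHom_mem_jTwoSided {n : ℕ} (w : Equiv.Perm (Fin n)) {v : Superspace n}
    (hv : v ∈ jTwoSided n) : permAlgHom w v ∈ jTwoSided n := by
  have h : jTwoSided n ≤ (jTwoSided n).comap (permAlgHom w) := by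
    refine TwoSidedIdeal.span_le.2 ?_
    rintro _ (⟨i, rfl⟩ | ⟨d, h1, h2, rfl⟩)
    · refine (TwoSidedIdeal.mem_comap _).2 (TwoSidedIdeal.subset_span (Or.inl ⟨w i, ?_⟩))
      simp [permAlgHom_xVar, permAlgHom_thetaVar]
    · refine (TwoSidedIdeal.mem_comap _).2 (TwoSidedIdeal.subset_span (Or.inr ⟨d, h1, h2, ?_⟩))
      simp [polyIncl, permAlgHom, MvPolynomial.rename_esymm]
  exact (TwoSidedIdeal.mem_comap _).1 (h hv)

/-- The quotient map from superspace to `S_n`, as a `ℚ`-linear map. -/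
def sMk (n : ℕ) : Superspace n →ₗ[ℚ] SQuot n :=
  (jIdeal n).mkQ.restrictScalars ℚ

/-- The action of the symmetric group on `S_n` induced by its action on superspace. -/
def sRep (n : ℕ) : Representation ℚ (Equiv.Perm (Fin n)) (SQuot n) :=
  (superRep n).quotient ((jIdeal n).restrictScalars ℚ)
    (fun w _ hv => TwoSidedIdeal.mem_asIdeal.2
      (permAlgHom_mem_jTwoSided w (TwoSidedIdeal.mem_asIdeal.1 hv)))

theorem sRep_sMk {n : ℕ} (w : Equiv.Perm (Fin n)) (v : Superspace n) :
    sRep n w (sMk n v) = sMk n (superRep n w v) := rfl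

/-- The part of `S_n` of `x`-degree `i` and `θ`-degree `j`: the image of the superpolynomials of
that bidegree. -/
def sPiece (n i j : ℕ) : Subrepresentation (sRep n) where
  toSubmodule := (bidegreeSubmodule n i j).map (sMk n)
  apply_mem_toSubmodule := by
    rintro w _ ⟨v, hv, rfl⟩
    exact ⟨superRep n w v, superRep_mem_bidegree w hv, (sRep_sMk w v).symm⟩

/-! ### Bigraded representations -/

/-- A doubly indexed family of subrepresentations makes the representation `ρ` into a bigraded
one with finite-dimensional pieces. -/
structure IsBigrading {n : ℕ} {V : Type} [AddCommMonoid V] [Module ℚ V]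
    {ρ : Representation ℚ (Equiv.Perm (Fin n)) V} (P : ℕ → ℕ → Subrepresentation ρ) : Prop where
  isInternal : DirectSum.IsInternal fun d : ℕ × ℕ => (P d.1 d.2).toSubmodule
  finite : ∀ i j, Module.Finite ℚ (P i j).toSubmodule

/-- Isomorphism of bigraded representations: an equivariant linear isomorphism that maps each
bigraded piece onto the piece of the same bidegree. -/
def BigradedIso {n : ℕ} {V W : Type} [AddCommMonoid V] [Module ℚ V] [AddCommMonoid W] [Module ℚ W]
    {ρ : Representation ℚ (Equiv.Perm (Fin n)) V} {σ : Representation ℚ (Equiv.Perm (Fin n)) W}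
    (P : ℕ → ℕ → Subrepresentation ρ) (Q : ℕ → ℕ → Subrepresentation σ) : Prop :=
  ∃ φ : V ≃ₗ[ℚ] W, (∀ w v, φ (ρ w v) = σ w (φ v)) ∧
    ∀ i j, (P i j).toSubmodule.map φ.toLinearMap = (Q i j).toSubmodule

/-! ### Symmetric functions -/

/-- Formal power series over `ℚ` in infinitely many variables, the ambient ring of the symmetric
functions. -/
abbrev SymFun : Type := MvPowerSeries ℕ ℚ

open Classical in
/-- The power sum `p_k = ∑ᵢ xᵢ^k`, for `k ≥ 1`. -/
def powerSum (k : ℕ) : SymFun := fun d => if ∃ i, d = Finsupp.single i k then 1 else 0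

open Classical in
/-- The elementary symmetric function `e_k`, the sum of the square-free monomials of
degree `k`. -/
def elemSym (k : ℕ) : SymFun := fun d => if d.degree = k ∧ ∀ i, d i ≤ 1 then 1 else 0

/-- The complete homogeneous symmetric function `h_k`, the sum of all monomials of degree `k`,
with `h_k = 0` for `k < 0`. -/
def complSym (k : ℤ) : SymFun := fun d => if (d.degree : ℤ) = k then 1 else 0

/-- The Frobenius image of a finite-dimensional representation of the symmetric group on `n`
letters: `(1/n!) ∑_w χ(w) p_{λ(w)}`, where `λ(w)` is the cycle type of `w`, fixed points
included. -/
def frob {n : ℕ} {V : Type} [AddCommMonoid V] [Module ℚ V]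
    (ρ : Representation ℚ (Equiv.Perm (Fin n)) V) : SymFun :=
  (n.factorial : ℚ)⁻¹ • ∑ w : Equiv.Perm (Fin n),
    LinearMap.trace ℚ V (ρ w) • (w.partition.parts.map powerSum).prod

/-- The bigraded Frobenius image `∑ Frob(V_{i,j}) q^i z^j`, as a power series in `z` (the outer
variable, second index) over power series in `q` (the inner variable, first index). -/
def grFrob {n : ℕ} {V : Type} [AddCommMonoid V] [Module ℚ V]
    (ρ : Representation ℚ (Equiv.Perm (Fin n)) V) (P : ℕ → ℕ → Subrepresentation ρ) :
    PowerSeries (PowerSeries SymFun) :=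
  PowerSeries.mk fun j => PowerSeries.mk fun i => frob (P i j).toRepresentation

/-- The coefficient of `R^m` in `(1 - R) / (1 - q R)`. -/
def raisingCoeff : ℕ → Polynomial SymFun
  | 0 => 1
  | m + 1 => Polynomial.X ^ (m + 1) - Polynomial.X ^ m

/-- The Hall–Littlewood function `Q'_λ(x; q)` of a partition `λ = (λ_1 ≥ ⋯ ≥ λ_l)`, by the raising
operator formula `Q'_λ = ∏_{i<j} (1 - R_{ij}) / (1 - q R_{ij}) h_λ`. Here `R_{ij}` raises the
`i`-th index of `h` by one and lowers the `j`-th one by one. The exponent `m p` of `R_p` may be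
bounded by `|λ|`: if some `m (i, j)` is larger, the indices at the places `≥ j` have a negative
sum, and that term is zero. -/
def hallLittlewoodQ' {l : ℕ} (lam : Fin l → ℕ) : Polynomial SymFun :=
  ∑ m : {p : Fin l × Fin l // p.1 < p.2} → Fin ((∑ i, lam i) + 1),
    (∏ p, raisingCoeff (m p)) * Polynomial.C (∏ i, complSym ((lam i : ℤ) +
      (∑ p with p.1.1 = i, (m p : ℤ)) - ∑ p with p.1.2 = i, (m p : ℤ)))

/-- The `q`-reversal `rev_q (r_d q^d + ⋯ + r_0) = r_0 q^d + ⋯ + r_d` (where `r_d ≠ 0`). -/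
abbrev revQ (f : Polynomial SymFun) : Polynomial SymFun := f.reverse

end SuperVandermonde

end

/-! Expand superspace along the monomials θ_T. For a set T of indices let H_T be the harmonic
polynomials in the variables outside T (`outsideHarm`), and let I_T be the ideal generated by the
variables in T and all e_d with d ≥ 1 (`outsideIdeal`). Then M_n is the sum of the H_T θ_T
(`mem_mSubmodule_iff`), because each ρ_{n,k} is up to sign a Vandermonde polynomial times some θ_T,
and the harmonic polynomials are exactly the span of the iterated derivatives of the Vandermonde.
Likewise J_n is the sum of the I_T θ_T (`mem_jTwoSided_iff`), because x_i θ_T is a multiple of x_i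
θ_i for i in T, and I_S lies in I_T when S lies in T. Since ℚ[x] = H_T ⊕ I_T for every T, the
composite M_n → superspace → S_n is bijective. It is visibly equivariant, and it respects bidegrees
since H_T and I_T are graded.

The splitting ℚ[x] = H ⊕ I rests on the positive definite form f(∂)g|₀, for which H is the
complement of the coinvariant ideal I. The main point is `mem_coinvIdeal_of_apolar`: a polynomial
all of whose multiples are orthogonal to the Vandermonde lies in I.

In the character, a permutation w only sees the sets T that it stabilizes, and each contributes the
sign of w on T times the character of w on H_T. Summing over w amounts to summing over pairs of
permutations of T and of its complement, which gives e_r times the Frobenius image of the harmonic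
polynomials in n - r variables. As ℚ[x] is free over the symmetric polynomials with the harmonics as
basis space (`esymmMul_bijective`), the graded character of H is ∏(1 - q^i) / ∏(1 - q^{λ_j}), and
its Frobenius image in m variables is (1 - q)⋯(1 - q^m) h_m[X/(1 - q)], which is `frobPoly`.

On the symmetric function side, the raising operator formula is expanded along its first index. An
auxiliary variable v records how far that index is raised, and the remaining factors form a formula
of the same kind over a larger ring with a modified sequence h. This yields a recursion for Q' of a
column (`hallLittlewoodQ'_column`), and q-reversal turns it into the recursion of `frobPoly`
(`reverse_columnPoly`). -/

noncomputable section

namespace SuperVandermonde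

set_option linter.unusedSectionVars false

open MvPolynomial

/-! ### The apolar form -/

section Apolar

variable {σ τ : Type*}

/-- The apolar pairing `⟨f, g⟩ = f(∂) g |_{x = 0}`, for which the monomial `x^a` has norm `a!`. -/
def apolar : MvPolynomial σ ℚ →ₗ[ℚ] MvPolynomial σ ℚ →ₗ[ℚ] ℚ :=
  (basisMonomials σ ℚ).constr ℚ fun a => ((a.prod fun _ k => k.factorial : ℕ) : ℚ) • lcoeff ℚ a

theorem apolar_monomial (a : σ →₀ ℕ) (g : MvPolynomial σ ℚ) :
    apolar (monomial a 1) g = ((a.prod fun _ k => k.factorial : ℕ) : ℚ) * coeff a g := by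
  have := (basisMonomials σ ℚ).constr_basis ℚ
    (fun a => ((a.prod fun _ k => k.factorial : ℕ) : ℚ) • lcoeff (R := ℚ) a) a
  rw [coe_basisMonomials] at this
  rw [apolar, this]
  simp

theorem apolar_eq_sum (f g : MvPolynomial σ ℚ) :
    apolar f g = ∑ a ∈ f.support,
      coeff a f * (((a.prod fun _ k => k.factorial : ℕ) : ℚ) * coeff a g) := by
  conv_lhs => rw [f.as_sum]
  rw [map_sum, LinearMap.sum_apply]
  refine Finset.sum_congr rfl fun a _ => ?_
  rw [← apolar_monomial, ← mul_one (coeff a f), ← smul_eq_mul, ← smul_monomial, map_smul,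
    LinearMap.smul_apply, smul_eq_mul, smul_eq_mul, mul_one]

theorem apolar_comm (f g : MvPolynomial σ ℚ) : apolar f g = apolar g f := by
  have h : apolar (σ := σ) = apolar.flip := by
    refine (basisMonomials σ ℚ).ext fun a => (basisMonomials σ ℚ).ext fun b => ?_
    classical
    simp only [coe_basisMonomials, LinearMap.flip_apply, apolar_monomial, coeff_monomial]
    by_cases hab : a = b
    · simp [hab]
    · simp [hab, Ne.symm hab]
  exact congrArg (fun F => F f g) h

/-- Positive definiteness: ⟨f, f⟩ is the sum of a! c_a² over the coefficients c_a of f. This is why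
orthogonal subspaces meet in zero. -/
theorem apolar_self_eq_zero {f : MvPolynomial σ ℚ} (h : apolar f f = 0) : f = 0 := by
  rw [apolar_eq_sum, Finset.sum_eq_zero_iff_of_nonneg] at h
  · ext a
    by_contra ha
    rw [coeff_zero] at ha
    have h1 := h a (mem_support_iff.2 ha)
    have h2 : ((a.prod fun _ k => k.factorial : ℕ) : ℚ) ≠ 0 := by
      rw [Nat.cast_ne_zero, Finsupp.prod, Finset.prod_ne_zero_iff]
      exact fun i _ => Nat.factorial_ne_zero _
    exact (mul_ne_zero ha (mul_ne_zero h2 ha)) h1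
  · intro a _
    have : 0 ≤ ((a.prod fun _ k => k.factorial : ℕ) : ℚ) := Nat.cast_nonneg _
    nlinarith [mul_nonneg this (mul_self_nonneg (coeff a f))]

/-- The norm of x_i x^a is (a_i + 1) a!, and the extra factor is the one that ∂_i produces. By this
adjointness the complement of an ideal is closed under derivatives. -/
theorem apolar_X_mul (i : σ) (f g : MvPolynomial σ ℚ) :
    apolar (X i * f) g = apolar f (pderiv i g) := by
  have h : apolar ∘ₗ LinearMap.mulLeft ℚ (X i : MvPolynomial σ ℚ) =
      apolar.compl₂ (pderiv (R := ℚ) i).toLinearMap := by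
    refine (basisMonomials σ ℚ).ext fun a => LinearMap.ext fun g => ?_
    have hx : (X i * monomial a 1 : MvPolynomial σ ℚ) = monomial (Finsupp.single i 1 + a) 1 := by
      rw [X, monomial_mul, one_mul]
    simp only [coe_basisMonomials, LinearMap.comp_apply, LinearMap.mulLeft_apply,
      LinearMap.compl₂_apply, Derivation.coeFn_coe, hx, apolar_monomial, coeff_pderiv]
    have hf : ((Finsupp.single i 1 + a).prod fun _ k => k.factorial) =
        (a i + 1) * a.prod fun _ k => k.factorial := by
      classical
      have h0 : ∀ b : σ →₀ ℕ, b.support ⊆ insert i a.support →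
          (b.prod fun _ k => k.factorial) =
            (b i).factorial * ∏ j ∈ a.support.erase i, (b j).factorial := by
        intro b hb
        rw [Finsupp.prod_of_support_subset b hb _ (by simp),
          ← Finset.mul_prod_erase _ _ (Finset.mem_insert_self _ _)]
        congr 1
        refine Finset.prod_congr ?_ fun _ _ => rfl
        ext j; simp +contextual
      rw [h0 a (Finset.subset_insert _ _), h0 (Finsupp.single i 1 + a)]
      · have : ∏ j ∈ a.support.erase i, ((Finsupp.single i 1 + a : σ →₀ ℕ) j).factorial =
            ∏ j ∈ a.support.erase i, (a j).factorial := by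
          refine Finset.prod_congr rfl fun j hj => ?_
          have : j ≠ i := (Finset.mem_erase.1 hj).1
          rw [Finsupp.add_apply, Finsupp.single_eq_of_ne this, zero_add]
        rw [this]
        simp only [Finsupp.add_apply, Finsupp.single_eq_same]
        rw [add_comm 1, Nat.factorial_succ, mul_assoc]
      · intro j hj
        by_cases hji : j = i
        · simp [hji]
        · simp [hji] at hj ⊢
          exact hj
    rw [hf, add_comm (Finsupp.single i 1)]
    push_cast
    ring
  exact congrArg (fun F => F f g) h

theorem apolar_rename (e : σ ≃ τ) (f g : MvPolynomial σ ℚ) :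
    apolar (rename e f) (rename e g) = apolar f g := by
  have h : apolar.compl₁₂ (rename (R := ℚ) e).toLinearMap (rename (R := ℚ) e).toLinearMap =
      apolar := by
    refine (basisMonomials σ ℚ).ext fun a => LinearMap.ext fun g => ?_
    simp only [coe_basisMonomials, LinearMap.compl₁₂_apply, AlgHom.toLinearMap_apply,
      rename_monomial, apolar_monomial, coeff_rename_mapDomain _ e.injective]
    rw [Finsupp.prod_mapDomain_index_inj e.injective]
  exact congrArg (fun F => F f g) h

theorem apolar_rename_left (e : σ ≃ τ) (f : MvPolynomial σ ℚ) (g : MvPolynomial τ ℚ) :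
    apolar (rename e f) g = apolar f (rename e.symm g) := by
  rw [← apolar_rename e, rename_rename]
  simp

theorem apolar_of_isHomogeneous {m n : ℕ} (hmn : m ≠ n) {f g : MvPolynomial σ ℚ}
    (hf : f.IsHomogeneous m) (hg : g.IsHomogeneous n) : apolar f g = 0 := by
  rw [apolar_eq_sum]
  refine Finset.sum_eq_zero fun a ha => ?_
  rw [hg.coeff_eq_zero, mul_zero, mul_zero]
  rwa [Finsupp.degree_apply, ← hf.degree_eq_sum_deg_support ha]

theorem apolar_homogeneousComponent (d : ℕ) (f g : MvPolynomial σ ℚ) :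
    apolar (homogeneousComponent d f) g = apolar f (homogeneousComponent d g) := by
  have key : ∀ f g : MvPolynomial σ ℚ, apolar (homogeneousComponent d f) g =
      apolar (homogeneousComponent d f) (homogeneousComponent d g) := by
    intro f g
    conv_lhs => rw [← sum_homogeneousComponent g]
    rw [map_sum]
    by_cases hd : d ∈ Finset.range (g.totalDegree + 1)
    · rw [Finset.sum_eq_single_of_mem d hd]
      intro b _ hb
      exact apolar_of_isHomogeneous hb.symm (homogeneousComponent_isHomogeneous _ _)
        (homogeneousComponent_isHomogeneous _ _)
    · have h0 : homogeneousComponent d g = 0 :=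
        homogeneousComponent_eq_zero _ _ (by simpa using hd)
      rw [h0, map_zero]
      refine Finset.sum_eq_zero fun b hb => ?_
      exact apolar_of_isHomogeneous (by rintro rfl; exact hd hb)
        (homogeneousComponent_isHomogeneous _ _) (homogeneousComponent_isHomogeneous _ _)
  rw [key f g, apolar_comm f, key g f, apolar_comm]

theorem homogeneousComponent_mul_of_isHomogeneous {m : ℕ} {f : MvPolynomial σ ℚ}
    (hf : f.IsHomogeneous m) (g : MvPolynomial σ ℚ) (d : ℕ) :
    homogeneousComponent d (f * g) = if m ≤ d then f * homogeneousComponent (d - m) g else 0 := by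
  have h : f * g = ∑ b ∈ Finset.range (g.totalDegree + 1), f * homogeneousComponent b g := by
    rw [← Finset.mul_sum, sum_homogeneousComponent]
  have hc : ∀ b, homogeneousComponent d (f * homogeneousComponent b g) =
      if m + b = d then f * homogeneousComponent b g else 0 := by
    intro b
    have := homogeneousComponent_of_mem (m := d)
      ((mem_homogeneousSubmodule _ _).2 (hf.mul (homogeneousComponent_isHomogeneous b g)))
    rw [this]
    simp only [eq_comm]
  rw [h, map_sum]
  simp_rw [hc]
  split_ifs with hmd
  · have : ∀ b, m + b = d ↔ b = d - m := fun b => by omega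
    simp_rw [this]
    rw [Finset.sum_ite_eq']
    split_ifs with hb
    · rfl
    · rw [homogeneousComponent_eq_zero _ _ (by rw [Finset.mem_range] at hb; omega), mul_zero]
  · exact Finset.sum_eq_zero fun b _ => if_neg (by omega)

theorem rename_mul_apply (v w : Equiv.Perm σ) (f : MvPolynomial σ ℚ) :
    rename (v * w) f = rename v (rename w f) := by
  rw [rename_rename, Equiv.Perm.coe_mul]

end Apolar

/-! ### Antisymmetrization and Vandermonde polynomials -/

section Alternating

variable {σ : Type*} [Fintype σ] [DecidableEq σ]

/-- The sign of a permutation as a rational number. -/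
abbrev signQ (w : Equiv.Perm σ) : ℚ := ((Equiv.Perm.sign w : ℤ) : ℚ)

theorem signQ_mul (v w : Equiv.Perm σ) : signQ (v * w) = signQ v * signQ w := by
  simp [signQ]

theorem signQ_mul_self (w : Equiv.Perm σ) : signQ w * signQ w = 1 := by
  rw [signQ, ← Int.cast_mul, Int.units_coe_mul_self, Int.cast_one]

theorem signQ_inv (w : Equiv.Perm σ) : signQ w⁻¹ = signQ w := by
  simp [signQ]

/-- A polynomial on which permutations of the variables act by their sign. -/
def IsAlternating (f : MvPolynomial σ ℚ) : Prop :=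
  ∀ w : Equiv.Perm σ, rename w f = signQ w • f

/-- The sum of the signed permutations of a polynomial. -/
def antisymmetrize (f : MvPolynomial σ ℚ) : MvPolynomial σ ℚ :=
  ∑ w : Equiv.Perm σ, signQ w • rename w f

theorem isAlternating_antisymmetrize (f : MvPolynomial σ ℚ) :
    IsAlternating (antisymmetrize f) := by
  intro v
  rw [antisymmetrize, map_sum, Finset.smul_sum]
  refine Fintype.sum_equiv (Equiv.mulLeft v) _ _ fun w => ?_
  rw [map_smul, Equiv.coe_mulLeft, rename_mul_apply, signQ_mul, smul_smul, ← mul_assoc,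
    signQ_mul_self, one_mul]

/-- A nonzero alternating homogeneous polynomial of least degree: it divides every other
alternating polynomial. -/
structure IsVandermonde (D : MvPolynomial σ ℚ) (N : ℕ) : Prop where
  ne_zero : D ≠ 0
  isHomogeneous : D.IsHomogeneous N
  isAlternating : IsAlternating D
  dvd : ∀ f, IsAlternating f → D ∣ f

/-- Permutations are isometries. Moving w to the side of D costs a sign that cancels the sign in the
antisymmetrization, so all summands agree. -/
theorem apolar_antisymmetrize {D : MvPolynomial σ ℚ} (hD : IsAlternating D)
    (f : MvPolynomial σ ℚ) :
    apolar (antisymmetrize f) D = (Fintype.card σ).factorial * apolar f D := by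
  rw [antisymmetrize, map_sum, LinearMap.sum_apply]
  have : ∀ w : Equiv.Perm σ, apolar (signQ w • rename w f) D = apolar f D := by
    intro w
    have h := hD w⁻¹
    rw [map_smul, LinearMap.smul_apply, apolar_rename_left]
    change signQ w • apolar f (rename (w⁻¹ : Equiv.Perm σ) D) = _
    rw [h, map_smul, smul_smul, signQ_inv, signQ_mul_self, one_smul]
  simp_rw [this]
  rw [Finset.sum_const, Finset.card_univ, Fintype.card_perm, nsmul_eq_mul]

theorem isSymmetric_of_isAlternating_mul {D g : MvPolynomial σ ℚ} (hD : IsAlternating D)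
    (h0 : D ≠ 0) (h : IsAlternating (D * g)) : g.IsSymmetric := by
  intro w
  have h1 := h w
  rw [map_mul, hD w, smul_mul_assoc] at h1
  have h2 : signQ w ≠ 0 := fun h => by simpa [h] using signQ_mul_self w
  exact mul_left_cancel₀ h0 (smul_right_injective _ h2 h1)

theorem antisymmetrize_symmetric_mul {f : MvPolynomial σ ℚ} (hf : f.IsSymmetric)
    (g : MvPolynomial σ ℚ) : antisymmetrize (f * g) = f * antisymmetrize g := by
  rw [antisymmetrize, antisymmetrize, Finset.mul_sum]
  refine Finset.sum_congr rfl fun w _ => ?_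
  rw [map_mul, hf w, mul_smul_comm]

theorem antisymmetrize_isHomogeneous {f : MvPolynomial σ ℚ} {d : ℕ} (hf : f.IsHomogeneous d) :
    (antisymmetrize f).IsHomogeneous d := by
  refine (mem_homogeneousSubmodule _ _).1 (Submodule.sum_mem _ fun w _ => Submodule.smul_mem _ _ ?_)
  exact (mem_homogeneousSubmodule _ _).2 hf.rename_isHomogeneous

end Alternating

/-! ### Coinvariants and harmonic polynomials -/

section DividedDifference

variable {σ : Type*}

/-- A substitution that is trivial modulo d on the variables is trivial modulo d. With d = x_i - x_j
it is used for the transposition of i and j, where it makes divided differences polynomial, and for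
i ↦ j, where it is the factor theorem. -/
theorem dvd_sub_rename {d : MvPolynomial σ ℚ} {φ : σ → σ} (h : ∀ k, d ∣ X k - X (φ k))
    (u : MvPolynomial σ ℚ) : d ∣ u - rename φ u := by
  induction u using MvPolynomial.induction_on with
  | C a => simp
  | add p q hp hq =>
    rw [map_add, add_sub_add_comm]
    exact dvd_add hp hq
  | mul_X p k hp =>
    have : p * X k - rename φ (p * X k) = (p - rename φ p) * X k + rename φ p * (X k - X (φ k)) := by
      rw [map_mul, rename_X]; ring
    rw [this]
    exact dvd_add (hp.mul_right _) ((h k).mul_left _)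

variable [DecidableEq σ]

theorem sub_dvd_sub_rename_swap (i j : σ) (u : MvPolynomial σ ℚ) :
    (X i - X j) ∣ u - rename (Equiv.swap i j) u := by
  refine dvd_sub_rename (fun k => ?_) u
  by_cases hi : k = i
  · simp [hi]
  by_cases hj : k = j
  · subst hj
    rw [Equiv.swap_apply_right]
    exact ⟨-1, by ring⟩
  · simp [Equiv.swap_apply_of_ne_of_ne hi hj]

theorem sub_dvd_sub_rename_update (i j : σ) (u : MvPolynomial σ ℚ) :
    (X i - X j) ∣ u - rename (Function.update id i j) u := by
  refine dvd_sub_rename (fun k => ?_) u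
  by_cases hi : k = i
  · subst hi; simp
  · simp [hi]

end DividedDifference

/-! ### The coinvariant ideal, its orthogonal complement and the derivatives of the Vandermonde. -/

section Coinvariants

variable (σ : Type*) [Fintype σ]

/-- The ideal generated by the elementary symmetric polynomials of positive degree. -/
def coinvIdeal : Ideal (MvPolynomial σ ℚ) :=
  Ideal.span (Set.range fun d : ℕ => esymm σ ℚ (d + 1))

/-- The harmonic polynomials: the orthogonal complement of the coinvariant ideal. -/
def harm : Submodule ℚ (MvPolynomial σ ℚ) where
  carrier := {h | ∀ f ∈ coinvIdeal σ, apolar f h = 0}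
  add_mem' ha hb f hf := by rw [map_add, ha f hf, hb f hf, add_zero]
  zero_mem' f _ := map_zero _
  smul_mem' c x hx f hf := by rw [map_smul, hx f hf, smul_zero]

variable {σ}

theorem esymm_mem_coinvIdeal {d : ℕ} (hd : 1 ≤ d) : esymm σ ℚ d ∈ coinvIdeal σ :=
  Ideal.subset_span ⟨d - 1, by simp [Nat.sub_add_cancel hd]⟩

theorem isHomogeneous_esymm (d : ℕ) : (esymm σ ℚ d).IsHomogeneous d := by
  refine IsHomogeneous.sum _ _ _ fun s hs => ?_
  have := IsHomogeneous.prod s (fun i => (X i : MvPolynomial σ ℚ)) (fun _ => 1)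
    fun i _ => isHomogeneous_X _ _
  simpa [(Finset.mem_powersetCard.1 hs).2] using this

theorem disjoint_harm_coinvIdeal {f : MvPolynomial σ ℚ} (h : f ∈ harm σ) (hf : f ∈ coinvIdeal σ) :
    f = 0 :=
  apolar_self_eq_zero (h f hf)

theorem pderiv_mem_harm (i : σ) {h : MvPolynomial σ ℚ} (hh : h ∈ harm σ) :
    pderiv i h ∈ harm σ := fun f hf => by
  rw [← apolar_X_mul]
  exact hh _ (Ideal.mul_mem_left _ _ hf)

theorem homogeneousComponent_mem_coinvIdeal (d : ℕ) {f : MvPolynomial σ ℚ}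
    (hf : f ∈ coinvIdeal σ) : homogeneousComponent d f ∈ coinvIdeal σ := by
  have key : ∀ g, homogeneousComponent d (g * f) ∈ coinvIdeal σ := by
    rw [coinvIdeal] at hf
    induction hf using Submodule.span_induction with
    | mem x hx =>
      obtain ⟨k, rfl⟩ := hx
      intro g
      rw [mul_comm, homogeneousComponent_mul_of_isHomogeneous (isHomogeneous_esymm _)]
      split_ifs
      · exact Ideal.mul_mem_right _ _ (esymm_mem_coinvIdeal (by omega))
      · exact zero_mem _
    | zero => simp
    | add x y _ _ hx hy => intro g; rw [mul_add, map_add]; exact add_mem (hx g) (hy g)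
    | smul a x _ hx => intro g; rw [smul_eq_mul, ← mul_assoc]; exact hx _
  simpa using key 1

theorem homogeneousComponent_mem_harm (d : ℕ) {h : MvPolynomial σ ℚ} (hh : h ∈ harm σ) :
    homogeneousComponent d h ∈ harm σ := fun f hf => by
  rw [← apolar_homogeneousComponent]
  exact hh _ (homogeneousComponent_mem_coinvIdeal d hf)

theorem rename_mem_coinvIdeal {τ : Type*} [Fintype τ] (e : σ ≃ τ) {f : MvPolynomial σ ℚ}
    (hf : f ∈ coinvIdeal σ) : rename e f ∈ coinvIdeal τ := by
  have : coinvIdeal σ ≤ (coinvIdeal τ).comap (rename e) := by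
    refine Ideal.span_le.2 ?_
    rintro _ ⟨d, rfl⟩
    change rename e (esymm σ ℚ (d + 1)) ∈ coinvIdeal τ
    rw [rename_esymm]
    exact esymm_mem_coinvIdeal (by omega)
  exact this hf

theorem rename_mem_harm {τ : Type*} [Fintype τ] (e : σ ≃ τ) {h : MvPolynomial σ ℚ}
    (hh : h ∈ harm σ) : rename e h ∈ harm τ := fun f hf => by
  rw [apolar_comm, apolar_rename_left, apolar_comm]
  exact hh _ (rename_mem_coinvIdeal e.symm hf)

/-- Evaluate ∏(T + x_j) = ∑ e_d T^{n-d} at T = -x_i. The left side vanishes, and on the right every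
term except (-x_i)^n contains some e_d with d ≥ 1. -/
theorem X_pow_card_mem_coinvIdeal (i : σ) : X i ^ Fintype.card σ ∈ coinvIdeal σ := by
  have h := congrArg (Polynomial.eval (-X i)) (MvPolynomial.prod_C_add_X_eq_sum_esymm (R := ℚ) (σ := σ))
  rw [Polynomial.eval_prod, Finset.prod_eq_zero (Finset.mem_univ i) (by simp),
    Polynomial.eval_finsetSum, Finset.sum_range_succ'] at h
  simp only [Polynomial.eval_mul, Polynomial.eval_C, Polynomial.eval_pow, Polynomial.eval_X,
    esymm_zero, one_mul, Nat.sub_zero] at h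
  have h2 : (-X i : MvPolynomial σ ℚ) ^ Fintype.card σ ∈ coinvIdeal σ := by
    rw [← neg_eq_iff_add_eq_zero.2 h.symm]
    exact neg_mem (sum_mem fun d _ => Ideal.mul_mem_right _ _ (esymm_mem_coinvIdeal (by omega)))
  rw [neg_pow] at h2
  have h3 := Ideal.mul_mem_left _ ((-1) ^ Fintype.card σ) h2
  rwa [← mul_assoc, ← mul_pow, neg_one_mul, neg_neg, one_pow, one_mul] at h3

/-- A symmetric polynomial is a polynomial in e_1, …, e_n, and modulo the coinvariant ideal these
all vanish, so only the constant coefficient survives. -/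
theorem exists_sub_C_mem_coinvIdeal {g : MvPolynomial σ ℚ} (hg : g.IsSymmetric) :
    ∃ c : ℚ, g - C c ∈ coinvIdeal σ := by
  obtain ⟨P, hP⟩ := esymmAlgHom_surjective (R := ℚ) (σ := σ) le_rfl
    (⟨g, hg⟩ : symmetricSubalgebra σ ℚ)
  have h : aeval (fun i : Fin (Fintype.card σ) => esymm σ ℚ (i + 1)) P = g := by
    rw [← esymmAlgHom_apply, hP]
  refine ⟨constantCoeff P, ?_⟩
  rw [← h, ← Ideal.Quotient.eq]
  change Ideal.Quotient.mkₐ ℚ (coinvIdeal σ) _ = Ideal.Quotient.mkₐ ℚ (coinvIdeal σ) _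
  have h0 : (fun i : Fin (Fintype.card σ) =>
      Ideal.Quotient.mkₐ ℚ (coinvIdeal σ) (esymm σ ℚ (i + 1))) = fun _ => 0 := by
    funext i
    exact Ideal.Quotient.eq_zero_iff_mem.2 (esymm_mem_coinvIdeal (by omega))
  rw [← AlgHom.comp_apply, comp_aeval]
  change aeval (fun i : Fin (Fintype.card σ) =>
    Ideal.Quotient.mkₐ ℚ (coinvIdeal σ) (esymm σ ℚ (i + 1))) P = _
  rw [h0]
  have := MvPolynomial.aeval_zero' (σ := Fin (Fintype.card σ)) (R := ℚ)
    (S₁ := MvPolynomial σ ℚ ⧸ coinvIdeal σ) P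
  rw [this]
  exact ((Ideal.Quotient.mkₐ ℚ (coinvIdeal σ)).commutes _).symm

/-- The finitely many variables are nilpotent modulo the coinvariant ideal. This starts the
descending induction in `mem_coinvIdeal_of_apolar`. -/
theorem exists_maximal_pow_le_coinvIdeal :
    ∃ m : ℕ, Ideal.span (Set.range (X : σ → MvPolynomial σ ℚ)) ^ m ≤ coinvIdeal σ := by
  refine Ideal.exists_pow_le_of_le_radical_of_fg ?_ ?_
  · refine Ideal.span_le.2 ?_
    rintro _ ⟨i, rfl⟩
    exact ⟨_, X_pow_card_mem_coinvIdeal i⟩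
  · exact Submodule.fg_span (Set.finite_range _)

variable [DecidableEq σ]

/-- Divided differences are linear over the symmetric polynomials and so preserve the coinvariant
ideal. The divided difference of (x_i - x_j) u is u plus its image under the transposition. -/
theorem rename_sub_mem_coinvIdeal {i j : σ} (hij : i ≠ j) {u : MvPolynomial σ ℚ}
    (hu : (X i - X j) * u ∈ coinvIdeal σ) :
    u + rename (Equiv.swap i j) u ∈ coinvIdeal σ := by
  have key : ∀ f ∈ coinvIdeal σ, ∃ v ∈ coinvIdeal σ,
      f - rename (Equiv.swap i j) f = (X i - X j) * v := by
    intro f hf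
    have : ∀ g, ∃ v ∈ coinvIdeal σ,
        g * f - rename (Equiv.swap i j) (g * f) = (X i - X j) * v := by
      rw [coinvIdeal] at hf
      induction hf using Submodule.span_induction with
      | mem x hx =>
        obtain ⟨k, rfl⟩ := hx
        intro g
        obtain ⟨v, hv⟩ := sub_dvd_sub_rename_swap i j g
        refine ⟨v * esymm σ ℚ (k + 1), Ideal.mul_mem_left _ _ (esymm_mem_coinvIdeal (by omega)), ?_⟩
        simp only
        rw [map_mul, rename_esymm, ← mul_assoc, ← hv, sub_mul]
      | zero => exact fun g => ⟨0, zero_mem _, by simp⟩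
      | add x y _ _ hx hy =>
        intro g
        obtain ⟨v, hv, h1⟩ := hx g
        obtain ⟨w, hw, h2⟩ := hy g
        exact ⟨v + w, add_mem hv hw, by
          rw [mul_add, mul_add, map_add, add_sub_add_comm, h1, h2]⟩
      | smul a x _ hx => intro g; rw [smul_eq_mul, ← mul_assoc]; exact hx _
    simpa using this 1
  obtain ⟨v, hv, h⟩ := key _ hu
  have hne : (X i - X j : MvPolynomial σ ℚ) ≠ 0 := by
    rw [Ne, sub_eq_zero, X_inj]
    exact hij
  have : (X i - X j) * (u + rename (Equiv.swap i j) u) = (X i - X j) * v := by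
    rw [← h, map_mul, map_sub, rename_X, rename_X, Equiv.swap_apply_left, Equiv.swap_apply_right]
    ring
  rw [mul_left_cancel₀ hne this]
  exact hv

/-- By degree only the constant term of v contributes. -/
theorem apolar_vandermonde_mul {D : MvPolynomial σ ℚ} {N : ℕ} (hD : IsVandermonde D N)
    (v : MvPolynomial σ ℚ) : apolar (D * v) D = coeff 0 v * apolar D D := by

  have : apolar (D * v) D = apolar (D * v) (homogeneousComponent N D) := by
    rw [homogeneousComponent_eq_self hD.isHomogeneous]
  rw [this, ← apolar_homogeneousComponent,
    homogeneousComponent_mul_of_isHomogeneous hD.isHomogeneous, if_pos le_rfl, Nat.sub_self,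
    homogeneousComponent_zero, mul_comm, ← smul_eq_C_mul, map_smul, LinearMap.smul_apply,
    smul_eq_mul]

/-- The Vandermonde is harmonic. Pairing g e_k with D amounts, up to a factorial, to pairing its
antisymmetrization e_k · D u with D, and e_k u has no constant term. -/
theorem apolar_coinvIdeal_vandermonde {D : MvPolynomial σ ℚ} {N : ℕ} (hD : IsVandermonde D N)
    {f : MvPolynomial σ ℚ} (hf : f ∈ coinvIdeal σ) : apolar f D = 0 := by
  have key : ∀ g, apolar (g * f) D = 0 := by
    rw [coinvIdeal] at hf
    induction hf using Submodule.span_induction with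
    | mem x hx =>
      obtain ⟨k, rfl⟩ := hx
      intro g
      have h := apolar_antisymmetrize hD.isAlternating (g * esymm σ ℚ (k + 1))
      rw [mul_comm, antisymmetrize_symmetric_mul (esymm_isSymmetric _ _ _)] at h
      obtain ⟨u, hu⟩ := hD.dvd _ (isAlternating_antisymmetrize g)
      rw [hu, mul_left_comm, apolar_vandermonde_mul hD, ← constantCoeff_eq, map_mul,
        constantCoeff_eq, (isHomogeneous_esymm (k + 1)).coeff_eq_zero (by simp), zero_mul,
        zero_mul] at h
      have h2 : ((Fintype.card σ).factorial : ℚ) ≠ 0 := by positivity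
      simpa [h2, mul_comm] using h.symm
    | zero => simp
    | add x y _ _ hx hy => intro g; rw [mul_add, map_add, LinearMap.add_apply, hx, hy, add_zero]
    | smul a x _ hx => intro g; rw [smul_eq_mul, ← mul_assoc]; exact hx _
  simpa using key 1

/-- The hypothesis passes from f to (x_i - x_j) f, which lies in a higher power of the maximal
ideal. Once these products are known to be coinvariant, f is alternating modulo the ideal I, hence
congruent to a multiple of D. Its pairing with D vanishes, so the multiple is zero. -/
theorem mem_coinvIdeal_of_apolar {D : MvPolynomial σ ℚ} {N : ℕ} (hD : IsVandermonde D N)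
    {f : MvPolynomial σ ℚ} (hf : ∀ g, apolar (g * f) D = 0) : f ∈ coinvIdeal σ := by
  obtain ⟨m, hm⟩ := exists_maximal_pow_le_coinvIdeal (σ := σ)
  set 𝔪 := Ideal.span (Set.range (X : σ → MvPolynomial σ ℚ)) with h𝔪
  -- Descending induction on the power of 𝔪 that contains f; at k = m the membership is no
  -- condition.
  have key : ∀ k, ∀ f ∈ 𝔪 ^ (m - k), (∀ g, apolar (g * f) D = 0) → f ∈ coinvIdeal σ := by
    intro k
    induction k with
    | zero => exact fun f hf _ => hm hf
    | succ k ih =>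
      intro f hfm hf
      have hswap : ∀ i j : σ, i ≠ j → f + rename (Equiv.swap i j) f ∈ coinvIdeal σ := by
        intro i j hij
        refine rename_sub_mem_coinvIdeal hij (ih _ ?_ ?_)
        · have h1 : (X i - X j : MvPolynomial σ ℚ) ∈ 𝔪 :=
            sub_mem (Ideal.subset_span ⟨i, rfl⟩) (Ideal.subset_span ⟨j, rfl⟩)
          have h2 := Ideal.mul_mem_mul h1 hfm
          rw [← pow_succ'] at h2
          exact Ideal.pow_le_pow_right (by omega) h2
        · intro g
          rw [← mul_assoc]
          exact hf _
      -- Each transposition acts by -1 on f modulo I, so each permutation acts by its sign.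
      have hperm : ∀ w : Equiv.Perm σ, f - signQ w • rename w f ∈ coinvIdeal σ := by
        intro w
        induction w using Equiv.Perm.swap_induction_on with
        | one => simp [signQ]
        | swap_mul w x y hxy ihw =>
          have h1 := sub_mem (hswap x y hxy) (rename_mem_coinvIdeal (Equiv.swap x y) ihw)
          rw [map_sub, map_smul] at h1
          rw [signQ_mul, rename_mul_apply]
          have h2 : signQ (Equiv.swap x y) = -1 := by simp [signQ, Equiv.Perm.sign_swap hxy]
          rw [h2]
          convert h1 using 1
          rw [neg_one_mul, neg_smul]
          abel
      have hsum : ((Fintype.card σ).factorial : ℚ) • f - antisymmetrize f ∈ coinvIdeal σ := by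
        have := sum_mem (t := Finset.univ) fun w (_ : w ∈ Finset.univ) => hperm w
        rw [Finset.sum_sub_distrib, Finset.sum_const, Finset.card_univ, Fintype.card_perm,
          ← Nat.cast_smul_eq_nsmul ℚ] at this
        exact this
      obtain ⟨g, hg⟩ := hD.dvd _ (isAlternating_antisymmetrize f)
      have hgs : g.IsSymmetric := isSymmetric_of_isAlternating_mul hD.isAlternating hD.ne_zero
        (hg ▸ isAlternating_antisymmetrize f)
      -- The cofactor g of D is symmetric and hence constant modulo I, so |σ|! f is congruent to c
      -- D.
      obtain ⟨c, hc⟩ := exists_sub_C_mem_coinvIdeal hgs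
      have h1 : ((Fintype.card σ).factorial : ℚ) • f - c • D ∈ coinvIdeal σ := by
        have := add_mem hsum (Ideal.mul_mem_left _ D hc)
        rw [hg] at this
        convert this using 1
        rw [smul_eq_C_mul D c]
        ring
      have h2 := apolar_coinvIdeal_vandermonde hD h1
      have h3 : apolar f D = 0 := by simpa using hf 1
      rw [map_sub, map_smul, map_smul, LinearMap.sub_apply, LinearMap.smul_apply,
        LinearMap.smul_apply, h3, smul_zero, zero_sub, neg_eq_zero, smul_eq_mul,
        mul_eq_zero] at h2
      have h4 : c = 0 := h2.resolve_right fun h => hD.ne_zero (apolar_self_eq_zero h)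
      rw [h4, zero_smul, sub_zero, smul_eq_C_mul] at h1
      have h5 := Ideal.mul_mem_left _ (C ((Fintype.card σ).factorial : ℚ)⁻¹) h1
      rwa [← mul_assoc, ← C_mul, inv_mul_cancel₀ (by positivity), C_1, one_mul] at h5
  exact key m f (by simp) hf

/-- The smallest subspace that contains `D` and is closed under partial derivatives. -/
def derivSpan (D : MvPolynomial σ ℚ) : Submodule ℚ (MvPolynomial σ ℚ) :=
  sInf {W | D ∈ W ∧ ∀ i, ∀ f ∈ W, pderiv i f ∈ W}

omit [Fintype σ] [DecidableEq σ] in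
theorem self_mem_derivSpan (D : MvPolynomial σ ℚ) : D ∈ derivSpan D := by
  rw [derivSpan, Submodule.mem_sInf]
  exact fun W hW => hW.1

omit [Fintype σ] [DecidableEq σ] in
theorem pderiv_mem_derivSpan (i : σ) {D f : MvPolynomial σ ℚ} (hf : f ∈ derivSpan D) :
    pderiv i f ∈ derivSpan D := by
  rw [derivSpan, Submodule.mem_sInf] at hf ⊢
  exact fun W hW => hW.2 i f (hf W hW)

omit [Fintype σ] [DecidableEq σ] in
theorem derivSpan_le {D : MvPolynomial σ ℚ} {W : Submodule ℚ (MvPolynomial σ ℚ)} (h1 : D ∈ W)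
    (h2 : ∀ i, ∀ f ∈ W, pderiv i f ∈ W) : derivSpan D ≤ W :=
  sInf_le ⟨h1, h2⟩

-- Positivity makes the map from W to its dual injective, and finite dimension makes it surjective.
-- The projection of f represents the functional ⟨f, ·⟩ on W.
omit [Fintype σ] [DecidableEq σ] in
theorem exists_orthogonal_projection (W : Submodule ℚ (MvPolynomial σ ℚ)) [Module.Finite ℚ W]
    (f : MvPolynomial σ ℚ) : ∃ w ∈ W, ∀ v ∈ W, apolar (f - w) v = 0 := by
  let B : W →ₗ[ℚ] Module.Dual ℚ W := (apolar.domRestrict₁₂ W W)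
  have hB : Function.Injective B := by
    rw [injective_iff_map_eq_zero]
    intro w hw
    have : apolar (w : MvPolynomial σ ℚ) w = 0 := congrArg (fun F => F w) hw
    exact Subtype.ext (apolar_self_eq_zero this)
  have hB' : Function.Surjective B :=
    (LinearMap.injective_iff_surjective_of_finrank_eq_finrank Subspace.dual_finrank_eq.symm).1 hB
  obtain ⟨w, hw⟩ := hB' ((apolar f).domRestrict W)
  refine ⟨w, w.2, fun v hv => ?_⟩
  have : apolar (w : MvPolynomial σ ℚ) v = apolar f v := congrArg (fun F => F ⟨v, hv⟩) hw
  rw [map_sub, LinearMap.sub_apply, this, sub_self]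

theorem derivSpan_le_harm {D : MvPolynomial σ ℚ} {N : ℕ} (hD : IsVandermonde D N) :
    derivSpan D ≤ harm σ :=
  derivSpan_le (fun _ hf => apolar_coinvIdeal_vandermonde hD hf) fun i _ hf => pderiv_mem_harm i hf

omit [Fintype σ] [DecidableEq σ] in
theorem totalDegree_pderiv_le (i : σ) (f : MvPolynomial σ ℚ) :
    (pderiv i f).totalDegree ≤ f.totalDegree := by
  refine Finset.sup_le fun m hm => ?_
  rw [mem_support_iff, coeff_pderiv] at hm
  have h := le_totalDegree (mem_support_iff.2 (left_ne_zero_of_mul hm))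
  rw [Finsupp.sum_add_index' (fun _ => rfl) (fun _ _ _ => rfl)] at h
  exact (Nat.le_add_right _ _).trans h

theorem derivSpan_finite (D : MvPolynomial σ ℚ) : Module.Finite ℚ (derivSpan D) := by
  have : derivSpan D ≤ restrictTotalDegree σ ℚ D.totalDegree := by
    refine derivSpan_le ((mem_restrictTotalDegree _ _ _).2 le_rfl) fun i f hf => ?_
    rw [mem_restrictTotalDegree] at hf ⊢
    exact (totalDegree_pderiv_le _ _).trans hf
  exact Module.Finite.of_injective _ (Submodule.inclusion_injective this)

/-- Project f orthogonally onto the span of the derivatives of D. By adjointness, every multiple of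
the remainder is orthogonal to D, so the remainder is coinvariant. -/
theorem exists_sub_mem_coinvIdeal_of_isVandermonde {D : MvPolynomial σ ℚ} {N : ℕ}
    (hD : IsVandermonde D N) (f : MvPolynomial σ ℚ) :
    ∃ w ∈ derivSpan D, f - w ∈ coinvIdeal σ := by
  have := derivSpan_finite D
  obtain ⟨w, hw, h⟩ := exists_orthogonal_projection (derivSpan D) f
  refine ⟨w, hw, mem_coinvIdeal_of_apolar hD fun g => ?_⟩
  have key : ∀ v ∈ derivSpan D, apolar (g * (f - w)) v = 0 := by
    induction g using MvPolynomial.induction_on with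
    | C a => intro v hv; rw [← smul_eq_C_mul, map_smul, LinearMap.smul_apply, h v hv, smul_zero]
    | add p q hp hq =>
      intro v hv
      rw [add_mul, map_add, LinearMap.add_apply, hp v hv, hq v hv, add_zero]
    | mul_X p i hp =>
      intro v hv
      rw [mul_comm p, mul_assoc, apolar_X_mul]
      exact hp _ (pderiv_mem_derivSpan i hv)
  exact key D (self_mem_derivSpan D)

/-- The derivatives of D are harmonic and already span a complement of the coinvariant ideal, while
a harmonic polynomial in that ideal is zero. -/
theorem harm_eq_derivSpan {D : MvPolynomial σ ℚ} {N : ℕ} (hD : IsVandermonde D N) :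
    harm σ = derivSpan D := by
  refine le_antisymm (fun h hh => ?_) (derivSpan_le_harm hD)
  obtain ⟨w, hw, hi⟩ := exists_sub_mem_coinvIdeal_of_isVandermonde hD h
  have := disjoint_harm_coinvIdeal (sub_mem hh (derivSpan_le_harm hD hw)) hi
  rw [sub_eq_zero.1 this]
  exact hw

end Coinvariants

/-! ### Existence of a Vandermonde polynomial over every finite set of variables. -/

section Existence

variable {σ τ : Type*} [Fintype σ] [DecidableEq σ] [Fintype τ] [DecidableEq τ]

theorem rename_rename_symm_permCongr (e : σ ≃ τ) (w : Equiv.Perm τ) (f : MvPolynomial σ ℚ) :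
    rename w (rename e f) = rename e (rename (e.symm.permCongr w) f) := by
  rw [rename_rename, rename_rename]
  congr 1
  congr 1
  funext i
  simp [Equiv.permCongr_apply]

theorem signQ_permCongr (e : σ ≃ τ) (w : Equiv.Perm σ) : signQ (e.permCongr w) = signQ w := by
  simp [signQ]

theorem IsAlternating.rename {f : MvPolynomial σ ℚ} (hf : IsAlternating f) (e : σ ≃ τ) :
    IsAlternating (rename e f) := fun w => by
  rw [rename_rename_symm_permCongr, hf, map_smul, signQ_permCongr]

theorem IsVandermonde.rename {D : MvPolynomial σ ℚ} {N : ℕ} (hD : IsVandermonde D N)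
    (e : σ ≃ τ) : IsVandermonde (MvPolynomial.rename e D) N where
  ne_zero h := hD.ne_zero (rename_injective _ e.injective (by rw [h, map_zero]))
  isHomogeneous := hD.isHomogeneous.rename_isHomogeneous
  isAlternating := hD.isAlternating.rename e
  dvd f hf := by
    obtain ⟨g, hg⟩ := hD.dvd _ (hf.rename e.symm)
    refine ⟨MvPolynomial.rename e g, ?_⟩
    rw [← map_mul, ← hg, rename_rename]
    simp

/-- The exponent vector `(k-1, …, 1, 0)`. -/
def staircase (k : ℕ) : Fin k →₀ ℕ :=
  Finsupp.equivFunOnFinite.symm fun i => k - 1 - i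

theorem staircase_injective (k : ℕ) : Function.Injective (staircase k) := by
  intro i j h
  have : k - 1 - (i : ℕ) = k - 1 - j := h
  exact Fin.ext (by omega)

/-- The Vandermonde determinant in `k` variables. -/
def vandermonde (k : ℕ) : MvPolynomial (Fin k) ℚ :=
  antisymmetrize (monomial (staircase k) 1)

/-- The entries of the staircase are distinct, so only the identity permutation fixes it. In
particular the Vandermonde is not zero. -/
theorem coeff_vandermonde (k : ℕ) : coeff (staircase k) (vandermonde k) = 1 := by
  rw [vandermonde, antisymmetrize, coeff_sum, Finset.sum_eq_single 1]
  · simp [signQ]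
  · intro w _ hw
    rw [rename_monomial, coeff_smul, coeff_monomial, if_neg, smul_zero]
    intro h
    refine hw (Equiv.ext fun i => staircase_injective k ?_)
    have := Finsupp.mapDomain_apply w.injective (staircase k) i
    rw [h] at this
    exact this
  · simp

/-- The product of all differences of variables. -/
def diffProd (S : Finset (σ × σ)) : MvPolynomial σ ℚ := ∏ p ∈ S, (X p.1 - X p.2)

/-- Add one factor x_i - x_j at a time. Setting x_i = x_j kills the alternating f but none of the
other differences, hence it kills the cofactor, which is then divisible by x_i - x_j. -/
theorem diffProd_dvd_of_isAlternating [LinearOrder σ] {f : MvPolynomial σ ℚ}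
    (hf : IsAlternating f) (S : Finset (σ × σ)) (hS : ∀ p ∈ S, p.1 < p.2) : diffProd S ∣ f := by
  induction S using Finset.induction_on with
  | empty => simp [diffProd]
  | insert p S hp ih =>
    obtain ⟨g, hg⟩ := ih fun q hq => hS q (Finset.mem_insert_of_mem hq)
    have hlt := hS p (Finset.mem_insert_self _ _)
    set φ := Function.update id p.1 p.2 with hφ
    have h1 : MvPolynomial.rename φ f = 0 := by
      have h2 := congrArg (MvPolynomial.rename φ) (hf (Equiv.swap p.1 p.2))
      -- The substitution does not notice the transposition, which changes the sign of f; so the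
      -- image of f equals its own negative.
      have h3 : φ ∘ Equiv.swap p.1 p.2 = φ := by
        funext k
        by_cases h : k = p.1
        · subst h; simp [hφ, Function.update_of_ne hlt.ne']
        by_cases h' : k = p.2
        · subst h'; simp [hφ, Function.update_of_ne hlt.ne']
        · simp [Equiv.swap_apply_of_ne_of_ne h h']
      have h4 : signQ (Equiv.swap p.1 p.2) = -1 := by
        simp [signQ, Equiv.Perm.sign_swap hlt.ne]
      rw [rename_rename, h3, h4, map_smul, neg_one_smul] at h2
      exact self_eq_neg.1 h2
    have h5 : MvPolynomial.rename φ (diffProd S) ≠ 0 := by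
      rw [diffProd, map_prod, Finset.prod_ne_zero_iff]
      intro q hq
      rw [map_sub, rename_X, rename_X, Ne, sub_eq_zero, X_inj]
      have hq' := hS q (Finset.mem_insert_of_mem hq)
      have hne : q ≠ p := fun h => hp (h ▸ hq)
      simp only [hφ, Function.update_apply, id]
      split_ifs with h6 h7 h7
      · exact fun _ => hq'.ne (h6.trans h7.symm)
      · exact fun h => hne (Prod.ext h6 h.symm)
      · intro h
        rw [h, h7] at hq'
        exact lt_asymm hq' hlt
      · exact hq'.ne
    rw [hg, map_mul] at h1
    obtain ⟨u, hu⟩ := sub_dvd_sub_rename_update p.1 p.2 g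
    rw [← hφ, (mul_eq_zero.1 h1).resolve_left h5, sub_zero] at hu
    rw [diffProd, Finset.prod_insert hp, hg, hu]
    exact ⟨u, by rw [diffProd]; ring⟩

theorem diffProd_isHomogeneous (S : Finset (σ × σ)) : (diffProd S).IsHomogeneous S.card := by
  have := IsHomogeneous.prod S (fun p => (X p.1 - X p.2 : MvPolynomial σ ℚ)) (fun _ => 1)
    fun p _ => (isHomogeneous_X _ _).sub (isHomogeneous_X _ _)
  simpa [diffProd] using this

theorem degree_staircase (k : ℕ) : (staircase k).degree =
    (Finset.univ.filter fun p : Fin k × Fin k => p.1 < p.2).card := by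
  rw [Finsupp.degree_eq_sum, Finset.card_filter, Fintype.sum_prod_type]
  refine Finset.sum_congr rfl fun i _ => ?_
  rw [← Finset.card_filter, Finset.filter_lt_eq_Ioi, Fin.card_Ioi]
  rfl

/-- The product of the differences divides the antisymmetrized staircase monomial and has the same
degree, so they differ by a nonzero constant. -/
theorem isVandermonde_vandermonde (k : ℕ) :
    IsVandermonde (vandermonde k) (staircase k).degree := by
  have h0 : vandermonde k ≠ 0 := fun h => by simpa [h] using coeff_vandermonde k
  have hh : (vandermonde k).IsHomogeneous (staircase k).degree :=
    antisymmetrize_isHomogeneous (isHomogeneous_monomial _ rfl)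
  have ha := isAlternating_antisymmetrize (monomial (staircase k) (1 : ℚ))
  refine ⟨h0, hh, ha, fun f hf => ?_⟩
  set S := Finset.univ.filter fun p : Fin k × Fin k => p.1 < p.2 with hSdef
  have hS : ∀ p ∈ S, p.1 < p.2 := fun p hp => (Finset.mem_filter.1 hp).2
  obtain ⟨c, hc⟩ := diffProd_dvd_of_isAlternating ha S hS
  change vandermonde k = _ at hc
  have hne : diffProd S ≠ 0 ∧ c ≠ 0 := mul_ne_zero_iff.1 (hc ▸ h0)
  have hdeg : c.totalDegree = 0 := by
    have h1 := totalDegree_mul_of_isDomain hne.1 hne.2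
    rw [← hc, hh.totalDegree h0, (diffProd_isHomogeneous S).totalDegree hne.1,
      degree_staircase, ← hSdef] at h1
    omega
  obtain ⟨a, rfl⟩ : ∃ a, c = C a := ⟨_, totalDegree_eq_zero_iff_eq_C.1 hdeg⟩
  have ha0 : a ≠ 0 := fun h => hne.2 (by rw [h, C_0])
  rw [hc]
  exact (IsUnit.mul_right_dvd ((IsUnit.mk0 a ha0).map C)).2 (diffProd_dvd_of_isAlternating hf S hS)

variable (σ) in
theorem exists_isVandermonde : ∃ (D : MvPolynomial σ ℚ) (N : ℕ), IsVandermonde D N :=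
  ⟨_, _, (isVandermonde_vandermonde (Fintype.card σ)).rename (Fintype.equivFin σ).symm⟩

theorem exists_harm_sub_mem_coinvIdeal (f : MvPolynomial σ ℚ) :
    ∃ h ∈ harm σ, f - h ∈ coinvIdeal σ := by
  obtain ⟨D, N, hD⟩ := exists_isVandermonde σ
  obtain ⟨w, hw, h⟩ := exists_sub_mem_coinvIdeal_of_isVandermonde hD f
  exact ⟨w, derivSpan_le_harm hD hw, h⟩

end Existence

/-! ### Traces through direct sum decompositions -/

section Trace

variable {V : Type*} [AddCommGroup V] [Module ℚ V] [Module.Finite ℚ V] {ι : Type*} [Fintype ι]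
  {W : ι → Type*} [∀ x, AddCommGroup (W x)] [∀ x, Module ℚ (W x)] [∀ x, Module.Finite ℚ (W x)]

/-- Only ∑ inc ∘ prj = id is needed, by cyclicity of the trace; nothing is assumed about prj x ∘ inc
y. -/
theorem trace_eq_sum_of_sum_comp_eq_id (inc : ∀ x, W x →ₗ[ℚ] V) (prj : ∀ x, V →ₗ[ℚ] W x)
    (h : ∑ x, inc x ∘ₗ prj x = LinearMap.id) (f : V →ₗ[ℚ] V) :
    LinearMap.trace ℚ V f = ∑ x, LinearMap.trace ℚ (W x) (prj x ∘ₗ f ∘ₗ inc x) := by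
  have h1 : f = ∑ x, (f ∘ₗ inc x) ∘ₗ prj x := by
    conv_lhs => rw [← LinearMap.comp_id f, ← h]
    ext v
    simp [LinearMap.sum_apply]
  conv_lhs => rw [h1]
  rw [map_sum]
  exact Finset.sum_congr rfl fun x _ => LinearMap.trace_comp_comm' _ _

theorem trace_eq_sum_of_bijective [DecidableEq ι] (inc : ∀ x, W x →ₗ[ℚ] V)
    (hb : Function.Bijective fun v : ∀ x, W x => ∑ x, inc x (v x))
    (f : V →ₗ[ℚ] V) (g : ∀ x, W x →ₗ[ℚ] W x) (hfg : ∀ x v, f (inc x v) = inc x (g x v)) :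
    LinearMap.trace ℚ V f = ∑ x, LinearMap.trace ℚ (W x) (g x) := by
  let Φ : (∀ x, W x) →ₗ[ℚ] V := ∑ x, inc x ∘ₗ LinearMap.proj x
  have hΦ : ∀ v, Φ v = ∑ x, inc x (v x) := fun v => by simp [Φ]
  let e : (∀ x, W x) ≃ₗ[ℚ] V := LinearEquiv.ofBijective Φ (by
    convert hb using 1
    exact funext hΦ)
  have he : ∀ v, e v = ∑ x, inc x (v x) := hΦ
  rw [trace_eq_sum_of_sum_comp_eq_id inc fun x => LinearMap.proj x ∘ₗ e.symm.toLinearMap]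
  · refine Finset.sum_congr rfl fun x _ => congrArg _ (LinearMap.ext fun v => ?_)
    have h1 : e (Pi.single x (g x v)) = inc x (g x v) := by
      rw [he, Finset.sum_eq_single x]
      · simp
      · intro y _ hy
        rw [Pi.single_eq_of_ne hy, map_zero]
      · simp
    simp only [LinearMap.comp_apply, hfg, ← h1, LinearEquiv.coe_coe, LinearEquiv.symm_apply_apply,
      LinearMap.proj_apply, Pi.single_eq_same]
  · refine LinearMap.ext fun v => ?_
    obtain ⟨u, rfl⟩ := e.surjective v
    simp only [LinearMap.sum_apply, LinearMap.comp_apply, LinearEquiv.coe_coe,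
      LinearEquiv.symm_apply_apply, LinearMap.proj_apply, LinearMap.id_apply]
    exact (he u).symm

end Trace

/-! ### Weighted compositions -/

section Weighted

variable {ι : Type*} [Fintype ι] [DecidableEq ι]

/-- The functions `b` with `∑ i, c i * b i = m`, for positive weights `c`. -/
def weightedFinset (c : ι → ℕ) (m : ℕ) : Finset (ι → ℕ) :=
  (Fintype.piFinset fun _ => Finset.range (m + 1)).filter fun b => ∑ i, c i * b i = m

theorem mem_weightedFinset {c : ι → ℕ} (hc : ∀ i, 1 ≤ c i) {m : ℕ} {b : ι → ℕ} :
    b ∈ weightedFinset c m ↔ ∑ i, c i * b i = m := by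
  rw [weightedFinset, Finset.mem_filter, and_iff_right_iff_imp, Fintype.mem_piFinset]
  rintro rfl i
  rw [Finset.mem_range, Nat.lt_succ_iff]
  calc b i ≤ c i * b i := Nat.le_mul_of_pos_left _ (hc i)
    _ ≤ _ := Finset.single_le_sum (f := fun i => c i * b i) (fun _ _ => Nat.zero_le _)
      (Finset.mem_univ i)

/-- The geometric series `1 / (1 - q^k)`. -/
def geomSeries (R : Type*) [CommRing R] (k : ℕ) : PowerSeries R :=
  PowerSeries.mk fun m => if k ∣ m then 1 else 0

theorem one_sub_X_pow_mul_geomSeries (R : Type*) [CommRing R] {k : ℕ} (hk : 1 ≤ k) :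
    (1 - PowerSeries.X ^ k) * geomSeries R k = 1 := by
  ext m
  rw [sub_mul, one_mul, map_sub, geomSeries, PowerSeries.coeff_mk, PowerSeries.coeff_X_pow_mul',
    PowerSeries.coeff_one]
  by_cases hm : k ≤ m
  · rw [if_pos hm, PowerSeries.coeff_mk, if_neg (by omega : m ≠ 0)]
    have : k ∣ m - k ↔ k ∣ m := by
      conv_rhs => rw [← Nat.sub_add_cancel hm, Nat.dvd_add_self_right]
    simp [this]
  · rw [if_neg hm, sub_zero]
    rcases Nat.eq_zero_or_pos m with rfl | h0
    · simp
    · rw [if_neg (Nat.not_dvd_of_pos_of_lt h0 (not_le.1 hm)), if_neg h0.ne']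

theorem coeff_prod_geomSeries (R : Type*) [CommRing R] {c : ι → ℕ} (hc : ∀ i, 1 ≤ c i) (m : ℕ) :
    PowerSeries.coeff m (∏ i, geomSeries R (c i)) = (weightedFinset c m).card := by
  rw [PowerSeries.coeff_prod]
  simp only [geomSeries, PowerSeries.coeff_mk]
  simp_rw [Finset.prod_ite_zero, Finset.prod_const_one]
  rw [Finset.sum_boole]
  congr 1
  refine Finset.card_bij' (fun l _ i => l i / c i)
    (fun b _ => Finsupp.equivFunOnFinite.symm fun i => c i * b i) ?_ ?_ ?_ ?_
  · intro l hl
    rw [Finset.mem_filter, Finset.mem_finsuppAntidiag] at hl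
    rw [mem_weightedFinset hc, ← hl.1.1]
    exact Finset.sum_congr rfl fun i _ => Nat.mul_div_cancel' (hl.2 i (Finset.mem_univ i))
  · intro b hb
    rw [mem_weightedFinset hc] at hb
    rw [Finset.mem_filter, Finset.mem_finsuppAntidiag]
    exact ⟨⟨hb, Finset.subset_univ _⟩, fun i _ => ⟨b i, rfl⟩⟩
  · intro l hl
    ext i
    exact Nat.mul_div_cancel' ((Finset.mem_filter.1 hl).2 i (Finset.mem_univ i))
  · intro b _
    funext i
    exact Nat.mul_div_cancel_left _ (hc i)

end Weighted

/-! ### Orbits of a permutation and its cycle type -/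

section Orbits

variable {τ : Type*} [Fintype τ] [DecidableEq τ] (w : Equiv.Perm τ)

/-- The orbits of a permutation. -/
abbrev Orbit : Type _ := Quotient (Equiv.Perm.SameCycle.setoid w)

instance : DecidableEq (Orbit w) := Classical.decEq _

instance : Fintype (Orbit w) := Fintype.ofFinite _

/-- The number of elements of an orbit. -/
def orbitCard (o : Orbit w) : ℕ := (Finset.univ.filter fun x : τ => (⟦x⟧ : Orbit w) = o).card

theorem orbit_eq_iff {x y : τ} : (⟦x⟧ : Orbit w) = ⟦y⟧ ↔ w.SameCycle x y := Quotient.eq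

theorem one_le_orbitCard (o : Orbit w) : 1 ≤ orbitCard w o := by
  rw [orbitCard, Nat.one_le_iff_ne_zero, Finset.card_ne_zero]
  exact ⟨o.out, by simp⟩

theorem orbitCard_of_apply_ne {x : τ} (h : w x ≠ x) :
    orbitCard w ⟦x⟧ = (w.cycleOf x).support.card := by
  rw [orbitCard]
  congr 1
  ext y
  rw [Finset.mem_filter, orbit_eq_iff, Equiv.Perm.mem_support_cycleOf_iff]
  simp only [Finset.mem_univ, true_and, Equiv.Perm.mem_support]
  exact ⟨fun hy => ⟨hy.symm, h⟩, fun hy => hy.1.symm⟩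

theorem orbitCard_of_apply_eq {x : τ} (h : w x = x) : orbitCard w ⟦x⟧ = 1 := by
  rw [orbitCard, Finset.card_eq_one]
  refine ⟨x, ?_⟩
  ext y
  rw [Finset.mem_filter, orbit_eq_iff, Finset.mem_singleton]
  simp only [Finset.mem_univ, true_and]
  refine ⟨fun hy => ?_, fun hy => hy ▸ Equiv.Perm.SameCycle.refl _ _⟩
  obtain ⟨i, hi⟩ := hy.symm
  rw [← hi, Equiv.Perm.zpow_apply_eq_self_of_apply_eq_self h]

/-- The nontrivial orbits correspond to the cycle factors, and the orbits of size one to the fixed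
points, which are the parts 1 added to the cycle type. -/
theorem prod_orbit_eq_prod_parts {M : Type*} [CommMonoid M] (F : ℕ → M) :
    ∏ o : Orbit w, F (orbitCard w o) = (w.partition.parts.map F).prod := by
  rw [Equiv.Perm.parts_partition, Multiset.map_add, Multiset.prod_add, Multiset.map_replicate,
    Multiset.prod_replicate, ← Finset.prod_filter_mul_prod_filter_not _
      fun o : Orbit w => w o.out ≠ o.out]
  congr 1
  · rw [Equiv.Perm.cycleType_def, Multiset.map_map]
    change _ = ∏ c ∈ w.cycleFactorsFinset, F c.support.card
    refine Finset.prod_bij (fun o _ => w.cycleOf o.out) ?_ ?_ ?_ ?_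
    · intro o ho
      rw [Equiv.Perm.cycleOf_mem_cycleFactorsFinset_iff, Equiv.Perm.mem_support]
      exact (Finset.mem_filter.1 ho).2
    · intro o ho o' ho' h
      rw [← o.out_eq, ← o'.out_eq, orbit_eq_iff]
      have h1 : o.out ∈ (w.cycleOf o'.out).support := by
        rw [← h, Equiv.Perm.mem_support_cycleOf_iff, Equiv.Perm.mem_support]
        exact ⟨Equiv.Perm.SameCycle.refl _ _, (Finset.mem_filter.1 ho).2⟩
      exact ((Equiv.Perm.mem_support_cycleOf_iff.1 h1).1).symm
    · intro c hc
      obtain ⟨x, hx⟩ := ((Equiv.Perm.mem_cycleFactorsFinset_iff.1 hc).1).nonempty_support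
      have hcx := Equiv.Perm.cycle_is_cycleOf hx hc
      have hs : w.SameCycle (⟦x⟧ : Orbit w).out x := (orbit_eq_iff w).1 (Quotient.out_eq _)
      refine ⟨⟦x⟧, ?_, ?_⟩
      · rw [Finset.mem_filter]
        refine ⟨Finset.mem_univ _, ?_⟩
        have hwx : x ∈ w.support := Equiv.Perm.mem_cycleFactorsFinset_support_le hc hx
        rw [Equiv.Perm.mem_support] at hwx
        exact fun h => hwx (hs.apply_eq_self_iff.1 h)
      · rw [hs.cycleOf_eq, hcx]
    · intro o ho
      conv_lhs => rw [← o.out_eq]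
      rw [orbitCard_of_apply_ne w (Finset.mem_filter.1 ho).2]
  · have h1 : ∀ o ∈ Finset.univ.filter (fun o : Orbit w => ¬ w o.out ≠ o.out),
        F (orbitCard w o) = F 1 := by
      intro o ho
      have := not_not.1 (Finset.mem_filter.1 ho).2
      conv_lhs => rw [← o.out_eq, orbitCard_of_apply_eq w this]
    rw [Finset.prod_congr rfl h1, Finset.prod_const]
    congr 1
    rw [← Finset.card_compl]
    refine Finset.card_bij' (fun o _ => o.out) (fun x _ => ⟦x⟧) ?_ ?_ ?_ ?_
    · intro o ho
      simpa using ho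
    · intro x hx
      rw [Finset.mem_compl, Equiv.Perm.notMem_support] at hx
      have hs : w.SameCycle (⟦x⟧ : Orbit w).out x := (orbit_eq_iff w).1 (Quotient.out_eq _)
      simpa using hs.apply_eq_self_iff.2 hx
    · intro o _
      exact o.out_eq
    · intro x hx
      rw [Finset.mem_compl, Equiv.Perm.notMem_support] at hx
      have hs : w.SameCycle x (⟦x⟧ : Orbit w).out := ((orbit_eq_iff w).1 (Quotient.out_eq _)).symm
      obtain ⟨i, hi⟩ := hs
      rw [← hi, Equiv.Perm.zpow_apply_eq_self_of_apply_eq_self hx]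

/-- The number of exponent vectors of degree `d` that are fixed by a permutation. -/
theorem card_fixed_exponents (R : Type*) [CommRing R] (d : ℕ) :
    (((Finset.finsuppAntidiag (Finset.univ : Finset τ) d).filter
      fun a => Finsupp.mapDomain w a = a).card : R) =
    PowerSeries.coeff d (w.partition.parts.map (geomSeries R)).prod := by
  rw [← prod_orbit_eq_prod_parts, coeff_prod_geomSeries R (one_le_orbitCard w)]
  congr 1
  have hdeg : ∀ b : Orbit w → ℕ, ∑ x : τ, b ⟦x⟧ = ∑ o, orbitCard w o * b o := by
    intro b
    rw [← Finset.sum_fiberwise (s := Finset.univ) (g := fun x : τ => (⟦x⟧ : Orbit w))]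
    refine Finset.sum_congr rfl fun o _ => ?_
    rw [Finset.sum_congr rfl (fun x hx => by rw [(Finset.mem_filter.1 hx).2] :
      ∀ x ∈ Finset.univ.filter (fun x : τ => (⟦x⟧ : Orbit w) = o), b ⟦x⟧ = b o),
      Finset.sum_const, smul_eq_mul, orbitCard]
  -- A fixed exponent vector is constant on orbits, so it is a function b on the orbits, and its
  -- degree is the sum of b weighted by the orbit sizes.
  have hfix : ∀ a : τ →₀ ℕ, Finsupp.mapDomain w a = a → ∀ x y, w.SameCycle x y → a x = a y := by
    intro a ha x y hxy
    have h1 : ∀ x, a (w x) = a x := fun x => by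
      conv_lhs => rw [← ha]
      exact Finsupp.mapDomain_apply w.injective a x
    obtain ⟨i, rfl⟩ := hxy
    have h2 : ∀ (k : ℕ) x, a ((w ^ k) x) = a x := by
      intro k
      induction k with
      | zero => simp
      | succ k ih => intro x; rw [pow_succ, Equiv.Perm.mul_apply, ih, h1]
    cases i with
    | ofNat k => exact (h2 k x).symm
    | negSucc k =>
      rw [zpow_negSucc]
      conv_lhs => rw [← Equiv.apply_symm_apply (w ^ (k + 1)) x]
      exact h2 _ _
  refine Finset.card_bij' (fun a _ o => a o.out)
    (fun b _ => Finsupp.equivFunOnFinite.symm fun x => b ⟦x⟧) ?_ ?_ ?_ ?_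
  · intro a ha
    rw [Finset.mem_filter, Finset.mem_finsuppAntidiag] at ha
    rw [mem_weightedFinset (one_le_orbitCard w), ← hdeg fun o => a o.out, ← ha.1.1]
    refine Finset.sum_congr rfl fun x _ => hfix a ha.2 _ _ ?_
    exact (orbit_eq_iff w).1 (Quotient.out_eq _)
  · intro b hb
    rw [mem_weightedFinset (one_le_orbitCard w), ← hdeg] at hb
    rw [Finset.mem_filter, Finset.mem_finsuppAntidiag]
    refine ⟨⟨hb, Finset.subset_univ _⟩, ?_⟩
    ext x
    obtain ⟨y, rfl⟩ := w.surjective x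
    rw [Finsupp.mapDomain_apply w.injective]
    have : (⟦y⟧ : Orbit w) = ⟦w y⟧ :=
      (orbit_eq_iff w).2 (Equiv.Perm.SameCycle.refl w y).apply_right
    change b ⟦y⟧ = b ⟦w y⟧
    rw [this]
  · intro a ha
    ext x
    exact hfix a (Finset.mem_filter.1 ha).2 _ _ ((orbit_eq_iff w).1 (Quotient.out_eq _))
  · intro b _
    funext o
    exact congrArg b o.out_eq

end Orbits

/-! ### Polynomials as a free module over the symmetric polynomials -/

section Decomposition

variable (σ : Type*) [Fintype σ]

/-- The harmonic polynomials that are homogeneous of degree `d`. -/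
def harmPiece (d : ℕ) : Submodule ℚ (MvPolynomial σ ℚ) := harm σ ⊓ homogeneousSubmodule σ ℚ d

instance (d : ℕ) : Module.Finite ℚ (homogeneousSubmodule σ ℚ d) :=
  Module.Finite.iff_fg.2 (homogeneousSubmodule_fg σ ℚ d)

instance (d : ℕ) : Module.Finite ℚ (harmPiece σ d) :=
  Module.Finite.of_injective (Submodule.inclusion inf_le_right)
    (Submodule.inclusion_injective (inf_le_right : harmPiece σ d ≤ homogeneousSubmodule σ ℚ d))

/-- The degree of the product of elementary symmetric polynomials with exponents `a`. -/
def esymmWeight (a : Fin (Fintype.card σ) → ℕ) : ℕ :=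
  ∑ i : Fin (Fintype.card σ), (i + 1 : ℕ) * a i

/-- A product of powers of elementary symmetric polynomials. -/
def esymmProd (a : Fin (Fintype.card σ) → ℕ) : MvPolynomial σ ℚ :=
  ∏ i : Fin (Fintype.card σ), esymm σ ℚ (i + 1) ^ a i

variable {σ}

theorem isHomogeneous_esymmProd (a : Fin (Fintype.card σ) → ℕ) :
    (esymmProd σ a).IsHomogeneous (esymmWeight σ a) :=
  IsHomogeneous.prod _ _ _ fun _ _ => (isHomogeneous_esymm _).pow _

theorem isSymmetric_esymmProd (a : Fin (Fintype.card σ) → ℕ) : (esymmProd σ a).IsSymmetric := by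
  intro w
  rw [esymmProd, map_prod]
  simp_rw [map_pow, rename_esymm]

theorem esymmProd_add_single [DecidableEq σ] (a : Fin (Fintype.card σ) → ℕ)
    (i : Fin (Fintype.card σ)) :
    esymmProd σ (a + Pi.single i 1) = esymm σ ℚ (i + 1) * esymmProd σ a := by
  rw [esymmProd, esymmProd]
  simp_rw [Pi.add_apply, pow_add]
  rw [Finset.prod_mul_distrib, mul_comm]
  congr 1
  rw [Finset.prod_eq_single i]
  · simp
  · intro j _ hj
    simp [hj]
  · simp

theorem esymmWeight_add_single (a : Fin (Fintype.card σ) → ℕ) (i : Fin (Fintype.card σ)) :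
    esymmWeight σ (a + Pi.single i 1) = esymmWeight σ a + (i + 1) := by
  rw [esymmWeight, esymmWeight]
  simp_rw [Pi.add_apply, mul_add]
  rw [Finset.sum_add_distrib]
  congr 1
  rw [Finset.sum_eq_single i]
  · simp
  · intro j _ hj
    simp [hj]
  · simp

/-- This is the algebraic independence of e_1, …, e_n. -/
theorem sum_smul_esymmProd_eq_zero {T : Finset (Fin (Fintype.card σ) → ℕ)}
    {c : (Fin (Fintype.card σ) → ℕ) → ℚ} (h : ∑ a ∈ T, c a • esymmProd σ a = 0) :
    ∀ a ∈ T, c a = 0 := by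
  classical
  let e : (Fin (Fintype.card σ) →₀ ℕ) ≃ (Fin (Fintype.card σ) → ℕ) := Finsupp.equivFunOnFinite
  let P : MvPolynomial (Fin (Fintype.card σ)) ℚ := ∑ a ∈ T, monomial (e.symm a) (c a)
  have hP : esymmAlgHom σ ℚ (Fintype.card σ) P = 0 := by
    refine Subtype.ext ?_
    rw [esymmAlgHom_apply, map_sum]
    refine Eq.trans (Finset.sum_congr rfl fun a _ => ?_) h
    rw [aeval_monomial, ← Algebra.smul_def, Finsupp.prod_fintype _ _ (by simp)]
    rfl
  have hP0 : P = 0 := esymmAlgHom_injective ℚ le_rfl (by rw [hP, map_zero])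
  intro a ha
  have := congrArg (coeff (e.symm a)) hP0
  rw [coeff_sum, Finset.sum_eq_single a] at this
  · simpa using this
  · intro b _ hb
    rw [coeff_monomial, if_neg]
    exact fun h => hb (e.symm.injective h)
  · exact fun h => absurd ha h

/-- The span of the products of a harmonic polynomial and elementary symmetric polynomials, in
degree `d`. -/
def esymmHarmSpan (σ : Type*) [Fintype σ] (d : ℕ) : Submodule ℚ (MvPolynomial σ ℚ) :=
  Submodule.span ℚ {f | ∃ a h, h ∈ harm σ ∧ h.IsHomogeneous (d - esymmWeight σ a) ∧
    esymmWeight σ a ≤ d ∧ f = esymmProd σ a * h}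

theorem esymm_mul_mem_esymmHarmSpan [DecidableEq σ] {d j : ℕ} (hj : 1 ≤ j) (hjd : j ≤ d)
    {f : MvPolynomial σ ℚ} (hf : f ∈ esymmHarmSpan σ (d - j)) :
    esymm σ ℚ j * f ∈ esymmHarmSpan σ d := by
  by_cases hjn : j ≤ Fintype.card σ
  · rw [esymmHarmSpan] at hf
    induction hf using Submodule.span_induction with
    | mem x hx =>
      obtain ⟨a, h, hh, hd, hw, rfl⟩ := hx
      obtain ⟨i, rfl⟩ : ∃ i : Fin (Fintype.card σ), (i + 1 : ℕ) = j :=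
        ⟨⟨j - 1, by omega⟩, by simp; omega⟩
      refine Submodule.subset_span ⟨a + Pi.single i 1, h, hh, ?_, ?_, ?_⟩
      · rw [esymmWeight_add_single]
        convert hd using 1
        omega
      · rw [esymmWeight_add_single]
        omega
      · rw [esymmProd_add_single, mul_assoc]
    | zero => simp
    | add x y _ _ hx hy => rw [mul_add]; exact add_mem hx hy
    | smul c x _ hx => rw [mul_smul_comm]; exact Submodule.smul_mem _ _ hx
  · have : esymm σ ℚ j = 0 := by
      rw [esymm, Finset.powersetCard_eq_empty.2 (by simpa using hjn), Finset.sum_empty]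
    rw [this, zero_mul]
    exact zero_mem _

/-- Split off the harmonic part of f. The rest is a combination of e_k with coefficients of lower
degree, to which induction applies. -/
theorem mem_esymmHarmSpan [DecidableEq σ] (d : ℕ) {f : MvPolynomial σ ℚ}
    (hf : f.IsHomogeneous d) : f ∈ esymmHarmSpan σ d := by
  induction d using Nat.strong_induction_on generalizing f with
  | _ d ih =>
    obtain ⟨h, hh, hi⟩ := exists_harm_sub_mem_coinvIdeal f
    have h1 : f = homogeneousComponent d h + homogeneousComponent d (f - h) := by
      rw [map_sub, homogeneousComponent_eq_self hf]
      ring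
    rw [h1]
    refine add_mem (Submodule.subset_span ⟨0, homogeneousComponent d h,
      homogeneousComponent_mem_harm d hh, ?_, ?_, ?_⟩) ?_
    · simpa [esymmWeight] using homogeneousComponent_isHomogeneous d h
    · simp [esymmWeight]
    · simp [esymmProd]
    have key : ∀ u ∈ coinvIdeal σ, ∀ g, homogeneousComponent d (g * u) ∈ esymmHarmSpan σ d := by
      intro u hu
      rw [coinvIdeal] at hu
      induction hu using Submodule.span_induction with
      | mem x hx =>
        obtain ⟨k, rfl⟩ := hx
        intro g
        rw [mul_comm, homogeneousComponent_mul_of_isHomogeneous (isHomogeneous_esymm _)]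
        split_ifs with hk
        · exact esymm_mul_mem_esymmHarmSpan (by omega) hk
            (ih _ (by omega) (homogeneousComponent_isHomogeneous _ _))
        · exact zero_mem _
      | zero => simp
      | add x y _ _ hx hy => intro g; rw [mul_add, map_add]; exact add_mem (hx g) (hy g)
      | smul a x _ hx => intro g; rw [smul_eq_mul, ← mul_assoc]; exact hx _
    simpa using key _ hi 1

variable [DecidableEq σ]

theorem IsVandermonde.exists_smul {D : MvPolynomial σ ℚ} {N d : ℕ} (hD : IsVandermonde D N)
    {f : MvPolynomial σ ℚ} (hf : IsAlternating f) (hd : f.IsHomogeneous d) (hdN : d ≤ N) :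
    ∃ c : ℚ, f = c • D ∧ (d < N → c = 0) := by
  obtain ⟨u, hu⟩ := hD.dvd f hf
  have h1 := homogeneousComponent_mul_of_isHomogeneous hD.isHomogeneous u d
  rw [← hu, homogeneousComponent_eq_self hd] at h1
  rcases hdN.lt_or_eq with h | rfl
  · rw [if_neg (by omega)] at h1
    exact ⟨0, by rw [h1, zero_smul], fun _ => rfl⟩
  · rw [if_pos le_rfl, Nat.sub_self, homogeneousComponent_zero, mul_comm, ← smul_eq_C_mul] at h1
    exact ⟨_, h1, fun h => absurd h (lt_irrefl _)⟩

/-- Proceed by induction on the weight m of the exponent a. Multiplying the relation by a suitable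
g' and antisymmetrizing turns every h b · g' into a scalar multiple of D. This leaves a linear
relation among products of elementary symmetric polynomials, so all scalars vanish. Hence all
multiples of h a are orthogonal to D, and h a is both coinvariant and harmonic. -/
theorem eq_zero_of_sum_esymmProd_mul {T : Finset (Fin (Fintype.card σ) → ℕ)} {d : ℕ}
    (hT : ∀ a ∈ T, esymmWeight σ a ≤ d) {h : (Fin (Fintype.card σ) → ℕ) → MvPolynomial σ ℚ}
    (hh : ∀ a ∈ T, h a ∈ harmPiece σ (d - esymmWeight σ a))
    (h0 : ∑ a ∈ T, esymmProd σ a * h a = 0) : ∀ a ∈ T, h a = 0 := by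
  obtain ⟨D, N, hD⟩ := exists_isVandermonde σ
  suffices key : ∀ m, ∀ a ∈ T, esymmWeight σ a = m → h a = 0 from fun a ha => key _ a ha rfl
  intro m
  induction m using Nat.strong_induction_on with
  | _ m ih =>
    intro a ha ham
    refine disjoint_harm_coinvIdeal (hh a ha).1 (mem_coinvIdeal_of_apolar hD fun g => ?_)
    have h1 : apolar (g * h a) D = apolar (homogeneousComponent N (h a * g)) D := by
      rw [apolar_homogeneousComponent, homogeneousComponent_eq_self hD.isHomogeneous, mul_comm]
    have hhom : (h a).IsHomogeneous (d - m) := ham ▸ (hh a ha).2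
    rw [h1, homogeneousComponent_mul_of_isHomogeneous hhom]
    split_ifs with hN
    swap
    · simp
    set g' := homogeneousComponent (N - (d - m)) g with hg'
    have hg'h : g'.IsHomogeneous (N - (d - m)) := homogeneousComponent_isHomogeneous _ _
    -- The degree of h b · g' is N + m - weight(b). It is at most N unless the weight is below m,
    -- and then h b is zero by induction.
    have h2 : ∀ b, ∃ c : ℚ, b ∈ T → antisymmetrize (h b * g') = c • D ∧ (m < esymmWeight σ b → c = 0) := by
      intro b
      by_cases hb : b ∈ T
      swap
      · exact ⟨0, fun h => absurd h hb⟩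
      by_cases hbm : esymmWeight σ b < m
      · exact ⟨0, fun _ => ⟨by simp [ih _ hbm b hb rfl, antisymmetrize], fun _ => rfl⟩⟩
      have hbd := hT b hb
      have hmd := hT a ha
      obtain ⟨c, hc, hc0⟩ := hD.exists_smul (isAlternating_antisymmetrize (h b * g'))
        (antisymmetrize_isHomogeneous (IsHomogeneous.mul (hh b hb).2 hg'h)) (by omega)
      exact ⟨c, fun _ => ⟨hc, fun hlt => hc0 (by omega)⟩⟩
    choose c hc using h2
    have h3 : ∑ b ∈ T, c b • esymmProd σ b = 0 := by
      have h4 := congrArg (fun F => antisymmetrize (F * g')) h0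
      simp only [zero_mul] at h4
      have h5 : antisymmetrize ((∑ b ∈ T, esymmProd σ b * h b) * g') =
          (∑ b ∈ T, c b • esymmProd σ b) * D := by
        rw [Finset.sum_mul, Finset.sum_mul]
        have : ∀ s : Finset (Fin (Fintype.card σ) → ℕ), ∀ F : _ → MvPolynomial σ ℚ,
            antisymmetrize (∑ b ∈ s, F b) = ∑ b ∈ s, antisymmetrize (F b) := by
          intro s F
          simp only [antisymmetrize, map_sum, Finset.smul_sum]
          rw [Finset.sum_comm]
        rw [this]
        refine Finset.sum_congr rfl fun b hb => ?_
        rw [mul_assoc, antisymmetrize_symmetric_mul (isSymmetric_esymmProd b), (hc b hb).1,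
          mul_smul_comm, smul_mul_assoc]
      rw [h5] at h4
      have h6 : antisymmetrize (0 : MvPolynomial σ ℚ) = 0 := by simp [antisymmetrize]
      rw [h6] at h4
      exact (mul_eq_zero.1 h4).resolve_right hD.ne_zero
    have h7 := apolar_antisymmetrize hD.isAlternating (h a * g')
    rw [(hc a ha).1, sum_smul_esymmProd_eq_zero h3 a ha, zero_smul, map_zero,
      LinearMap.zero_apply] at h7
    exact (mul_eq_zero.1 h7.symm).resolve_left (by positivity)

/-- The exponents of the products of elementary symmetric polynomials of degree at most `d`. -/
def esymmExponents (σ : Type*) [Fintype σ] (d : ℕ) : Finset (Fin (Fintype.card σ) → ℕ) :=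
  (Finset.range (d + 1)).biUnion fun m =>
    weightedFinset (fun i : Fin (Fintype.card σ) => (i + 1 : ℕ)) m

theorem mem_esymmExponents {d : ℕ} {a : Fin (Fintype.card σ) → ℕ} :
    a ∈ esymmExponents σ d ↔ esymmWeight σ a ≤ d := by
  simp only [esymmExponents, Finset.mem_biUnion, Finset.mem_range, Nat.lt_succ_iff,
    mem_weightedFinset fun i : Fin (Fintype.card σ) => (by omega : 1 ≤ (i + 1 : ℕ))]
  exact ⟨fun ⟨m, hm, h⟩ => (show esymmWeight σ a = m from h).trans_le hm, fun h => ⟨_, h, rfl⟩⟩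

/-- Multiplication by a product of elementary symmetric polynomials. -/
def esymmMul (d : ℕ) (a : esymmExponents σ d) :
    harmPiece σ (d - esymmWeight σ a) →ₗ[ℚ] homogeneousSubmodule σ ℚ d :=
  ((LinearMap.mulLeft ℚ (esymmProd σ a)).comp (Submodule.subtype _)).codRestrict _ fun h => by
    have := (isHomogeneous_esymmProd (σ := σ) a).mul h.2.2
    rwa [Nat.add_sub_cancel' (mem_esymmExponents.1 a.2)] at this

/-- In each degree, this says that the polynomials are free over the symmetric polynomials with the
harmonics as basis space. -/
theorem esymmMul_bijective (d : ℕ) : Function.Bijective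
    fun v : ∀ a : esymmExponents σ d, harmPiece σ (d - esymmWeight σ a) =>
      ∑ a, esymmMul d a (v a) := by
  classical
  let Φ : (∀ a : esymmExponents σ d, harmPiece σ (d - esymmWeight σ a)) →ₗ[ℚ]
    homogeneousSubmodule σ ℚ d := ∑ a, esymmMul d a ∘ₗ LinearMap.proj a
  have hΦ : (fun v : ∀ a : esymmExponents σ d, harmPiece σ (d - esymmWeight σ a) =>
      ∑ a, esymmMul d a (v a)) = Φ := by
    funext v
    simp [Φ]
  rw [hΦ]
  constructor
  · rw [injective_iff_map_eq_zero]
    intro v hv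
    have h1 : ∑ a ∈ esymmExponents σ d, esymmProd σ a *
        (if h : a ∈ esymmExponents σ d then (v ⟨a, h⟩ : MvPolynomial σ ℚ) else 0) = 0 := by
      rw [← Finset.sum_coe_sort]
      have := congrArg Subtype.val ((congrFun hΦ v).trans hv)
      simp only [Submodule.coe_sum, ZeroMemClass.coe_zero] at this
      refine Eq.trans (Finset.sum_congr rfl fun a _ => ?_) this
      rw [dif_pos a.2]
      rfl
    have h2 := eq_zero_of_sum_esymmProd_mul (fun a ha => mem_esymmExponents.1 ha) (fun a ha => by
      rw [dif_pos ha]; exact (v ⟨a, ha⟩).2) h1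
    funext a
    have h3 := h2 a a.2
    rw [dif_pos a.2] at h3
    exact Subtype.ext h3
  · intro f
    suffices h : esymmHarmSpan σ d ≤ (LinearMap.range Φ).map (Submodule.subtype _) by
      obtain ⟨x, hx, hxf⟩ := h (mem_esymmHarmSpan d f.2)
      rwa [show x = f from Subtype.ext hxf] at hx
    refine Submodule.span_le.2 ?_
    rintro _ ⟨a, h, hh, hd, hw, rfl⟩
    let a' : esymmExponents σ d := ⟨a, mem_esymmExponents.2 hw⟩
    refine ⟨esymmMul d a' ⟨h, hh, hd⟩, ⟨Pi.single a' ⟨h, hh, hd⟩, ?_⟩, rfl⟩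
    rw [← congrFun hΦ]
    rw [Finset.sum_eq_single a']
    · rw [Pi.single_eq_same]
    · intro b _ hb
      rw [Pi.single_eq_of_ne hb, map_zero]
    · simp

/-- A permutation acting on the homogeneous polynomials of degree `d`. -/
def polyAct (d : ℕ) (w : Equiv.Perm σ) :
    homogeneousSubmodule σ ℚ d →ₗ[ℚ] homogeneousSubmodule σ ℚ d :=
  (rename (R := ℚ) w).toLinearMap.restrict fun _ hf => IsHomogeneous.rename_isHomogeneous hf

/-- A permutation acting on the harmonic polynomials of degree `d`. -/
def harmAct (d : ℕ) (w : Equiv.Perm σ) : harmPiece σ d →ₗ[ℚ] harmPiece σ d :=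
  (rename (R := ℚ) w).toLinearMap.restrict fun _ hf =>
    ⟨rename_mem_harm w hf.1, IsHomogeneous.rename_isHomogeneous hf.2⟩

theorem trace_polyAct_eq_sum (d : ℕ) (w : Equiv.Perm σ) :
    LinearMap.trace ℚ _ (polyAct d w) = ∑ m ∈ Finset.range (d + 1),
      ((weightedFinset (fun i : Fin (Fintype.card σ) => (i + 1 : ℕ)) m).card : ℚ) *
        LinearMap.trace ℚ _ (harmAct (d - m) w) := by
  rw [trace_eq_sum_of_bijective (esymmMul d) (esymmMul_bijective d) (polyAct d w)
    (fun a => harmAct (d - esymmWeight σ a) w)]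
  · rw [Finset.sum_coe_sort (esymmExponents σ d)
      fun a => LinearMap.trace ℚ _ (harmAct (d - esymmWeight σ a) w), esymmExponents,
      Finset.sum_biUnion]
    · refine Finset.sum_congr rfl fun m _ => ?_
      rw [← nsmul_eq_mul, ← Finset.sum_const]
      refine Finset.sum_congr rfl fun a ha => ?_
      rw [mem_weightedFinset fun i => by omega] at ha
      have : esymmWeight σ a = m := ha
      rw [this]
    · intro m _ m' _ hmm
      rw [Function.onFun, Finset.disjoint_left]
      intro a ha ha'
      rw [mem_weightedFinset fun i => by omega] at ha ha'
      exact hmm (ha.symm.trans ha')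
  · intro a v
    refine Subtype.ext ?_
    change rename w (esymmProd σ a * (v : MvPolynomial σ ℚ)) = esymmProd σ a * rename w (v : MvPolynomial σ ℚ)
    rw [map_mul, isSymmetric_esymmProd]

/-- A permutation permutes the monomial basis, so its trace counts the fixed monomials. -/
theorem trace_polyAct (d : ℕ) (w : Equiv.Perm σ) :
    LinearMap.trace ℚ _ (polyAct d w) =
      PowerSeries.coeff d (w.partition.parts.map (geomSeries ℚ)).prod := by
  classical
  rw [← card_fixed_exponents]
  set S := Finset.finsuppAntidiag (Finset.univ : Finset σ) d with hS
  have hmem : ∀ a : S, (a : σ →₀ ℕ).degree = d := fun a => by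
    rw [Finsupp.degree_eq_sum]
    exact (Finset.mem_finsuppAntidiag.1 a.2).1
  rw [trace_eq_sum_of_sum_comp_eq_id (ι := S) (W := fun _ => ℚ)
    (fun a => LinearMap.toSpanSingleton ℚ _
      (⟨monomial a 1, isHomogeneous_monomial _ (hmem a)⟩ : homogeneousSubmodule σ ℚ d))
    (fun a => (lcoeff ℚ (a : σ →₀ ℕ)).comp (Submodule.subtype _))]
  · rw [Finset.card_filter, Nat.cast_sum, ← Finset.sum_coe_sort S]
    refine Finset.sum_congr rfl fun a _ => ?_
    have : ∀ f : ℚ →ₗ[ℚ] ℚ, LinearMap.trace ℚ ℚ f = f 1 := by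
      intro f
      rw [LinearMap.trace_eq_matrix_trace ℚ (Module.Basis.singleton Unit ℚ)]
      simp [Matrix.trace, LinearMap.toMatrix_apply]
    rw [this]
    change coeff (a : σ →₀ ℕ) (rename w ((1 : ℚ) • monomial (a : σ →₀ ℕ) (1 : ℚ))) = _
    rw [one_smul, rename_monomial, coeff_monomial]
    simp
  · refine LinearMap.ext fun f => Subtype.ext ?_
    simp only [LinearMap.sum_apply, LinearMap.comp_apply, LinearMap.id_apply, Submodule.coe_sum,
      LinearMap.toSpanSingleton_apply, Submodule.subtype_apply, Submodule.coe_smul]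
    change ∑ a : S, coeff (a : σ →₀ ℕ) (f : MvPolynomial σ ℚ) • monomial (a : σ →₀ ℕ) (1 : ℚ) = f
    rw [Finset.sum_coe_sort S fun a => coeff a (f : MvPolynomial σ ℚ) • monomial a (1 : ℚ)]
    ext b
    rw [coeff_sum]
    simp_rw [coeff_smul, coeff_monomial, smul_eq_mul, mul_ite, mul_one, mul_zero]
    rw [Finset.sum_ite_eq']
    split_ifs with hb
    · rfl
    · refine (IsHomogeneous.coeff_eq_zero f.2 fun h => hb ?_).symm
      rw [hS, Finset.mem_finsuppAntidiag]
      rw [Finsupp.degree_eq_sum] at h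
      exact ⟨h, Finset.subset_univ _⟩

/-- The graded character of the harmonic polynomials. -/
theorem mk_trace_harmAct (w : Equiv.Perm σ) :
    (PowerSeries.mk fun d => LinearMap.trace ℚ _ (harmAct d w)) =
      (∏ i : Fin (Fintype.card σ), (1 - PowerSeries.X ^ (i + 1 : ℕ))) *
        (w.partition.parts.map (geomSeries ℚ)).prod := by
  have h1 : (w.partition.parts.map (geomSeries ℚ)).prod =
      (∏ i : Fin (Fintype.card σ), geomSeries ℚ (i + 1)) *
        PowerSeries.mk fun d => LinearMap.trace ℚ _ (harmAct d w) := by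
    ext d
    rw [← trace_polyAct, trace_polyAct_eq_sum, PowerSeries.coeff_mul,
      Finset.Nat.sum_antidiagonal_eq_sum_range_succ_mk]
    refine Finset.sum_congr rfl fun m _ => ?_
    rw [PowerSeries.coeff_mk,
      coeff_prod_geomSeries ℚ fun i : Fin (Fintype.card σ) => (by omega : 1 ≤ (i + 1 : ℕ))]
  rw [h1, ← mul_assoc, ← Finset.prod_mul_distrib, Finset.prod_eq_one, one_mul]
  exact fun i _ => one_sub_X_pow_mul_geomSeries ℚ (by omega)

end Decomposition

/-! ### The cycle index -/

section CycleIndex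

/-- The order of the centralizer of a permutation of cycle type `s`. -/
def zee (s : Multiset ℕ) : ℕ := s.prod * ∏ k ∈ s.toFinset, (s.count k).factorial

theorem prod_count_factorial {s : Multiset ℕ} {S : Finset ℕ} (h : s.toFinset ⊆ S) :
    ∏ k ∈ s.toFinset, (s.count k).factorial = ∏ k ∈ S, (s.count k).factorial := by
  refine Finset.prod_subset h fun k _ hk => ?_
  rw [Multiset.count_eq_zero_of_notMem (by simpa using hk), Nat.factorial_zero]

theorem zee_cons (k : ℕ) (t : Multiset ℕ) :
    zee (k ::ₘ t) = k * (t.count k + 1) * zee t := by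
  rw [zee, zee, Multiset.prod_cons, Multiset.toFinset_cons,
    prod_count_factorial (Finset.subset_insert k t.toFinset),
    ← Finset.mul_prod_erase _ _ (Finset.mem_insert_self k _),
    ← Finset.mul_prod_erase _ (fun j => (t.count j).factorial) (Finset.mem_insert_self k _)]
  have : ∏ j ∈ (insert k t.toFinset).erase k, ((k ::ₘ t).count j).factorial =
      ∏ j ∈ (insert k t.toFinset).erase k, (t.count j).factorial :=
    Finset.prod_congr rfl fun j hj => by
      rw [Multiset.count_cons_of_ne (Finset.mem_erase.1 hj).1]
  rw [this, Multiset.count_cons_self, Nat.factorial_succ]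
  ring

/-- The partitions of `n`, as multisets. -/
def partitionFinset (n : ℕ) : Finset (Multiset ℕ) :=
  (Finset.univ : Finset n.Partition).image Nat.Partition.parts

theorem mem_partitionFinset {n : ℕ} {s : Multiset ℕ} :
    s ∈ partitionFinset n ↔ s.sum = n ∧ ∀ k ∈ s, 1 ≤ k := by
  rw [partitionFinset, Finset.mem_image]
  constructor
  · rintro ⟨p, _, rfl⟩
    exact ⟨p.parts_sum, fun k hk => p.parts_pos hk⟩
  · rintro ⟨h1, h2⟩
    exact ⟨⟨s, fun {k} hk => h2 k hk, h1⟩, Finset.mem_univ _, rfl⟩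

theorem zee_pos {s : Multiset ℕ} (h : ∀ k ∈ s, 1 ≤ k) : 0 < zee s :=
  Nat.mul_pos (Multiset.prod_pos h) (Finset.prod_pos fun _ _ => Nat.factorial_pos _)

variable {A : Type*} [CommRing A] [Algebra ℚ A]

/-- The cycle index of the symmetric group on `n` letters, in variables `p`. -/
def cycleIndex (p : ℕ → A) (n : ℕ) : A :=
  ∑ s ∈ partitionFinset n, (zee s : ℚ)⁻¹ • (s.map p).prod

theorem cycleIndex_zero (p : ℕ → A) : cycleIndex p 0 = 1 := by
  have : partitionFinset 0 = {0} := by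
    ext s
    rw [mem_partitionFinset, Finset.mem_singleton]
    constructor
    · rintro ⟨h1, h2⟩
      refine Multiset.eq_zero_of_forall_notMem fun k hk => ?_
      have := Multiset.single_le_sum (fun _ _ => Nat.zero_le _) k hk
      have := h2 k hk
      omega
    · rintro rfl
      simp
  rw [cycleIndex, this]
  simp [zee]

/-- Newton's identity. Write n + 1 as the sum of k · (multiplicity of k) over the distinct parts k
of a partition, and remove one part k; by `zee_cons` the factor k · multiplicity is exactly the
quotient of the two centralizer orders. -/
theorem cycleIndex_succ (p : ℕ → A) (n : ℕ) :
    ((n + 1 : ℕ) : ℚ) • cycleIndex p (n + 1) =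
      ∑ x ∈ Finset.HasAntidiagonal.antidiagonal n, p (x.1 + 1) * cycleIndex p x.2 := by
  have h1 : ∀ s ∈ partitionFinset (n + 1), ((n + 1 : ℕ) : ℚ) • ((zee s : ℚ)⁻¹ • (s.map p).prod) =
      ∑ k ∈ s.toFinset, ((s.count k * k : ℕ) : ℚ) • ((zee s : ℚ)⁻¹ • (s.map p).prod) := by
    intro s hs
    rw [← Finset.sum_smul, ← Nat.cast_sum]
    congr 2
    rw [← (mem_partitionFinset.1 hs).1, Finset.sum_multiset_count]
    simp only [smul_eq_mul]
  rw [cycleIndex, Finset.smul_sum, Finset.sum_congr rfl h1, Finset.sum_sigma']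
  simp_rw [cycleIndex, Finset.mul_sum]
  rw [Finset.sum_sigma']
  refine Finset.sum_bij' (fun x _ => ⟨(x.2 - 1, n + 1 - x.2), x.1.erase x.2⟩)
    (fun y _ => ⟨(y.1.1 + 1) ::ₘ y.2, y.1.1 + 1⟩) ?_ ?_ ?_ ?_ ?_
  · rintro ⟨s, k⟩ hx
    simp only [Finset.mem_sigma, mem_partitionFinset, Multiset.mem_toFinset] at hx
    obtain ⟨t, rfl⟩ := Multiset.exists_cons_of_mem hx.2
    have hk := hx.1.2 k hx.2
    have hsum := hx.1.1
    rw [Multiset.sum_cons] at hsum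
    simp only [Finset.mem_sigma, mem_partitionFinset, Finset.HasAntidiagonal.mem_antidiagonal,
      Multiset.erase_cons_head]
    exact ⟨by omega, by omega, fun j hj => hx.1.2 j (Multiset.mem_cons_of_mem hj)⟩
  · rintro ⟨⟨i, j⟩, t⟩ hy
    simp only [Finset.mem_sigma, mem_partitionFinset, Finset.HasAntidiagonal.mem_antidiagonal] at hy
    simp only [Finset.mem_sigma, mem_partitionFinset, Multiset.mem_toFinset,
      Multiset.mem_cons_self, and_true, Multiset.sum_cons]
    refine ⟨by omega, fun l hl => ?_⟩
    rcases Multiset.mem_cons.1 hl with rfl | hl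
    · omega
    · exact hy.2.2 l hl
  · rintro ⟨s, k⟩ hx
    simp only [Finset.mem_sigma, mem_partitionFinset, Multiset.mem_toFinset] at hx
    have hk := hx.1.2 k hx.2
    simp only [Nat.sub_add_cancel hk, Multiset.cons_erase hx.2]
  · rintro ⟨⟨i, j⟩, t⟩ hy
    simp only [Finset.mem_sigma, Finset.HasAntidiagonal.mem_antidiagonal] at hy
    have : n + 1 - (i + 1) = j := by omega
    simp only [Nat.add_sub_cancel, this, Multiset.erase_cons_head]
  · rintro ⟨s, k⟩ hx
    simp only [Finset.mem_sigma, mem_partitionFinset, Multiset.mem_toFinset] at hx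
    obtain ⟨t, rfl⟩ := Multiset.exists_cons_of_mem hx.2
    have hk := hx.1.2 k hx.2
    simp only [Nat.sub_add_cancel hk, Multiset.erase_cons_head, Multiset.map_cons,
      Multiset.prod_cons, Multiset.count_cons_self]
    rw [smul_smul, mul_smul_comm]
    congr 1
    rw [zee_cons]
    have h2 : (zee t : ℚ) ≠ 0 := by
      exact_mod_cast (zee_pos fun j hj => hx.1.2 j (Multiset.mem_cons_of_mem hj)).ne'
    have h3 : (k : ℚ) ≠ 0 := by exact_mod_cast (by omega : k ≠ 0)
    have h4 : ((t.count k : ℚ) + 1) ≠ 0 := by positivity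
    push_cast
    field_simp

/-- Since n + 1 is invertible, Newton's identity and the initial value determine the sequence. -/
theorem eq_cycleIndex {p f : ℕ → A} (h0 : f 0 = 1)
    (h : ∀ n, ((n + 1 : ℕ) : ℚ) • f (n + 1) = ∑ x ∈ Finset.HasAntidiagonal.antidiagonal n, p (x.1 + 1) * f x.2)
    (n : ℕ) : f n = cycleIndex p n := by
  induction n using Nat.strong_induction_on with
  | _ n ih =>
    cases n with
    | zero => rw [h0, cycleIndex_zero]
    | succ n =>
      have h1 := (h n).trans (Finset.sum_congr rfl fun x hx => by
        rw [ih x.2 (by rw [Finset.HasAntidiagonal.mem_antidiagonal] at hx; omega)])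
      rw [← cycleIndex_succ] at h1
      have h2 : ((n + 1 : ℕ) : ℚ) ≠ 0 := by positivity
      have h3 := congrArg (fun y => ((n + 1 : ℕ) : ℚ)⁻¹ • y) h1
      simpa only [smul_smul, inv_mul_cancel₀ h2, one_smul] using h3

/-- The class size formula for cycle types has only parts ≥ 2. The parts equal to 1 do not change
the product of the parts, and their multiplicity accounts for the factorial of the number of fixed
points. -/
theorem card_partition_mul_zee (τ : Type*) [Fintype τ] [DecidableEq τ]
    {s : Multiset ℕ} (hs : s ∈ partitionFinset (Fintype.card τ)) :
    (Finset.univ.filter fun w : Equiv.Perm τ => w.partition.parts = s).card * zee s =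
      (Fintype.card τ).factorial := by
  obtain ⟨hsum, hpos⟩ := mem_partitionFinset.1 hs
  set m := s.filter (2 ≤ ·) with hm
  have hsm : s = m + Multiset.replicate (s.count 1) 1 := by
    conv_lhs => rw [← Multiset.filter_add_not (2 ≤ ·) s]
    congr 1
    rw [← Multiset.filter_eq']
    refine Multiset.filter_congr fun k hk => ?_
    have := hpos k hk
    omega
  have hcount : s.count 1 = Fintype.card τ - m.sum := by
    have h1 := congrArg Multiset.sum hsm
    rw [Multiset.sum_add, Multiset.sum_replicate, hsum] at h1
    simp only [smul_eq_mul, mul_one] at h1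
    omega
  have hle : m.sum ≤ Fintype.card τ := by
    have h1 := congrArg Multiset.sum hsm
    rw [Multiset.sum_add, hsum] at h1
    omega
  have h := Equiv.Perm.card_of_cycleType_mul_eq τ m
  rw [if_pos ⟨hle, fun a ha => (Multiset.mem_filter.1 ha).2⟩] at h
  rw [← h]
  congr 1
  · congr 1
    ext w
    simp only [Finset.mem_filter, Finset.mem_univ, true_and]
    constructor
    · intro hw
      rw [← Equiv.Perm.filter_parts_partition_eq_cycleType, hw, hm]
    · intro hw
      rw [Equiv.Perm.parts_partition, hw, ← Equiv.Perm.sum_cycleType, hw, ← hcount, ← hsm]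
  · rw [zee]
    have h1 : s.prod = m.prod := by
      conv_lhs => rw [hsm]
      simp
    have h2 : ∏ k ∈ s.toFinset, (s.count k).factorial =
        (Fintype.card τ - m.sum).factorial * ∏ k ∈ m.toFinset, (m.count k).factorial := by
      have hms : m.toFinset ⊆ (insert 1 s.toFinset).erase 1 := by
        intro k hk
        rw [Multiset.mem_toFinset, hm, Multiset.mem_filter] at hk
        simp only [Finset.mem_erase, Finset.mem_insert, Multiset.mem_toFinset]
        exact ⟨by omega, Or.inr hk.1⟩
      rw [prod_count_factorial (Finset.subset_insert 1 s.toFinset),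
        ← Finset.mul_prod_erase _ _ (Finset.mem_insert_self 1 _), hcount,
        prod_count_factorial hms]
      congr 1
      refine Finset.prod_congr rfl fun k hk => ?_
      have hk1 := (Finset.mem_erase.1 hk).1
      rw [hm]
      by_cases hks : k ∈ s
      · rw [Multiset.count_filter_of_pos (by have := hpos k hks; omega)]
      · rw [Multiset.count_eq_zero_of_notMem hks, Multiset.count_eq_zero_of_notMem]
        exact fun h => hks (Multiset.mem_of_mem_filter h)
    rw [h1, h2]
    ring

/-- The sum of the power-sum monomials of all permutations. -/
theorem sum_prod_parts_eq_cycleIndex (τ : Type*) [Fintype τ] [DecidableEq τ] (p : ℕ → A) :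
    ∑ w : Equiv.Perm τ, (w.partition.parts.map p).prod =
      ((Fintype.card τ).factorial : ℚ) • cycleIndex p (Fintype.card τ) := by
  rw [cycleIndex, Finset.smul_sum, ← Finset.sum_fiberwise_of_maps_to
    (t := partitionFinset (Fintype.card τ)) (g := fun w : Equiv.Perm τ => w.partition.parts)
    fun w _ => Finset.mem_image_of_mem _ (Finset.mem_univ w.partition)]
  refine Finset.sum_congr rfl fun s hs => ?_
  rw [Finset.sum_congr rfl (fun w hw => by rw [(Finset.mem_filter.1 hw).2] :
    ∀ w ∈ Finset.univ.filter (fun w : Equiv.Perm τ => w.partition.parts = s),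
      (w.partition.parts.map p).prod = (s.map p).prod), Finset.sum_const, smul_smul,
    ← Nat.cast_smul_eq_nsmul ℚ, ← card_partition_mul_zee τ hs]
  congr 1
  have h2 : (zee s : ℚ) ≠ 0 := by
    exact_mod_cast (zee_pos (mem_partitionFinset.1 hs).2).ne'
  push_cast
  field_simp

end CycleIndex

/-! ### Newton's identities for the symmetric functions -/

section Newton

/-- The shift k + 1 matters: for a positive exponent, distinct variables have distinct powers, so
each variable contributes at most one term. -/
theorem powerSum_mul_apply (k : ℕ) (f : SymFun) (d : ℕ →₀ ℕ) :
    (powerSum (k + 1) * f) d =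
      ∑ i ∈ d.support, if k + 1 ≤ d i then f (d - Finsupp.single i (k + 1)) else 0 := by
  classical
  have h := MvPowerSeries.coeff_mul (R := ℚ) d (powerSum (k + 1)) f
  refine h.trans ?_
  rw [← Finset.sum_filter]
  have h1 : ∀ p : (ℕ →₀ ℕ) × (ℕ →₀ ℕ), MvPowerSeries.coeff p.1 (powerSum (k + 1)) *
      MvPowerSeries.coeff p.2 f = if ∃ i, p.1 = Finsupp.single i (k + 1) then f p.2 else 0 := by
    intro p
    change (if ∃ i, p.1 = Finsupp.single i (k + 1) then (1 : ℚ) else 0) * f p.2 = _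
    rw [ite_mul, one_mul, zero_mul]
  simp_rw [h1]
  rw [← Finset.sum_filter]
  symm
  refine Finset.sum_bij (fun i _ => (Finsupp.single i (k + 1), d - Finsupp.single i (k + 1)))
    ?_ ?_ ?_ ?_
  · intro i hi
    rw [Finset.mem_filter] at hi
    rw [Finset.mem_filter, Finset.HasAntidiagonal.mem_antidiagonal]
    exact ⟨add_tsub_cancel_of_le (Finsupp.single_le_iff.2 hi.2), i, rfl⟩
  · intro i _ j _ h
    exact (Finsupp.single_left_inj (Nat.succ_ne_zero k)).1 (Prod.ext_iff.1 h).1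
  · rintro ⟨a, b⟩ hp
    rw [Finset.mem_filter, Finset.HasAntidiagonal.mem_antidiagonal] at hp
    obtain ⟨hab, i, rfl⟩ := hp
    simp only at hab
    have hi : d i = k + 1 + b i := by rw [← hab]; simp
    refine ⟨i, ?_, ?_⟩
    · rw [Finset.mem_filter, Finsupp.mem_support_iff]
      omega
    · rw [← hab, add_tsub_cancel_left]
  · intro i _
    rfl

theorem symFun_sum_apply {ι : Type*} (s : Finset ι) (F : ι → SymFun) (d : ℕ →₀ ℕ) :
    (∑ k ∈ s, F k) d = ∑ k ∈ s, F k d := by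
  have h := map_sum (MvPowerSeries.coeff (R := ℚ) d) F s
  exact h

theorem degree_sub_single {d : ℕ →₀ ℕ} {i k : ℕ} (h : k ≤ d i) :
    (d - Finsupp.single i k).degree + k = d.degree := by
  conv_rhs => rw [← tsub_add_cancel_of_le (Finsupp.single_le_iff.2 h)]
  rw [map_add, Finsupp.degree_single]

theorem le_degree_apply (d : ℕ →₀ ℕ) (i : ℕ) : d i ≤ d.degree := Finsupp.le_degree i d

theorem sum_support_eq_degree (d : ℕ →₀ ℕ) : ∑ i ∈ d.support, d i = d.degree := rfl

theorem sum_powerSum_mul_apply (c : ℕ → ℚ) (f : ℕ → SymFun) (n : ℕ) (d : ℕ →₀ ℕ) :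
    (∑ x ∈ Finset.HasAntidiagonal.antidiagonal n, (c x.1 • powerSum (x.1 + 1)) * f x.2) d =
      ∑ i ∈ d.support, ∑ k ∈ Finset.range (n + 1),
        if k + 1 ≤ d i then c k * f (n - k) (d - Finsupp.single i (k + 1)) else 0 := by
  rw [Finset.Nat.sum_antidiagonal_eq_sum_range_succ_mk, Finset.sum_comm]
  rw [symFun_sum_apply]
  refine Finset.sum_congr rfl fun k _ => ?_
  rw [smul_mul_assoc]
  change c k • (powerSum (k + 1) * f (n - k)) d = _
  rw [powerSum_mul_apply, smul_eq_mul, Finset.mul_sum]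
  refine Finset.sum_congr rfl fun i _ => ?_
  rw [mul_ite, mul_zero]

/-- In Newton's identity at a monomial of degree n + 1, the variable i contributes one term for each
exponent from 1 to d i. The contributions add up to the degree. -/
theorem complSym_eq_cycleIndex (n : ℕ) : complSym n = cycleIndex powerSum n := by
  refine eq_cycleIndex (f := fun n => complSym n) ?_ (fun n => ?_) n
  · funext d
    change (if ((d.degree : ℕ) : ℤ) = ((0 : ℕ) : ℤ) then (1 : ℚ) else 0) = MvPowerSeries.coeff d 1
    classical
    rw [MvPowerSeries.coeff_one]
    simp [Finsupp.degree_eq_zero_iff]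
  · have h := sum_powerSum_mul_apply (fun _ => 1) (fun n => complSym n) n
    simp only [one_smul, one_mul] at h
    funext d
    rw [h d]
    change ((n + 1 : ℕ) : ℚ) • (if ((d.degree : ℕ) : ℤ) = ((n + 1 : ℕ) : ℤ) then (1 : ℚ) else 0) = _
    have h1 : ∀ i ∈ d.support, (∑ k ∈ Finset.range (n + 1),
        if k + 1 ≤ d i then (complSym ((n - k : ℕ) : ℤ)) (d - Finsupp.single i (k + 1)) else 0) =
        if d.degree = n + 1 then (d i : ℚ) else 0 := by
      intro i _
      have h2 : ∀ k ∈ Finset.range (n + 1), (if k + 1 ≤ d i then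
          (complSym ((n - k : ℕ) : ℤ)) (d - Finsupp.single i (k + 1)) else 0) =
          if k + 1 ≤ d i then (if d.degree = n + 1 then (1 : ℚ) else 0) else 0 := by
        intro k hk
        rw [Finset.mem_range] at hk
        refine if_ctx_congr Iff.rfl (fun hki => ?_) fun _ => rfl
        have := degree_sub_single hki
        change (if (((d - Finsupp.single i (k + 1)).degree : ℕ) : ℤ) = ((n - k : ℕ) : ℤ)
          then (1 : ℚ) else 0) = _
        refine if_congr ?_ rfl rfl
        omega
      rw [Finset.sum_congr rfl h2]
      by_cases hd : d.degree = n + 1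
      · simp only [if_pos hd]
        rw [Finset.sum_boole]
        congr 1
        have hle := le_degree_apply d i
        have : (Finset.range (n + 1)).filter (fun k => k + 1 ≤ d i) = Finset.range (d i) := by
          ext k
          simp only [Finset.mem_filter, Finset.mem_range]
          omega
        rw [this, Finset.card_range]
      · simp only [if_neg hd, ite_self, Finset.sum_const_zero]
    rw [Finset.sum_congr rfl h1]
    by_cases hd : d.degree = n + 1
    · simp only [if_pos hd]
      rw [← Nat.cast_sum, sum_support_eq_degree, hd]
      simp
    · simp only [if_neg hd, Finset.sum_const_zero]
      rw [if_neg (by exact_mod_cast hd), smul_zero]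

/-- Only k = c - 1 and k = c - 2 survive. For c ≥ 2 both occur and cancel; for c = 1 only the first
exists. -/
theorem sum_neg_one_pow_of_le_one {c n : ℕ} (hc : 1 ≤ c) (hcn : c ≤ n + 1) :
    (∑ k ∈ Finset.range (n + 1), if k + 1 ≤ c then
      (-1 : ℚ) ^ k * (if c - (k + 1) ≤ 1 then 1 else 0) else 0) = if c = 1 then 1 else 0 := by
  have h : (∑ k ∈ Finset.range (n + 1), if k + 1 ≤ c then
      (-1 : ℚ) ^ k * (if c - (k + 1) ≤ 1 then 1 else 0) else 0) =
      ∑ k ∈ Finset.range c, (-1 : ℚ) ^ k * (if c - (k + 1) ≤ 1 then 1 else 0) := by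
    rw [← Finset.sum_filter]
    refine Finset.sum_congr ?_ fun _ _ => rfl
    ext k
    simp only [Finset.mem_filter, Finset.mem_range]
    omega
  rw [h]
  obtain ⟨c, rfl⟩ : ∃ b, c = b + 1 := ⟨c - 1, by omega⟩
  rw [Finset.sum_range_succ]
  cases c with
  | zero => simp
  | succ b =>
    rw [Finset.sum_range_succ, Finset.sum_eq_zero]
    · have h1 : b + 1 + 1 - (b + 1) ≤ 1 := by omega
      have h2 : b + 1 + 1 - (b + 1 + 1) ≤ 1 := by omega
      rw [if_pos h1, if_pos h2, if_neg (by omega), pow_succ]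
      ring
    · intro k hk
      rw [Finset.mem_range] at hk
      rw [if_neg (by omega), mul_zero]

/-- Removing a power of the variable i leaves a square-free monomial only if the other exponents are
at most 1. By the alternating sum above, the total contribution of i vanishes unless its own
exponent is 1. -/
theorem elemSym_eq_cycleIndex (n : ℕ) :
    elemSym n = cycleIndex (fun k => (-1 : ℚ) ^ (k - 1) • powerSum k) n := by
  classical
  refine eq_cycleIndex (f := fun n => elemSym n) ?_ (fun n => ?_) n
  · funext d
    change (if d.degree = 0 ∧ ∀ i, d i ≤ 1 then (1 : ℚ) else 0) = MvPowerSeries.coeff d 1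
    rw [MvPowerSeries.coeff_one]
    refine if_congr ?_ rfl rfl
    rw [Finsupp.degree_eq_zero_iff]
    exact ⟨fun h => h.1, fun h => ⟨h, by simp [h]⟩⟩
  · have h := sum_powerSum_mul_apply (fun k => (-1) ^ k) (fun n => elemSym n) n
    funext d
    simp only [Nat.add_sub_cancel]
    rw [h d]
    change ((n + 1 : ℕ) : ℚ) • (if d.degree = n + 1 ∧ ∀ i, d i ≤ 1 then (1 : ℚ) else 0) = _
    have h1 : ∀ i ∈ d.support, (∑ k ∈ Finset.range (n + 1), if k + 1 ≤ d i then
        (-1) ^ k * (elemSym (n - k)) (d - Finsupp.single i (k + 1)) else 0) =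
        if d.degree = n + 1 ∧ (∀ j, j ≠ i → d j ≤ 1) ∧ d i = 1 then (1 : ℚ) else 0 := by
      intro i hi
      by_cases hd : d.degree = n + 1 ∧ ∀ j, j ≠ i → d j ≤ 1
      · have h2 : (if d.degree = n + 1 ∧ (∀ j, j ≠ i → d j ≤ 1) ∧ d i = 1 then (1 : ℚ) else 0) =
            if d i = 1 then 1 else 0 := if_congr (by tauto) rfl rfl
        have hle := le_degree_apply d i
        rw [Finsupp.mem_support_iff] at hi
        rw [h2, ← sum_neg_one_pow_of_le_one (c := d i) (n := n) (by omega) (by omega)]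
        refine Finset.sum_congr rfl fun k hk => ?_
        rw [Finset.mem_range] at hk
        refine if_ctx_congr Iff.rfl (fun hki => ?_) fun _ => rfl
        congr 1
        refine if_congr ?_ rfl rfl
        have h3 := degree_sub_single hki
        constructor
        · rintro ⟨_, h4⟩
          simpa using h4 i
        · intro h4
          refine ⟨by omega, fun j => ?_⟩
          by_cases hj : j = i
          · subst hj
            simpa using h4
          · simpa [Finsupp.single_eq_of_ne hj] using hd.2 j hj
      · rw [if_neg (by tauto)]
        refine Finset.sum_eq_zero fun k hk => ?_
        rw [Finset.mem_range] at hk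
        rw [ite_eq_right_iff]
        intro hki
        have h3 := degree_sub_single hki
        refine mul_eq_zero_of_right _ (if_neg ?_)
        rintro ⟨h4, h5⟩
        refine hd ⟨by omega, fun j hj => ?_⟩
        simpa [Finsupp.single_eq_of_ne hj] using h5 j
    rw [Finset.sum_congr rfl h1]
    by_cases hd : d.degree = n + 1 ∧ ∀ i, d i ≤ 1
    · rw [if_pos hd]
      have h2 : ∀ i ∈ d.support,
          (if d.degree = n + 1 ∧ (∀ j, j ≠ i → d j ≤ 1) ∧ d i = 1 then (1 : ℚ) else 0) = d i := by
        intro i hi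
        rw [Finsupp.mem_support_iff] at hi
        have h3 : d i = 1 := by have := hd.2 i; omega
        rw [if_pos ⟨hd.1, fun j _ => hd.2 j, h3⟩, h3, Nat.cast_one]
      rw [Finset.sum_congr rfl h2, ← Nat.cast_sum, sum_support_eq_degree, hd.1]
      simp
    · rw [if_neg hd, smul_zero]
      refine (Finset.sum_eq_zero fun i _ => if_neg ?_).symm
      rintro ⟨h2, h3, h4⟩
      refine hd ⟨h2, fun j => ?_⟩
      by_cases hj : j = i
      · rw [hj, h4]
      · exact h3 j hj

end Newton

/-! ### The graded cycle index and its recursion -/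

section GradedCycleIndex

open Finset.HasAntidiagonal

/-- The power sum `p_k[X / (1 - q)]`. -/
def gradedPowerSum (k : ℕ) : PowerSeries SymFun :=
  PowerSeries.C (powerSum k) * geomSeries SymFun k

/-- The complete homogeneous function `h_n[X / (1 - q)]`. -/
def gradedCompl (n : ℕ) : PowerSeries SymFun := cycleIndex gradedPowerSum n

/-- In plethystic terms, X/(1 - q) = X + q X/(1 - q). -/
theorem gradedPowerSum_eq {k : ℕ} (hk : 1 ≤ k) :
    gradedPowerSum k = PowerSeries.C (powerSum k) + PowerSeries.X ^ k * gradedPowerSum k := by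
  have h := one_sub_X_pow_mul_geomSeries SymFun hk
  rw [gradedPowerSum, ← sub_eq_iff_eq_add]
  linear_combination PowerSeries.C (powerSum k) * h

theorem complSym_zero : complSym 0 = 1 := by
  have := complSym_eq_cycleIndex 0
  rwa [cycleIndex_zero] at this

/-- Newton's identity says F' = P F for the generating functions. In this form products are easy:
the logarithmic derivatives P add. -/
theorem derivative_mk_eq {A : Type*} [CommRing A] [Algebra ℚ A] {p f : ℕ → A}
    (h : ∀ n, ((n + 1 : ℕ) : ℚ) • f (n + 1) =
      ∑ x ∈ antidiagonal n, p (x.1 + 1) * f x.2) :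
    PowerSeries.derivative A (PowerSeries.mk f) =
      PowerSeries.mk (fun n => p (n + 1)) * PowerSeries.mk f := by
  ext n
  rw [PowerSeries.coeff_derivative, PowerSeries.coeff_mul]
  simp only [PowerSeries.coeff_mk]
  rw [← h n, Algebra.smul_def, mul_comm]
  simp

theorem derivative_mul_eq {A : Type*} [CommRing A] {f g p r : PowerSeries A}
    (hf : PowerSeries.derivative A f = p * f) (hg : PowerSeries.derivative A g = r * g) :
    PowerSeries.derivative A (f * g) = (p + r) * (f * g) := by
  rw [Derivation.leibniz, hf, hg, smul_eq_mul, smul_eq_mul]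
  ring

theorem coeff_succ_of_derivative_eq {A : Type*} [CommRing A] [Algebra ℚ A] {p : ℕ → A}
    {F : PowerSeries A} (h : PowerSeries.derivative A F = PowerSeries.mk p * F) (n : ℕ) :
    ((n + 1 : ℕ) : ℚ) • PowerSeries.coeff (n + 1) F =
      ∑ x ∈ antidiagonal n, p x.1 * PowerSeries.coeff x.2 F := by
  have := congrArg (PowerSeries.coeff n) h
  rw [PowerSeries.coeff_derivative, PowerSeries.coeff_mul] at this
  simp only [PowerSeries.coeff_mk] at this
  rw [← this, Algebra.smul_def, mul_comm]
  simp

theorem neg_one_pow_mul_self {A : Type*} [CommRing A] (k : ℕ) : (-1 : A) ^ k * (-1) ^ k = 1 := by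
  rw [← mul_pow, neg_one_mul, neg_neg, one_pow]

/-- The addition formula for h_n on X + q X/(1 - q). The power sums of the two alphabets add to the
graded power sums, so the product of their generating functions satisfies the Newton recursion of
the left side. -/
theorem gradedCompl_eq_sum (n : ℕ) :
    gradedCompl n = ∑ x ∈ antidiagonal n,
      PowerSeries.C (complSym (x.1 : ℤ)) * (PowerSeries.X ^ x.2 * gradedCompl x.2) := by
  symm
  let P1 : ℕ → PowerSeries SymFun := fun k => PowerSeries.C (powerSum k)
  let P2 : ℕ → PowerSeries SymFun := fun k => PowerSeries.X ^ k * gradedPowerSum k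
  let F1 : ℕ → PowerSeries SymFun := fun n => PowerSeries.C (complSym (n : ℤ))
  let F2 : ℕ → PowerSeries SymFun := fun n => PowerSeries.X ^ n * gradedCompl n
  have h1 := derivative_mk_eq (p := P1) (f := F1) fun n => by
    have := congrArg (PowerSeries.C (R := SymFun)) (cycleIndex_succ powerSum n)
    simp only [← complSym_eq_cycleIndex, map_sum, map_mul] at this
    refine Eq.trans ?_ this
    ext m
    by_cases hm : m = 0 <;> simp [F1, PowerSeries.coeff_C, hm]
  have h2 := derivative_mk_eq (p := P2) (f := F2) fun n => by
    have := congrArg (fun F => PowerSeries.X ^ (n + 1) * F) (cycleIndex_succ gradedPowerSum n)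
    simp only [Finset.mul_sum] at this
    rw [mul_smul_comm] at this
    refine this.trans (Finset.sum_congr rfl fun x hx => ?_)
    rw [mem_antidiagonal] at hx
    have hn : n + 1 = (x.1 + 1) + x.2 := by omega
    rw [hn, pow_add]
    simp only [P2, F2, gradedCompl]
    ring
  refine eq_cycleIndex (p := gradedPowerSum)
    (f := fun n => ∑ x ∈ antidiagonal n,
      PowerSeries.C (complSym (x.1 : ℤ)) * (PowerSeries.X ^ x.2 * gradedCompl x.2)) ?_ (fun n => ?_) n
  · simp [complSym_zero, gradedCompl, cycleIndex_zero]
  · have hF : ∀ m : ℕ, ∑ x ∈ antidiagonal m,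
        PowerSeries.C (complSym (x.1 : ℤ)) * (PowerSeries.X ^ x.2 * gradedCompl x.2) =
        PowerSeries.coeff m (PowerSeries.mk F1 * PowerSeries.mk F2) := by
      intro m
      simp [PowerSeries.coeff_mul, F1, F2]
    simp only [hF]
    have hP : PowerSeries.mk (fun n => gradedPowerSum (n + 1)) =
        PowerSeries.mk (fun n => P1 (n + 1)) + PowerSeries.mk (fun n => P2 (n + 1)) := by
      refine PowerSeries.ext fun k => ?_
      rw [map_add, PowerSeries.coeff_mk, PowerSeries.coeff_mk, PowerSeries.coeff_mk]
      exact gradedPowerSum_eq (by omega)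
    have hD : PowerSeries.derivative _ (PowerSeries.mk F1 * PowerSeries.mk F2) =
        PowerSeries.mk (fun n => gradedPowerSum (n + 1)) *
          (PowerSeries.mk F1 * PowerSeries.mk F2) := by
      rw [derivative_mul_eq h1 h2, hP]
    exact coeff_succ_of_derivative_eq hD n

/-- The product `(1 - q^{i+1}) ⋯ (1 - q^n)`. -/
def qFactorials (R : Type*) [CommRing R] (q : R) (i n : ℕ) : R :=
  ∏ j ∈ Finset.Ico i n, (1 - q ^ (j + 1))

theorem qFactorials_mul (R : Type*) [CommRing R] (q : R) {i n : ℕ} (h : i ≤ n) :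
    qFactorials R q 0 i * qFactorials R q i n = qFactorials R q 0 n :=
  Finset.prod_Ico_consecutive _ (Nat.zero_le i) h

theorem qFactorials_succ (R : Type*) [CommRing R] (q : R) (n : ℕ) :
    qFactorials R q 0 (n + 1) = qFactorials R q 0 n * (1 - q ^ (n + 1)) :=
  Finset.prod_Ico_succ_top (Nat.zero_le n) _

/-- The polynomial `(1 - q) ⋯ (1 - q^n) h_n[X / (1 - q)]`. -/
def frobPoly : ℕ → Polynomial SymFun
  | 0 => 1
  | n + 1 => ∑ i : Fin (n + 1), Polynomial.C (complSym ((n - i + 1 : ℕ) : ℤ)) *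
      (Polynomial.X ^ (i : ℕ) * qFactorials _ Polynomial.X i n * frobPoly i)

theorem coe_qFactorials (i n : ℕ) :
    ((qFactorials _ (Polynomial.X : Polynomial SymFun) i n : Polynomial SymFun) :
      PowerSeries SymFun) = qFactorials _ PowerSeries.X i n := by
  have := map_prod (Polynomial.coeToPowerSeries.ringHom (R := SymFun))
    (fun j => (1 : Polynomial SymFun) - Polynomial.X ^ (j + 1)) (Finset.Ico i n)
  rw [qFactorials, qFactorials]
  refine this.trans (Finset.prod_congr rfl fun j _ => ?_)
  simp

/-- In the addition formula for h_{n+1}[X/(1 - q)], move the term q^{n+1} h_{n+1}[X/(1 - q)] to the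
left and clear denominators. The recursion of `frobPoly` is what remains. -/
theorem coe_frobPoly (n : ℕ) : ((frobPoly n : Polynomial SymFun) : PowerSeries SymFun) =
    qFactorials _ PowerSeries.X 0 n * gradedCompl n := by
  induction n using Nat.strong_induction_on with
  | _ n ih =>
    cases n with
    | zero => simp [frobPoly, qFactorials, gradedCompl, cycleIndex_zero]
    | succ n =>
      have h := gradedCompl_eq_sum (n + 1)
      rw [Finset.Nat.sum_antidiagonal_succ, Nat.cast_zero, complSym_zero, map_one, one_mul,
        ← sub_eq_iff_eq_add'] at h
      have h2 : qFactorials _ PowerSeries.X 0 (n + 1) * gradedCompl (n + 1) =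
          qFactorials _ PowerSeries.X 0 n *
            (gradedCompl (n + 1) - PowerSeries.X ^ (n + 1) * gradedCompl (n + 1)) := by
        rw [qFactorials_succ]
        ring
      rw [h2, h, frobPoly]
      have h3 := map_sum (Polynomial.coeToPowerSeries.ringHom (R := SymFun))
        (fun i : Fin (n + 1) => Polynomial.C (complSym ((n - i + 1 : ℕ) : ℤ)) *
          (Polynomial.X ^ (i : ℕ) * qFactorials _ Polynomial.X i n * frobPoly i)) Finset.univ
      refine h3.trans ?_
      rw [← Finset.Nat.sum_antidiagonal_swap, Finset.Nat.sum_antidiagonal_eq_sum_range_succ_mk,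
        Finset.mul_sum]
      simp only [Prod.swap]
      rw [← Fin.sum_univ_eq_sum_range fun i =>
          qFactorials (PowerSeries SymFun) PowerSeries.X 0 n *
          (PowerSeries.C (complSym ((n - i + 1 : ℕ) : ℤ)) *
            (PowerSeries.X ^ i * gradedCompl i))]
      refine Finset.sum_congr rfl fun i _ => ?_
      rw [map_mul, map_mul, map_mul]
      simp only [Polynomial.coeToPowerSeries.ringHom_apply, Polynomial.coe_C, Polynomial.coe_pow,
        Polynomial.coe_X, coe_qFactorials, ih i i.2]
      rw [← qFactorials_mul _ PowerSeries.X (Nat.lt_succ_iff.1 i.2)]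
      ring

/-- The Hall–Littlewood function of `(1^n)`, by its recursion. -/
def columnPoly : ℕ → Polynomial SymFun
  | 0 => 1
  | n + 1 => ∑ i : Fin (n + 1), Polynomial.C (complSym ((n - i + 1 : ℕ) : ℤ)) *
      ((-1) ^ (n - i : ℕ) * qFactorials _ Polynomial.X i n * columnPoly i)

theorem reflect_one_sub_X_pow (k : ℕ) :
    Polynomial.reflect k (1 - Polynomial.X ^ k : Polynomial SymFun) =
      -(1 - Polynomial.X ^ k) := by
  rw [Polynomial.reflect_sub, Polynomial.reflect_one, Polynomial.reflect_monomial,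
    Polynomial.revAt_le le_rfl, Nat.sub_self, pow_zero]
  ring

/-- Each factor 1 - q^k is antipalindromic, so the reversal of the product only brings a sign per
factor. These signs are the ones in the recursion of `columnPoly`. -/
theorem qFactorials_reflect (i n : ℕ) :
    (qFactorials _ (Polynomial.X : Polynomial SymFun) i n).natDegree ≤
        ∑ j ∈ Finset.Ico i n, (j + 1) ∧
      Polynomial.reflect (∑ j ∈ Finset.Ico i n, (j + 1))
        (qFactorials _ (Polynomial.X : Polynomial SymFun) i n) =
      (-1) ^ (n - i) * qFactorials _ Polynomial.X i n := by
  have key : ∀ S : Finset ℕ,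
      (∏ j ∈ S, (1 - Polynomial.X ^ (j + 1) : Polynomial SymFun)).natDegree ≤ ∑ j ∈ S, (j + 1) ∧
      Polynomial.reflect (∑ j ∈ S, (j + 1))
        (∏ j ∈ S, (1 - Polynomial.X ^ (j + 1) : Polynomial SymFun)) =
      (-1) ^ S.card * ∏ j ∈ S, (1 - Polynomial.X ^ (j + 1)) := by
    intro S
    induction S using Finset.induction_on with
    | empty => simp
    | insert j S hj ih =>
      have hdeg : (1 - Polynomial.X ^ (j + 1) : Polynomial SymFun).natDegree ≤ j + 1 :=
        (Polynomial.natDegree_sub_le _ _).trans (by simp)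
      rw [Finset.prod_insert hj, Finset.sum_insert hj, Finset.card_insert_of_notMem hj,
        Polynomial.reflect_mul _ _ hdeg ih.1, ih.2, reflect_one_sub_X_pow]
      refine ⟨Polynomial.natDegree_mul_le.trans (Nat.add_le_add hdeg ih.1), ?_⟩
      rw [pow_succ]
      ring
  have := key (Finset.Ico i n)
  rwa [Nat.card_Ico] at this

/-- Reflection at degree n(n-1)/2 matches the two recursions term by term. -/
theorem columnPoly_reflect (n : ℕ) :
    (columnPoly n).natDegree ≤ ∑ j ∈ Finset.range n, j ∧
      Polynomial.reflect (∑ j ∈ Finset.range n, j) (columnPoly n) = frobPoly n := by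
  induction n using Nat.strong_induction_on with
  | _ n ih =>
    cases n with
    | zero => simp [columnPoly, frobPoly]
    | succ n =>
      have hterm : ∀ i : Fin (n + 1),
          (Polynomial.C (complSym ((n - i + 1 : ℕ) : ℤ)) *
            ((-1) ^ (n - i : ℕ) * qFactorials _ Polynomial.X i n *
              columnPoly i)).natDegree ≤ ∑ j ∈ Finset.range (n + 1), j ∧
          Polynomial.reflect (∑ j ∈ Finset.range (n + 1), j)
            (Polynomial.C (complSym ((n - i + 1 : ℕ) : ℤ)) *
              ((-1) ^ (n - i : ℕ) * qFactorials _ Polynomial.X i n * columnPoly i)) =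
          Polynomial.C (complSym ((n - i + 1 : ℕ) : ℤ)) *
            (Polynomial.X ^ (i : ℕ) * qFactorials _ Polynomial.X i n * frobPoly i) := by
        intro i
        have hi : (i : ℕ) ≤ n := Nat.lt_succ_iff.1 i.2
        have hq := qFactorials_reflect i n
        -- The degree splits over the three factors; the surplus i is spent on reflecting the
        -- constant 1, which produces the power X^i of `frobPoly`.
        have hs : ∑ j ∈ Finset.range (n + 1), j = (i + ∑ j ∈ Finset.Ico (i : ℕ) n, (j + 1)) +
            ∑ j ∈ Finset.range i, j := by
          have h1 : ∑ j ∈ Finset.Ico (i : ℕ) n, (j + 1) = ∑ j ∈ Finset.Ico ((i : ℕ) + 1) (n + 1), j :=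
            Finset.sum_Ico_add' (fun j => j) _ _ 1
          have h2 := Finset.sum_eq_sum_Ico_succ_bot (Nat.lt_succ_of_le hi) (fun j => j)
          have h3 := Finset.sum_range_add_sum_Ico (fun j => j) (Nat.le_succ_of_le hi)
          simp only [Nat.succ_eq_add_one] at h2 h3
          omega
        have hC : Polynomial.C (complSym ((n - i + 1 : ℕ) : ℤ)) *
            ((-1) ^ (n - i : ℕ) * qFactorials _ Polynomial.X i n * columnPoly i) =
            Polynomial.C (complSym ((n - i + 1 : ℕ) : ℤ) * (-1) ^ (n - i : ℕ)) *
              (1 * qFactorials _ Polynomial.X i n * columnPoly i) := by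
          rw [map_mul, map_pow, map_neg, map_one]
          ring
        have hd1 : (1 * qFactorials _ (Polynomial.X : Polynomial SymFun) i n).natDegree ≤
            i + ∑ j ∈ Finset.Ico (i : ℕ) n, (j + 1) := by
          rw [one_mul]
          exact hq.1.trans (Nat.le_add_left _ _)
        rw [hC, hs]
        constructor
        · exact (Polynomial.natDegree_C_mul_le _ _).trans
            (Polynomial.natDegree_mul_le.trans (Nat.add_le_add hd1 (ih i i.2).1))
        · rw [Polynomial.reflect_C_mul, Polynomial.reflect_mul _ _ hd1 (ih i i.2).1, (ih i i.2).2,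
            Polynomial.reflect_mul _ _ (by simp) hq.1, hq.2, Polynomial.reflect_one, map_mul,
            map_pow, map_neg, map_one]
          have h2 : ((-1 : Polynomial SymFun) ^ (n - i : ℕ)) * (-1) ^ (n - i : ℕ) = 1 :=
            neg_one_pow_mul_self _
          linear_combination Polynomial.C (complSym ((n - i + 1 : ℕ) : ℤ)) * Polynomial.X ^ (i : ℕ) *
            qFactorials _ Polynomial.X (i : ℕ) n * frobPoly i * h2
      rw [columnPoly, frobPoly]
      refine ⟨Polynomial.natDegree_sum_le_of_forall_le _ _ fun i _ => (hterm i).1, ?_⟩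
      rw [← Finset.sum_congr rfl fun i _ => (hterm i).2]
      ext1 m
      simp only [Polynomial.coeff_reflect, Polynomial.finsetSum_coeff]

theorem coeff_zero_frobPoly (n : ℕ) : (frobPoly n).coeff 0 = complSym n := by
  cases n with
  | zero => simp [frobPoly, complSym_zero]
  | succ n =>
    rw [frobPoly, Polynomial.finsetSum_coeff, Finset.sum_eq_single 0]
    · have h1 : (qFactorials _ (Polynomial.X : Polynomial SymFun) 0 n).coeff 0 = 1 := by
        rw [qFactorials, Polynomial.coeff_zero_prod]
        exact Finset.prod_eq_one fun j _ => by simp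
      simp [Polynomial.mul_coeff_zero, h1, frobPoly]
    · intro i _ hi
      have : (i : ℕ) ≠ 0 := fun h => hi (Fin.ext h)
      simp [Polynomial.mul_coeff_zero, Polynomial.coeff_X_pow, this.symm]
    · simp

theorem complSym_ne_zero (n : ℕ) : complSym n ≠ 0 := fun h => by
  have h1 := congrFun h (Finsupp.single 0 n)
  have h2 : complSym n (Finsupp.single 0 n) = 1 := by simp [complSym]
  rw [h2] at h1
  exact one_ne_zero h1

/-- `reverse` reflects at the true degree. This is n(n-1)/2 because the coefficient there is the
constant term h_n of `frobPoly`, which is not zero. -/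
theorem reverse_columnPoly (n : ℕ) : (columnPoly n).reverse = frobPoly n := by
  obtain ⟨h1, h2⟩ := columnPoly_reflect n
  have h3 : (columnPoly n).natDegree = ∑ j ∈ Finset.range n, j := by
    refine Polynomial.natDegree_eq_of_le_of_coeff_ne_zero h1 ?_
    have := coeff_zero_frobPoly n
    rw [← h2, Polynomial.coeff_reflect, Polynomial.revAt_le (Nat.zero_le _), Nat.sub_zero] at this
    rw [this]
    exact complSym_ne_zero n
  rw [Polynomial.reverse, h3, h2]

end GradedCycleIndex

/-! ### Raising operators and Hall–Littlewood functions of columns -/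

section HallLittlewood

/-- The coefficient of `R^m` in `(1 - R) / (1 - q R)`, for an element `q` of a ring. -/
def raisingSeq {B : Type*} [CommRing B] (q : B) : ℕ → B
  | 0 => 1
  | m + 1 => q ^ (m + 1) - q ^ m

theorem map_raisingSeq {B C : Type*} [CommRing B] [CommRing C] (φ : B →+* C) (q : B) (m : ℕ) :
    φ (raisingSeq q m) = raisingSeq (φ q) m := by
  cases m <;> simp [raisingSeq]

theorem raisingCoeff_eq (m : ℕ) : raisingCoeff m = raisingSeq Polynomial.X m := by
  cases m <;> rfl

/-- Pairs `i < j`. -/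
abbrev LTPair (l : ℕ) : Type := {p : Fin l × Fin l // p.1 < p.2}

/-- The exponent vector `α` after the raising operators `R_p ^ m_p` are applied. -/
def raisedIndex {l : ℕ} (α : Fin l → ℕ) (m : LTPair l → ℕ) (i : Fin l) : ℤ :=
  (α i : ℤ) + (∑ p with p.1.1 = i, (m p : ℤ)) - ∑ p with p.1.2 = i, (m p : ℤ)

variable {B : Type*} [CommRing B]

/-- The term of the raising operator formula with exponents `m`. -/
def raisingTerm (q : B) (h : ℤ → B) {l : ℕ} (α : Fin l → ℕ) (m : LTPair l → ℕ) : B :=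
  (∏ p, raisingSeq q (m p)) * ∏ i, h (raisedIndex α m i)

/-- The raising operator formula with exponents bounded by `b`. -/
def raisingSum (q : B) (h : ℤ → B) {l : ℕ} (α : Fin l → ℕ) (b : LTPair l → ℕ) : B :=
  ∑ m ∈ Fintype.piFinset fun p => Finset.range (b p), raisingTerm q h α m

/-- Look at the sum of the indices at places ≥ j, for p = (i, j). No raising operator increases it,
and R_p lowers it by `m p`. Hence some index is negative, which makes large exponents irrelevant. -/
theorem sum_raisedIndex_lt_zero {l : ℕ} (α : Fin l → ℕ) (m : LTPair l → ℕ) (p : LTPair l)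
    (hp : ∑ i, α i < m p) : ∑ i with p.1.2 ≤ i, raisedIndex α m i < 0 := by
  have h1 : ∀ g : LTPair l → Fin l, ∑ i with p.1.2 ≤ i, ∑ r with g r = i, (m r : ℤ) =
      ∑ r, if p.1.2 ≤ g r then (m r : ℤ) else 0 := by
    intro g
    simp only [Finset.sum_filter (fun r => g r = _)]
    rw [Finset.sum_comm]
    refine Finset.sum_congr rfl fun r _ => ?_
    rw [Finset.sum_ite_eq]
    simp
  simp only [raisedIndex]
  rw [Finset.sum_sub_distrib, Finset.sum_add_distrib, h1 fun r => r.1.1, h1 fun r => r.1.2]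
  have h2 : ∑ i with p.1.2 ≤ i, (α i : ℤ) ≤ ∑ i, (α i : ℤ) :=
    Finset.sum_le_sum_of_subset_of_nonneg (Finset.filter_subset _ _) fun i _ _ => by positivity
  have h3 : (m p : ℤ) ≤ ∑ r : LTPair l, ((if p.1.2 ≤ r.1.2 then (m r : ℤ) else 0) -
      if p.1.2 ≤ r.1.1 then (m r : ℤ) else 0) := by
    refine le_trans (le_of_eq ?_) (Finset.single_le_sum
      (f := fun r : LTPair l => (if p.1.2 ≤ r.1.2 then (m r : ℤ) else 0) -
        if p.1.2 ≤ r.1.1 then (m r : ℤ) else 0) (fun r _ => ?_) (Finset.mem_univ p))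
    · simp [not_le.2 p.2]
    · have := r.2
      split_ifs with h4 h5 h5
      · simp
      · simp
      · exact absurd (h5.trans this.le) h4
      · simp
  rw [Finset.sum_sub_distrib] at h3
  have h4 : ((∑ i, α i : ℕ) : ℤ) < m p := by exact_mod_cast hp
  push_cast at h4
  linarith

theorem raisingTerm_eq_zero (q : B) {h : ℤ → B} (hneg : ∀ k < 0, h k = 0) {l : ℕ} (α : Fin l → ℕ)
    (m : LTPair l → ℕ) (p : LTPair l) (hp : ∑ i, α i < m p) : raisingTerm q h α m = 0 := by
  obtain ⟨i, _, hi⟩ := Finset.exists_lt_of_sum_lt (s := Finset.univ.filter fun i => p.1.2 ≤ i)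
    (f := raisedIndex α m) (g := fun _ => 0)
    (by rw [Finset.sum_const_zero]; exact sum_raisedIndex_lt_zero α m p hp)
  rw [raisingTerm, Finset.prod_eq_zero (Finset.mem_univ i) (hneg _ hi), mul_zero]

theorem raisingSum_eq_of_lt (q : B) {h : ℤ → B} (hneg : ∀ k < 0, h k = 0) {l : ℕ} (α : Fin l → ℕ)
    {b : LTPair l → ℕ} (hb : ∀ p, ∑ i, α i < b p) :
    raisingSum q h α b = raisingSum q h α fun _ => ∑ i, α i + 1 := by
  symm
  refine Finset.sum_subset (fun m hm => ?_) fun m _ hm => ?_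
  · rw [Fintype.mem_piFinset] at hm ⊢
    intro p
    have h1 : m p < ∑ i, α i + 1 := Finset.mem_range.1 (hm p)
    have h2 := hb p
    exact Finset.mem_range.2 (by omega)
  · rw [Fintype.mem_piFinset] at hm
    push Not at hm
    obtain ⟨p, hp⟩ := hm
    rw [Finset.mem_range] at hp
    exact raisingTerm_eq_zero q hneg α m p (by omega)

/-- A pair of indices either contains the first index or not. -/
def ltPairEquiv (l : ℕ) : Fin l ⊕ LTPair l ≃ LTPair (l + 1) :=
  Equiv.ofBijective (Sum.elim (fun j => ⟨(0, j.succ), Fin.succ_pos j⟩)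
    fun p => ⟨(p.1.1.succ, p.1.2.succ), Fin.succ_lt_succ_iff.2 p.2⟩) <| by
    constructor
    · rintro (i | ⟨⟨i, j⟩, hij⟩) (i' | ⟨⟨i', j'⟩, hij'⟩) h <;>
        simp only [Sum.elim_inl, Sum.elim_inr, Subtype.mk.injEq, Prod.mk.injEq, Fin.succ_inj,
          Fin.succ_ne_zero, (Fin.succ_ne_zero _).symm, false_and, true_and] at h
      · rw [h]
      · rw [Sum.inr.injEq, Subtype.mk.injEq, Prod.mk.injEq]
        exact h
    · rintro ⟨⟨i, j⟩, hij⟩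
      obtain ⟨j, rfl⟩ := Fin.exists_succ_eq.2 (Fin.pos_iff_ne_zero.1 (lt_of_le_of_lt (Fin.zero_le i) hij))
      induction i using Fin.cases with
      | zero => exact ⟨Sum.inl j, rfl⟩
      | succ i => exact ⟨Sum.inr ⟨(i, j), Fin.succ_lt_succ_iff.1 hij⟩, rfl⟩

theorem ltPairEquiv_inl {l : ℕ} (j : Fin l) :
    (ltPairEquiv l (Sum.inl j)).1 = (0, j.succ) := rfl

theorem ltPairEquiv_inr {l : ℕ} (p : LTPair l) :
    (ltPairEquiv l (Sum.inr p)).1 = (p.1.1.succ, p.1.2.succ) := rfl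

/-- Exponents for the pairs with first index and for the other pairs. -/
def joinExponents {l : ℕ} (a : Fin l → ℕ) (m : LTPair l → ℕ) (p : LTPair (l + 1)) : ℕ :=
  Sum.elim a m ((ltPairEquiv l).symm p)

theorem raisedIndex_join_zero {l : ℕ} (α : Fin (l + 1) → ℕ) (a : Fin l → ℕ) (m : LTPair l → ℕ) :
    raisedIndex α (joinExponents a m) 0 = (α 0 : ℤ) + ((∑ j, a j : ℕ) : ℤ) := by
  rw [raisedIndex, Finset.sum_filter, Finset.sum_filter, ← (ltPairEquiv l).sum_comp,
    ← (ltPairEquiv l).sum_comp]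
  simp [Fintype.sum_sum_type, ltPairEquiv_inl, ltPairEquiv_inr, joinExponents, Fin.succ_ne_zero]

theorem raisedIndex_join_succ {l : ℕ} (α : Fin (l + 1) → ℕ) (a : Fin l → ℕ) (m : LTPair l → ℕ)
    (i : Fin l) :
    raisedIndex α (joinExponents a m) i.succ = raisedIndex (Fin.tail α) m i - (a i : ℤ) := by
  rw [raisedIndex, Finset.sum_filter, Finset.sum_filter, ← (ltPairEquiv l).sum_comp,
    ← (ltPairEquiv l).sum_comp, raisedIndex, Finset.sum_filter, Finset.sum_filter]
  simp [Fintype.sum_sum_type, ltPairEquiv_inl, ltPairEquiv_inr, joinExponents,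
    (Fin.succ_ne_zero _).symm, Fin.tail]
  ring

theorem raisingTerm_join (q : B) (h : ℤ → B) {l : ℕ} (α : Fin (l + 1) → ℕ) (a : Fin l → ℕ)
    (m : LTPair l → ℕ) :
    raisingTerm q h α (joinExponents a m) =
      (∏ p, raisingSeq q (m p)) *
        (h ((α 0 : ℤ) + ((∑ j, a j : ℕ) : ℤ)) *
          ∏ j, (raisingSeq q (a j) * h (raisedIndex (Fin.tail α) m j - (a j : ℤ)))) := by
  rw [raisingTerm, Fin.prod_univ_succ, ← (ltPairEquiv l).prod_comp, Fintype.prod_sum_type,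
    raisedIndex_join_zero, Finset.prod_mul_distrib]
  simp only [raisedIndex_join_succ, joinExponents, Equiv.symm_apply_apply, Sum.elim_inl,
    Sum.elim_inr]
  ring

theorem raisingSum_join (q : B) (h : ℤ → B) {l : ℕ} (α : Fin (l + 1) → ℕ) (b₁ : Fin l → ℕ)
    (b₂ : LTPair l → ℕ) :
    raisingSum q h α (joinExponents b₁ b₂) =
      ∑ m ∈ Fintype.piFinset fun p => Finset.range (b₂ p),
        ∑ a ∈ Fintype.piFinset fun j => Finset.range (b₁ j),
          raisingTerm q h α (joinExponents a m) := by
  rw [raisingSum, ← Finset.sum_product']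
  refine Finset.sum_bij' (fun m _ => (fun p => m (ltPairEquiv l (Sum.inr p)),
    fun j => m (ltPairEquiv l (Sum.inl j)))) (fun x _ => joinExponents x.2 x.1) ?_ ?_ ?_ ?_ ?_
  · intro m hm
    rw [Fintype.mem_piFinset] at hm
    rw [Finset.mem_product, Fintype.mem_piFinset, Fintype.mem_piFinset]
    refine ⟨fun p => ?_, fun j => ?_⟩
    · simpa [joinExponents] using hm (ltPairEquiv l (Sum.inr p))
    · simpa [joinExponents] using hm (ltPairEquiv l (Sum.inl j))
  · rintro ⟨m, a⟩ hx
    rw [Finset.mem_product, Fintype.mem_piFinset, Fintype.mem_piFinset] at hx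
    rw [Fintype.mem_piFinset]
    intro p
    obtain ⟨s, rfl⟩ := (ltPairEquiv l).surjective p
    cases s with
    | inl j => simpa [joinExponents] using hx.2 j
    | inr p => simpa [joinExponents] using hx.1 p
  · intro m _
    funext p
    obtain ⟨s, rfl⟩ := (ltPairEquiv l).surjective p
    cases s <;> simp [joinExponents]
  · rintro ⟨m, a⟩ _
    simp [joinExponents]
  · intro m _
    congr 1
    funext p
    obtain ⟨s, rfl⟩ := (ltPairEquiv l).surjective p
    cases s <;> simp [joinExponents]

open Polynomial in
/-- The sequence with generating function `H(t) (1 - v t) / (1 - q v t)`. -/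
def twistSeq (q : B) (h : ℤ → B) (k : ℤ) : Polynomial B :=
  ∑ a ∈ Finset.range (k.toNat + 1), monomial a (raisingSeq q a * h (k - (a : ℤ)))

theorem twistSeq_eq (q : B) {h : ℤ → B} (hneg : ∀ k < 0, h k = 0) (k : ℤ) {K : ℕ}
    (hK : k.toNat < K) : twistSeq q h k =
      ∑ a ∈ Finset.range K, Polynomial.monomial a (raisingSeq q a * h (k - (a : ℤ))) := by
  refine Finset.sum_subset (Finset.range_mono (by omega)) fun a _ ha => ?_
  rw [Finset.mem_range] at ha
  rw [hneg _ (by omega), mul_zero, map_zero]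

theorem twistSeq_neg (q : B) {h : ℤ → B} (hneg : ∀ k < 0, h k = 0) (k : ℤ) (hk : k < 0) :
    twistSeq q h k = 0 :=
  Finset.sum_eq_zero fun a _ => by rw [hneg _ (by omega), mul_zero, map_zero]

theorem twistSeq_zero (q : B) {h : ℤ → B} (h0 : h 0 = 1) : twistSeq q h 0 = 1 := by
  simp [twistSeq, raisingSeq, h0]

/-- The coefficientwise form of H'(t)(1 - q v t) = H(t)(1 - v t), where H' is the generating
function of the twisted sequence. -/
theorem twistSeq_succ (q : B) (h : ℤ → B) (k : ℕ) :
    twistSeq q h (k + 1 : ℕ) - Polynomial.C q * Polynomial.X * twistSeq q h k =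
      Polynomial.C (h (k + 1 : ℕ)) - Polynomial.X * Polynomial.C (h k) := by
  have h1 : twistSeq q h (k + 1 : ℕ) = Polynomial.C (h (k + 1 : ℕ)) +
      ∑ a ∈ Finset.range (k + 1),
        Polynomial.monomial (a + 1) (raisingSeq q (a + 1) * h ((k : ℤ) - a)) := by
    rw [twistSeq, Int.toNat_natCast, Finset.sum_range_succ', add_comm]
    congr 1
    · simp [raisingSeq]
    · refine Finset.sum_congr rfl fun a _ => ?_
      congr 3
      push_cast
      ring
  rw [h1, twistSeq, Int.toNat_natCast, Finset.mul_sum, Finset.sum_range_succ',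
    Finset.sum_range_succ', ← sub_eq_zero]
  have h2 : ∀ a : ℕ, Polynomial.C q * Polynomial.X *
      Polynomial.monomial (a + 1) (raisingSeq q (a + 1) * h ((k : ℤ) - (a + 1 : ℕ))) =
      Polynomial.monomial (a + 1 + 1) (raisingSeq q (a + 1 + 1) * h ((k : ℤ) - (a + 1 : ℕ))) := by
    intro a
    rw [mul_assoc, Polynomial.X_mul_monomial, Polynomial.C_mul_monomial]
    congr 1
    simp only [raisingSeq]
    ring
  simp only [h2]
  simp only [raisingSeq, ← Polynomial.C_mul_X_pow_eq_monomial,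
    Nat.cast_zero, sub_zero, map_mul, map_sub, map_pow, map_one]
  ring

/-- The linear map `v^d ↦ h_{c + d}`. -/
def shiftEval (h : ℤ → B) (c : ℤ) : Polynomial B →ₗ[B] B :=
  (Polynomial.basisMonomials B).constr B fun d => h (c + (d : ℤ))

theorem shiftEval_monomial (h : ℤ → B) (c : ℤ) (d : ℕ) (x : B) :
    shiftEval h c (Polynomial.monomial d x) = h (c + (d : ℤ)) * x := by
  have : Polynomial.monomial d x = x • Polynomial.basisMonomials B d := by
    rw [Polynomial.coe_basisMonomials, Polynomial.smul_monomial, smul_eq_mul, mul_one]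
  rw [this, map_smul, shiftEval, Module.Basis.constr_basis, smul_eq_mul, mul_comm]

theorem prod_monomial {ι : Type*} (s : Finset ι) (a : ι → ℕ) (x : ι → B) :
    ∏ i ∈ s, Polynomial.monomial (a i) (x i) =
      Polynomial.monomial (∑ i ∈ s, a i) (∏ i ∈ s, x i) := by
  classical
  induction s using Finset.induction_on with
  | empty => simp
  | insert i s hi ih =>
    rw [Finset.prod_insert hi, Finset.sum_insert hi, Finset.prod_insert hi, ih,
      Polynomial.monomial_mul_monomial]

/-- The raising operator formula, expanded along the first index. -/
theorem raisingSum_succ (q : B) {h : ℤ → B} (hneg : ∀ k < 0, h k = 0) {l : ℕ}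
    (α : Fin (l + 1) → ℕ) :
    raisingSum q h α (fun _ => ∑ i, α i + 1) = shiftEval h (α 0)
      (raisingSum (Polynomial.C q) (twistSeq q h) (Fin.tail α)
        fun _ => ∑ i, (Fin.tail α) i + 1) := by
  let b₂ : LTPair l → ℕ := fun _ => ∑ i, α i + 1
  let S : Finset (LTPair l → ℕ) := Fintype.piFinset fun p => Finset.range (b₂ p)
  -- K exceeds both the size of α and every index that can occur, so neither the raising sum nor the
  -- twisted sequences lose a term when truncated at K.
  let K : ℕ := ∑ i, α i + 1 + ∑ m ∈ S, ∑ j, (raisedIndex (Fin.tail α) m j).toNat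
  have hK : ∀ m ∈ S, ∀ j, (raisedIndex (Fin.tail α) m j).toNat < K := by
    intro m hm j
    have h1 := Finset.single_le_sum
      (f := fun m => ∑ j, (raisedIndex (Fin.tail α) m j).toNat) (fun _ _ => Nat.zero_le _) hm
    have h2 := Finset.single_le_sum
      (f := fun j => (raisedIndex (Fin.tail α) m j).toNat) (fun _ _ => Nat.zero_le _)
      (Finset.mem_univ j)
    exact (h2.trans h1).trans_lt (by simp only [K]; omega)
  have htail : ∑ i, Fin.tail α i ≤ ∑ i, α i := by
    rw [Fin.sum_univ_succ α]
    exact Nat.le_add_left _ _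
  rw [← raisingSum_eq_of_lt (Polynomial.C q) (twistSeq_neg q hneg) (Fin.tail α) (b := b₂)
      (fun p => Nat.lt_succ_of_le htail),
    ← raisingSum_eq_of_lt q hneg α (b := joinExponents (fun _ => K) b₂) (fun p => ?_),
    raisingSum_join, raisingSum, map_sum]
  · refine Finset.sum_congr rfl fun m hm => ?_
    -- Expanding the product of twisted sequences chooses an exponent a_j of R_{0j} for each j. The
    -- power of v is their sum, by which `shiftEval` raises the first index.
    rw [raisingTerm, Finset.prod_congr rfl fun j _ => twistSeq_eq q hneg _ (hK m hm j),
      Finset.prod_univ_sum, Finset.mul_sum, map_sum]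
    refine Finset.sum_congr rfl fun a _ => ?_
    rw [prod_monomial, ← Finset.prod_congr rfl fun p _ => map_raisingSeq Polynomial.C q (m p),
      ← map_prod, Polynomial.C_mul_monomial, shiftEval_monomial, raisingTerm_join]
    ring
  · obtain ⟨s, rfl⟩ := (ltPairEquiv l).surjective p
    cases s with
    | inl j => simp only [joinExponents, Equiv.symm_apply_apply, Sum.elim_inl]; omega
    | inr p => simp only [joinExponents, Equiv.symm_apply_apply, Sum.elim_inr, b₂]; omega

/-- The recursion of the Hall–Littlewood functions of columns. -/
def columnRec (q : B) (h : ℤ → B) : ℕ → B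
  | 0 => 1
  | n + 1 => ∑ i : Fin (n + 1), h ((n - i + 1 : ℕ) : ℤ) *
      ((-1) ^ (n - i : ℕ) * qFactorials B q i n * columnRec q h i)

theorem columnRec_succ (q : B) (h : ℤ → B) (n : ℕ) : columnRec q h (n + 1) =
    ∑ x ∈ Finset.HasAntidiagonal.antidiagonal n, h ((x.1 + 1 : ℕ) : ℤ) *
      ((-1) ^ x.1 * qFactorials B q x.2 n * columnRec q h x.2) := by
  rw [columnRec, ← Finset.Nat.sum_antidiagonal_swap,
    Finset.Nat.sum_antidiagonal_eq_sum_range_succ_mk]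
  simp only [Prod.swap]
  rw [← Fin.sum_univ_eq_sum_range fun i =>
    h ((n - i + 1 : ℕ) : ℤ) * ((-1) ^ (n - i) * qFactorials B q i n * columnRec q h i)]

theorem map_qFactorials {C : Type*} [CommRing C] (φ : B →+* C) (q : B) (i n : ℕ) :
    φ (qFactorials B q i n) = qFactorials C (φ q) i n := by
  simp [qFactorials, map_prod]

theorem map_columnRec {C : Type*} [CommRing C] (φ : B →+* C) (q : B) (h : ℤ → B) (n : ℕ) :
    φ (columnRec q h n) = columnRec (φ q) (fun k => φ (h k)) n := by
  induction n using Nat.strong_induction_on with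
  | _ n ih =>
    cases n with
    | zero => simp [columnRec]
    | succ n =>
      rw [columnRec, columnRec, map_sum]
      refine Finset.sum_congr rfl fun i _ => ?_
      rw [map_mul, map_mul, map_mul, map_qFactorials, ih i i.2, map_pow, map_neg, map_one]

theorem columnPoly_eq_columnRec (n : ℕ) :
    columnPoly n = columnRec Polynomial.X (fun k => Polynomial.C (complSym k)) n := by
  induction n using Nat.strong_induction_on with
  | _ n ih =>
    cases n with
    | zero => simp [columnPoly, columnRec]
    | succ n =>
      rw [columnPoly, columnRec]
      exact Finset.sum_congr rfl fun i _ => by rw [ih i i.2]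

/-- The normalized and signed column functions. -/
def columnSeries (q : B) (h : ℤ → B) : PowerSeries B :=
  PowerSeries.mk fun n => (-1) ^ n * Ring.inverse (qFactorials B q 0 n) * columnRec q h n

theorem isUnit_qFactorials {q : B} (hq : ∀ i : ℕ, IsUnit (1 - q ^ (i + 1))) (i n : ℕ) :
    IsUnit (qFactorials B q i n) := by
  rw [qFactorials]
  exact Finset.prod_induction _ IsUnit (fun _ _ => IsUnit.mul) isUnit_one fun j _ => hq j

theorem qFactorials_mul_coeff_columnSeries {q : B} (hq : ∀ i : ℕ, IsUnit (1 - q ^ (i + 1)))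
    (h : ℤ → B) (n : ℕ) :
    qFactorials B q 0 n * PowerSeries.coeff n (columnSeries q h) = (-1) ^ n * columnRec q h n := by
  have := Ring.mul_inverse_cancel _ (isUnit_qFactorials hq 0 n)
  rw [columnSeries, PowerSeries.coeff_mk]
  linear_combination (-1) ^ n * columnRec q h n * this

/-- Dividing the column recursion by the q-factorial turns it into the q-difference equation F(qt) =
H(t) F(t). -/
theorem rescale_columnSeries {q : B} (hq : ∀ i : ℕ, IsUnit (1 - q ^ (i + 1))) {h : ℤ → B}
    (h0 : h 0 = 1) : PowerSeries.rescale q (columnSeries q h) =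
      PowerSeries.mk (fun k => h (k : ℤ)) * columnSeries q h := by
  refine PowerSeries.ext fun n => ?_
  rw [PowerSeries.coeff_rescale, PowerSeries.coeff_mul]
  cases n with
  | zero => simp [h0]
  | succ n =>
    rw [Finset.Nat.sum_antidiagonal_succ]
    simp only [PowerSeries.coeff_mk, Nat.cast_zero, h0, one_mul]
    refine (isUnit_qFactorials hq 0 n).mul_left_cancel ?_
    have h1 := qFactorials_mul_coeff_columnSeries hq h (n + 1)
    rw [columnRec_succ, qFactorials_succ, Finset.mul_sum] at h1
    have h2 : ∑ x ∈ Finset.HasAntidiagonal.antidiagonal n, (-1) ^ (n + 1) *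
        (h ((x.1 + 1 : ℕ) : ℤ) * ((-1) ^ x.1 * qFactorials B q x.2 n * columnRec q h x.2)) =
        - ∑ x ∈ Finset.HasAntidiagonal.antidiagonal n, qFactorials B q 0 n *
          (h ((x.1 + 1 : ℕ) : ℤ) * PowerSeries.coeff x.2 (columnSeries q h)) := by
      rw [← Finset.sum_neg_distrib]
      refine Finset.sum_congr rfl fun x hx => ?_
      rw [Finset.HasAntidiagonal.mem_antidiagonal] at hx
      have h3 := qFactorials_mul_coeff_columnSeries hq h x.2
      have h4 := qFactorials_mul B q (i := x.2) (n := n) (by omega)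
      have h5 := neg_one_pow_mul_self (A := B) x.1
      rw [← h4, ← hx, pow_succ, pow_add]
      linear_combination (-h ((x.1 + 1 : ℕ) : ℤ) * qFactorials B q x.2 (x.1 + x.2)) * h3 * (-1) +
        (-(-1) ^ x.2 * h ((x.1 + 1 : ℕ) : ℤ) * qFactorials B q x.2 (x.1 + x.2) *
          columnRec q h x.2) * h5
    rw [h2, ← Finset.mul_sum] at h1
    linear_combination (-1) * h1

/-- The coefficient of t^{n+1} satisfies (q^{n+1} - 1) F_{n+1} = terms in earlier coefficients, and
1 - q^{n+1} is a unit. -/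
theorem eq_of_rescale_eq {q : B} (hq : ∀ i : ℕ, IsUnit (1 - q ^ (i + 1))) {H F G : PowerSeries B}
    (hH : PowerSeries.coeff 0 H = 1) (hF : PowerSeries.rescale q F = H * F)
    (hG : PowerSeries.rescale q G = H * G)
    (h0 : PowerSeries.coeff 0 F = PowerSeries.coeff 0 G) : F = G := by
  refine PowerSeries.ext fun n => ?_
  induction n using Nat.strong_induction_on with
  | _ n ih =>
    cases n with
    | zero => exact h0
    | succ n =>
      have h1 := congrArg (PowerSeries.coeff (n + 1)) hF
      have h2 := congrArg (PowerSeries.coeff (n + 1)) hG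
      rw [PowerSeries.coeff_rescale, PowerSeries.coeff_mul, Finset.Nat.sum_antidiagonal_succ,
        hH, one_mul] at h1 h2
      have h3 : ∑ x ∈ Finset.HasAntidiagonal.antidiagonal n, PowerSeries.coeff (x.1 + 1) H *
          PowerSeries.coeff x.2 F = ∑ x ∈ Finset.HasAntidiagonal.antidiagonal n,
            PowerSeries.coeff (x.1 + 1) H * PowerSeries.coeff x.2 G := by
        refine Finset.sum_congr rfl fun x hx => ?_
        rw [Finset.HasAntidiagonal.mem_antidiagonal] at hx
        rw [ih x.2 (by omega)]
      refine (hq n).mul_left_cancel ?_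
      linear_combination h2 - h1 - h3

/-- Uniqueness for the q-difference equation gives F = (1 - v t) F' for the two column series.
Comparing coefficients is a two-term recursion, which is solved for the twisted sequence. -/
theorem columnRec_twist {q : B} (hq : ∀ i : ℕ, IsUnit (1 - q ^ (i + 1))) (v : B) {h h' : ℤ → B}
    (h0 : h 0 = 1) (h0' : h' 0 = 1)
    (hh : ∀ k : ℕ, h' (k + 1 : ℕ) - q * v * h' k = h (k + 1 : ℕ) - v * h k) (n : ℕ) :
    columnRec q h' n = ∑ x ∈ Finset.HasAntidiagonal.antidiagonal n,
      (-v) ^ x.1 * qFactorials B q x.2 n * columnRec q h x.2 := by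
  have hE : columnSeries q h =
      (1 - PowerSeries.C v * PowerSeries.X) * columnSeries q h' := by
    refine eq_of_rescale_eq hq (H := PowerSeries.mk fun k => h (k : ℤ)) (by simp [h0])
      (rescale_columnSeries hq h0) ?_ (by simp [columnSeries, columnRec])
    have h1 : (1 - PowerSeries.C (q * v) * PowerSeries.X) * PowerSeries.mk (fun k => h' (k : ℤ)) =
        (1 - PowerSeries.C v * PowerSeries.X) * PowerSeries.mk (fun k => h (k : ℤ)) := by
      refine PowerSeries.ext fun k => ?_
      rw [sub_mul, sub_mul, one_mul, one_mul, mul_assoc, mul_assoc, map_sub, map_sub,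
        PowerSeries.coeff_C_mul, PowerSeries.coeff_C_mul]
      cases k with
      | zero => simp [h0, h0']
      | succ k =>
        rw [PowerSeries.coeff_succ_X_mul, PowerSeries.coeff_succ_X_mul]
        simp only [PowerSeries.coeff_mk]
        exact hh k
    have h2 : PowerSeries.rescale q (PowerSeries.C v * PowerSeries.X) =
        PowerSeries.C (q * v) * PowerSeries.X := by
      refine PowerSeries.ext fun k => ?_
      rw [PowerSeries.coeff_rescale, PowerSeries.coeff_C_mul, PowerSeries.coeff_C_mul,
        PowerSeries.coeff_X]
      split_ifs with hk
      · rw [hk]; ring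
      · ring
    rw [map_mul, map_sub, map_one, h2, rescale_columnSeries hq h0']
    linear_combination columnSeries q h' * h1
  have hstep : ∀ m, columnRec q h (m + 1) =
      columnRec q h' (m + 1) + v * (1 - q ^ (m + 1)) * columnRec q h' m := by
    intro m
    have h1 := congrArg (PowerSeries.coeff (m + 1)) hE
    rw [sub_mul, one_mul, mul_assoc, map_sub, PowerSeries.coeff_C_mul,
      PowerSeries.coeff_succ_X_mul] at h1
    have h2 := qFactorials_mul_coeff_columnSeries hq h (m + 1)
    have h3 := qFactorials_mul_coeff_columnSeries hq h' (m + 1)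
    have h4 := qFactorials_mul_coeff_columnSeries hq h' m
    rw [h1, mul_sub, h3, qFactorials_succ] at h2
    have h5 := neg_one_pow_mul_self (A := B) m
    linear_combination (-1) ^ m * h2 + (-1) ^ m * (1 - q ^ (m + 1)) * v * h4 -
      (columnRec q h (m + 1) - columnRec q h' (m + 1) -
        v * (1 - q ^ (m + 1)) * columnRec q h' m) * h5
  induction n with
  | zero => simp [columnRec, qFactorials]
  | succ n ih =>
    rw [Finset.Nat.sum_antidiagonal_succ]
    have h1 : ∑ x ∈ Finset.HasAntidiagonal.antidiagonal n,
        (-v) ^ (x.1 + 1) * qFactorials B q x.2 (n + 1) * columnRec q h x.2 =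
        (-v) * (1 - q ^ (n + 1)) * columnRec q h' n := by
      rw [ih, Finset.mul_sum]
      refine Finset.sum_congr rfl fun x hx => ?_
      rw [Finset.HasAntidiagonal.mem_antidiagonal] at hx
      have : qFactorials B q x.2 (n + 1) = qFactorials B q x.2 n * (1 - q ^ (n + 1)) :=
        Finset.prod_Ico_succ_top (by omega) _
      rw [this]
      ring
    rw [h1, hstep]
    simp only [qFactorials, Finset.Ico_self, Finset.prod_empty]
    ring

/-- The raising operator formula for a column satisfies the column recursion. -/
theorem raisingSum_column (n : ℕ) : ∀ {B : Type} [CommRing B] {q : B}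
    (_ : ∀ i : ℕ, IsUnit (1 - q ^ (i + 1))) {h : ℤ → B} (_ : h 0 = 1) (_ : ∀ k < 0, h k = 0),
    raisingSum q h (fun _ : Fin n => 1) (fun _ => ∑ _i : Fin n, 1 + 1) = columnRec q h n := by
  induction n with
  | zero =>
    intro B _ q hq h h0 hneg
    simp [raisingSum, raisingTerm, columnRec]
  | succ n ih =>
    intro B _ q hq h h0 hneg
    -- The induction passes from B to B[v], which is why the statement is uniform in the ring; units
    -- stay units there.
    have hq' : ∀ i : ℕ, IsUnit (1 - (Polynomial.C q) ^ (i + 1)) := fun i => by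
      have := (hq i).map (Polynomial.C : B →+* Polynomial B)
      rwa [map_sub, map_one, map_pow] at this
    have h1 := raisingSum_succ q hneg (fun _ : Fin (n + 1) => 1)
    rw [h1, show Fin.tail (fun _ : Fin (n + 1) => 1) = fun _ => 1 from rfl,
      ih hq' (twistSeq_zero q h0) (twistSeq_neg q hneg),
      columnRec_twist hq' Polynomial.X (h := fun k => Polynomial.C (h k))
        (by rw [h0, map_one]) (twistSeq_zero q h0) (twistSeq_succ q h), map_sum, columnRec_succ]
    refine Finset.sum_congr rfl fun x _ => ?_
    -- The untwisted column functions have coefficients in B, so each summand is a monomial in v and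
    -- `shiftEval` turns its exponent into the index of h.
    have h2 : (-Polynomial.X : Polynomial B) ^ x.1 * qFactorials _ (Polynomial.C q) x.2 n *
        columnRec (Polynomial.C q) (fun k => Polynomial.C (h k)) x.2 =
        Polynomial.monomial x.1 ((-1) ^ x.1 * qFactorials B q x.2 n * columnRec q h x.2) := by
      rw [← map_columnRec, ← map_qFactorials, ← Polynomial.C_mul_X_pow_eq_monomial, neg_pow,
        map_mul, map_mul, map_pow, map_neg, map_one]
      ring
    rw [h2, shiftEval_monomial]
    congr 2
    push_cast
    ring

/-- The argument divides by 1 - q^i, so it takes place in power series in q, where these are units.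
Polynomials embed into power series. -/
theorem hallLittlewoodQ'_column (n : ℕ) :
    hallLittlewoodQ' (fun _ : Fin n => 1) = columnPoly n := by
  apply Polynomial.coe_injective
  have hq : ∀ i : ℕ, IsUnit (1 - (PowerSeries.X : PowerSeries SymFun) ^ (i + 1)) := fun i =>
    PowerSeries.isUnit_iff_constantCoeff.2 (by simp)
  have h0 : PowerSeries.C (complSym 0) = (1 : PowerSeries SymFun) := by rw [complSym_zero, map_one]
  have hneg : ∀ k < 0, PowerSeries.C (complSym k) = (0 : PowerSeries SymFun) := fun k hk => by
    have : complSym k = 0 := funext fun d => if_neg (by omega)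
    rw [this, map_zero]
  have h1 := raisingSum_column n hq (h := fun k => PowerSeries.C (complSym k)) h0 hneg
  have h2 := map_columnRec (Polynomial.coeToPowerSeries.ringHom (R := SymFun)) Polynomial.X
    (fun k => Polynomial.C (complSym k)) n
  rw [← columnPoly_eq_columnRec] at h2
  simp only [Polynomial.coeToPowerSeries.ringHom_apply, Polynomial.coe_X, Polynomial.coe_C] at h2
  rw [h2, ← h1, hallLittlewoodQ', raisingSum]
  have h3 := map_sum (Polynomial.coeToPowerSeries.ringHom (R := SymFun))
    (fun m : {p : Fin n × Fin n // p.1 < p.2} → Fin ((∑ _i : Fin n, 1) + 1) =>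
      (∏ p, raisingCoeff (m p)) * Polynomial.C (∏ i : Fin n, complSym (((1 : ℕ) : ℤ) +
      (∑ p with p.1.1 = i, (m p : ℤ)) - ∑ p with p.1.2 = i, (m p : ℤ)))) Finset.univ
  refine h3.trans ?_
  refine Finset.sum_bij (fun m _ p => (m p : ℕ)) ?_ ?_ ?_ ?_
  · intro m _
    exact Fintype.mem_piFinset.2 fun p => Finset.mem_range.2 (m p).2
  · intro m _ m' _ hm
    funext p
    exact Fin.ext (congrFun hm p)
  · intro m hm
    rw [Fintype.mem_piFinset] at hm
    exact ⟨fun p => ⟨m p, Finset.mem_range.1 (hm p)⟩, Finset.mem_univ _, rfl⟩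
  · intro m _
    rw [map_mul, map_prod, map_prod, map_prod, raisingTerm]
    congr 1
    · refine Finset.prod_congr rfl fun p _ => ?_
      rw [raisingCoeff_eq, map_raisingSeq]
      simp
    · refine Finset.prod_congr rfl fun i _ => ?_
      simp [raisedIndex]

end HallLittlewood

/-! ### Frobenius images of the harmonic polynomials and of the sign representation -/

section Frobenius

variable (τ : Type*) [Fintype τ] [DecidableEq τ]

theorem prod_map_smul_eq {c : ℕ → ℚ} {p : ℕ → SymFun} (s : Multiset ℕ) :
    (s.map fun k => c k • p k).prod = (s.map c).prod • (s.map p).prod := by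
  induction s using Multiset.induction_on with
  | empty => simp
  | cons k s ih => rw [Multiset.map_cons, Multiset.prod_cons, ih, Multiset.map_cons,
      Multiset.prod_cons, Multiset.map_cons, Multiset.prod_cons, smul_mul_smul_comm]

variable {τ} in
theorem prod_parts_eq_signQ (u : Equiv.Perm τ) :
    (u.partition.parts.map fun k => (-1 : ℚ) ^ (k - 1)).prod = signQ u := by
  have h1 : ∀ k ∈ u.cycleType, (-1 : ℚ) ^ (k - 1) = ((-(-1) ^ k : ℤˣ) : ℤ) := by
    intro k hk
    obtain ⟨m, rfl⟩ := Nat.exists_eq_add_of_le (Equiv.Perm.two_le_of_mem_cycleType hk)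
    rw [show 2 + m - 1 = m + 1 by omega]
    push_cast
    ring
  rw [Equiv.Perm.parts_partition, Multiset.map_add, Multiset.prod_add, Multiset.map_replicate,
    Nat.sub_self, pow_zero, Multiset.prod_replicate, one_pow, mul_one, Multiset.map_congr rfl h1,
    signQ, Equiv.Perm.sign_of_cycleType']
  have h2 := map_multiset_prod ((Int.castRingHom ℚ : ℤ →* ℚ).comp (Units.coeHom ℤ))
    (u.cycleType.map fun n => -(-1) ^ n)
  rw [Multiset.map_map] at h2
  exact h2.symm

theorem sum_signQ_smul : ∑ u : Equiv.Perm τ, signQ u • (u.partition.parts.map powerSum).prod =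
    ((Fintype.card τ).factorial : ℚ) • elemSym (Fintype.card τ) := by
  rw [elemSym_eq_cycleIndex, ← sum_prod_parts_eq_cycleIndex]
  refine Finset.sum_congr rfl fun u _ => ?_
  rw [prod_map_smul_eq, prod_parts_eq_signQ]

theorem map_geomSeries (k : ℕ) :
    PowerSeries.map (algebraMap ℚ SymFun) (geomSeries ℚ k) = geomSeries SymFun k := by
  ext1 m
  simp only [geomSeries, PowerSeries.coeff_map, PowerSeries.coeff_mk]
  split_ifs <;> simp

/-- Multiplying the graded character by the power sums replaces each p_k by p_k/(1 - q^k), up to the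
common factor ∏(1 - q^i). The sum over permutations is then the cycle index that defines
`gradedCompl`. -/
theorem sum_trace_harmAct_smul (d : ℕ) :
    ∑ v : Equiv.Perm τ, LinearMap.trace ℚ _ (harmAct d v) • (v.partition.parts.map powerSum).prod =
      ((Fintype.card τ).factorial : ℚ) • (frobPoly (Fintype.card τ)).coeff d := by
  have h1 : ∀ v : Equiv.Perm τ, PowerSeries.mk
      (fun d => LinearMap.trace ℚ _ (harmAct d v) • (v.partition.parts.map powerSum).prod) =
      qFactorials _ PowerSeries.X 0 (Fintype.card τ) *
        (v.partition.parts.map gradedPowerSum).prod := by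
    intro v
    have h2 : PowerSeries.mk
        (fun d => LinearMap.trace ℚ _ (harmAct d v) • (v.partition.parts.map powerSum).prod) =
        PowerSeries.map (algebraMap ℚ SymFun)
          (PowerSeries.mk fun d => LinearMap.trace ℚ _ (harmAct d v)) *
          PowerSeries.C (v.partition.parts.map powerSum).prod := by
      ext1 m
      rw [PowerSeries.coeff_mul_C, PowerSeries.coeff_map, PowerSeries.coeff_mk,
        PowerSeries.coeff_mk, Algebra.smul_def]
    have h3 : (v.partition.parts.map gradedPowerSum).prod =
        PowerSeries.C (v.partition.parts.map powerSum).prod *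
          PowerSeries.map (algebraMap ℚ SymFun) (v.partition.parts.map (geomSeries ℚ)).prod := by
      rw [map_multiset_prod, map_multiset_prod, Multiset.map_map, Multiset.map_map,
        ← Multiset.prod_map_mul]
      congr 1
      refine Multiset.map_congr rfl fun k _ => ?_
      rw [Function.comp_apply, Function.comp_apply, map_geomSeries, gradedPowerSum]
    have h4 : PowerSeries.map (algebraMap ℚ SymFun)
        (∏ i : Fin (Fintype.card τ), (1 - PowerSeries.X ^ (i + 1 : ℕ))) =
        qFactorials _ PowerSeries.X 0 (Fintype.card τ) := by
      rw [qFactorials, ← Finset.range_eq_Ico, map_prod,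
        ← Fin.prod_univ_eq_prod_range fun j => (1 - PowerSeries.X ^ (j + 1) : PowerSeries SymFun)]
      refine Finset.prod_congr rfl fun i _ => ?_
      rw [map_sub, map_one, map_pow, PowerSeries.map_X]
    rw [h2, mk_trace_harmAct, map_mul, h3, h4]
    ring
  have h5 : PowerSeries.mk (fun d => ∑ v : Equiv.Perm τ,
      LinearMap.trace ℚ _ (harmAct d v) • (v.partition.parts.map powerSum).prod) =
      ((Fintype.card τ).factorial : ℚ) • (frobPoly (Fintype.card τ) : PowerSeries SymFun) := by
    rw [coe_frobPoly, gradedCompl, ← mul_smul_comm, ← sum_prod_parts_eq_cycleIndex,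
      Finset.mul_sum, ← Finset.sum_congr rfl fun v _ => h1 v]
    ext1 m
    rw [map_sum]
    simp only [PowerSeries.coeff_mk]
  have h6 := congrArg (PowerSeries.coeff d) h5
  rw [PowerSeries.coeff_mk] at h6
  rw [h6, ← Polynomial.coeff_coe]
  rfl

end Frobenius

/-! ### Coordinates of superspace -/

section Coordinates

variable {n : ℕ}

/-- The monomials in the `θ`-variables. -/
def thetaBasis (n : ℕ) :
    Module.Basis (Finset (Fin n)) ℚ (ExteriorAlgebra ℚ (Fin n → ℚ)) :=
  (Pi.basisFun ℚ (Fin n)).ExteriorAlgebra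

theorem thetaBasis_apply (T : Finset (Fin n)) {k : ℕ} (h : T.card = k) : thetaBasis n T =
    ExteriorAlgebra.ιMulti ℚ k (fun i => Pi.single (T.orderEmbOfFin h i) (1 : ℚ)) := by
  rw [thetaBasis, ExteriorAlgebra.basis_apply_ofCard _ h]
  refine congrArg (ExteriorAlgebra.ιMulti ℚ k) (funext fun i => ?_)
  rw [Function.comp_apply, Pi.basisFun_apply]
  rfl

theorem sign_smul_eq {V : Type*} [AddCommGroup V] [Module ℚ V] {ι : Type*} [Fintype ι]
    [DecidableEq ι] (w : Equiv.Perm ι) (v : V) : Equiv.Perm.sign w • v = signQ w • v := by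
  rw [Units.smul_def, signQ, Int.cast_smul_eq_zsmul]

theorem ιMulti_single_equiv (T : Finset (Fin n)) {k : ℕ} (h : T.card = k) (e : Fin k ≃ T) :
    ExteriorAlgebra.ιMulti ℚ k (fun i => Pi.single (e i : Fin n) (1 : ℚ)) =
      signQ (e.trans (T.orderIsoOfFin h).symm.toEquiv) • thetaBasis n T := by
  rw [thetaBasis_apply T h, ← sign_smul_eq, ← AlternatingMap.map_perm]
  congr 1
  funext i
  rw [Function.comp_apply, ← Finset.coe_orderIsoOfFin_apply]
  simp

theorem map_thetaBasis (w : Equiv.Perm (Fin n)) (T : Finset (Fin n)) {k : ℕ} (h : T.card = k) :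
    ExteriorAlgebra.map (permVec w) (thetaBasis n T) =
      ExteriorAlgebra.ιMulti ℚ k (fun i => Pi.single (w (T.orderIsoOfFin h i)) (1 : ℚ)) := by
  rw [thetaBasis_apply T h, ExteriorAlgebra.map_apply_ιMulti]
  congr 1
  funext i
  rw [Function.comp_apply, permVec_single, Finset.coe_orderIsoOfFin_apply]

/-- The exact sign matters here, since it enters the character. -/
theorem map_thetaBasis_of_stable (w : Equiv.Perm (Fin n)) {T : Finset (Fin n)}
    (hT : ∀ x, w x ∈ T ↔ x ∈ T) : ExteriorAlgebra.map (permVec w) (thetaBasis n T) =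
      signQ (w.subtypePerm hT) • thetaBasis n T := by
  let o := (T.orderIsoOfFin rfl).toEquiv
  have h1 := ιMulti_single_equiv T rfl (o.trans (w.subtypePerm hT))
  have h2 : (o.trans (w.subtypePerm hT)).trans (T.orderIsoOfFin rfl).symm.toEquiv =
      o.symm.permCongr (w.subtypePerm hT) := rfl
  rw [h2, signQ, Equiv.Perm.sign_permCongr] at h1
  rw [map_thetaBasis w T rfl]
  exact h1

/-- For questions of membership the sign is irrelevant; ε² = 1 is enough to cancel it. -/
theorem exists_map_thetaBasis (w : Equiv.Perm (Fin n)) (T : Finset (Fin n)) :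
    ∃ ε : ℚ, ε * ε = 1 ∧ ExteriorAlgebra.map (permVec w) (thetaBasis n T) =
      ε • thetaBasis n (T.map w.toEmbedding) := by
  have h : (T.map w.toEmbedding).card = T.card := Finset.card_map _
  let e : T ≃ T.map w.toEmbedding :=
    w.subtypeEquiv fun x => by simp
  refine ⟨_, ?_, (map_thetaBasis w T rfl).trans
    (ιMulti_single_equiv (T.map w.toEmbedding) h ((T.orderIsoOfFin rfl).toEquiv.trans e))⟩
  exact signQ_mul_self _

theorem exists_thetaBasis_mul {S T : Finset (Fin n)} (h : Disjoint S T) :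
    ∃ ε : ℚ, ε * ε = 1 ∧ thetaBasis n S * thetaBasis n T = ε • thetaBasis n (S ∪ T) := by
  have h1 := ExteriorAlgebra.basis_mul_of_disjoint (Pi.basisFun ℚ (Fin n))
    (Set.powersetCard.ofCard (s := S) rfl) (Set.powersetCard.ofCard (s := T) rfl) h
  rw [sign_smul_eq] at h1
  rw [← Finset.disjUnion_eq_union S T h]
  exact ⟨_, signQ_mul_self _, h1⟩

theorem thetaBasis_mul_of_not_disjoint {S T : Finset (Fin n)} (h : ¬ Disjoint S T) :
    thetaBasis n S * thetaBasis n T = 0 :=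
  ExteriorAlgebra.basis_mul_of_not_disjoint (Pi.basisFun ℚ (Fin n))
    (Set.powersetCard.ofCard (s := S) rfl) (Set.powersetCard.ofCard (s := T) rfl) h

theorem thetaBasis_empty : thetaBasis n ∅ = 1 := by
  rw [thetaBasis_apply ∅ Finset.card_empty, ExteriorAlgebra.ιMulti_zero_apply]

theorem thetaBasis_singleton (i : Fin n) :
    thetaBasis n {i} = ExteriorAlgebra.ι ℚ (Pi.single i 1) := by
  rw [thetaBasis_apply {i} (Finset.card_singleton i), ExteriorAlgebra.ιMulti_apply]
  simp

theorem thetaVar_eq (i : Fin n) : thetaVar i = 1 ⊗ₜ[ℚ] thetaBasis n {i} := by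
  rw [thetaVar, thetaBasis_singleton]

theorem thetaBasis_mem (T : Finset (Fin n)) : thetaBasis n T ∈ ⋀[ℚ]^T.card (Fin n → ℚ) := by
  have := ExteriorAlgebra.basis_eq_coe_basis (Pi.basisFun ℚ (Fin n))
    (Set.powersetCard.ofCard (s := T) rfl)
  rw [Set.powersetCard.val_ofCard] at this
  rw [thetaBasis, this]
  exact Subtype.property _

theorem thetaBasis_repr_eq_zero {j : ℕ} {g : ExteriorAlgebra ℚ (Fin n → ℚ)}
    (hg : g ∈ ⋀[ℚ]^j (Fin n → ℚ)) {T : Finset (Fin n)} (hT : T.card ≠ j) :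
    (thetaBasis n).repr g T = 0 := by
  have h1 := ((Pi.basisFun ℚ (Fin n)).exteriorPower j).sum_repr ⟨g, hg⟩
  have h2 := congrArg Subtype.val h1
  rw [Submodule.coe_sum] at h2
  change _ = g at h2
  rw [← h2, map_sum, Finsupp.finsetSum_apply]
  refine Finset.sum_eq_zero fun s _ => ?_
  rw [Submodule.coe_smul, ← ExteriorAlgebra.basis_eq_coe_basis, map_smul, Finsupp.smul_apply,
    ← thetaBasis, Module.Basis.repr_self, Finsupp.single_eq_of_ne, smul_zero]
  rintro rfl
  exact hT s.2

/-- The coefficient of a `θ`-monomial. -/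
def coord (T : Finset (Fin n)) : Superspace n →ₗ[ℚ] MvPolynomial (Fin n) ℚ :=
  (TensorProduct.rid ℚ (MvPolynomial (Fin n) ℚ)).toLinearMap ∘ₗ
    LinearMap.lTensor _ ((thetaBasis n).coord T)

theorem coord_tmul (T : Finset (Fin n)) (f : MvPolynomial (Fin n) ℚ)
    (g : ExteriorAlgebra ℚ (Fin n → ℚ)) : coord T (f ⊗ₜ[ℚ] g) = (thetaBasis n).repr g T • f := by
  simp [coord]

theorem coord_tmul_thetaBasis (S T : Finset (Fin n)) (f : MvPolynomial (Fin n) ℚ) :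
    coord T (f ⊗ₜ[ℚ] thetaBasis n S) = if S = T then f else 0 := by
  rw [coord_tmul, Module.Basis.repr_self, Finsupp.single_apply]
  split_ifs <;> simp

theorem sum_coord_tmul (v : Superspace n) : ∑ T, coord T v ⊗ₜ[ℚ] thetaBasis n T = v := by
  induction v using TensorProduct.induction_on with
  | zero => simp
  | add a b ha hb =>
    simp only [map_add, TensorProduct.add_tmul, Finset.sum_add_distrib, ha, hb]
  | tmul f g =>
    simp only [coord_tmul, TensorProduct.smul_tmul]
    rw [← TensorProduct.tmul_sum, (thetaBasis n).sum_repr]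

theorem coord_ext {v v' : Superspace n} (h : ∀ T, coord T v = coord T v') : v = v' := by
  rw [← sum_coord_tmul v, ← sum_coord_tmul v']
  exact Finset.sum_congr rfl fun T _ => by rw [h T]

theorem coord_sum_tmul (f : Finset (Fin n) → MvPolynomial (Fin n) ℚ) (T : Finset (Fin n)) :
    coord T (∑ S, f S ⊗ₜ[ℚ] thetaBasis n S) = f T := by
  simp [coord_tmul_thetaBasis]

theorem superspace_induction {p : Superspace n → Prop} (hadd : ∀ u v, p u → p v → p (u + v))
    (hp : ∀ f T, p (f ⊗ₜ[ℚ] thetaBasis n T)) (v : Superspace n) : p v := by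
  rw [← sum_coord_tmul v]
  refine Finset.sum_induction _ p hadd ?_ fun T _ => hp _ T
  have := hp 0 ∅
  rwa [TensorProduct.zero_tmul] at this

theorem superRep_tmul (w : Equiv.Perm (Fin n)) (f : MvPolynomial (Fin n) ℚ)
    (g : ExteriorAlgebra ℚ (Fin n → ℚ)) :
    superRep n w (f ⊗ₜ[ℚ] g) = rename w f ⊗ₜ[ℚ] ExteriorAlgebra.map (permVec w) g := rfl

theorem exists_coord_superRep (w : Equiv.Perm (Fin n)) (T : Finset (Fin n)) :
    ∃ ε : ℚ, ε * ε = 1 ∧ ∀ v, coord (T.map w.toEmbedding) (superRep n w v) =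
      ε • rename w (coord T v) := by
  obtain ⟨ε, hε, h⟩ := exists_map_thetaBasis w T
  refine ⟨ε, hε, superspace_induction (fun u v hu hv => ?_) fun f S => ?_⟩
  · rw [map_add, map_add, map_add, map_add, hu, hv, smul_add]
  · rw [superRep_tmul, coord_tmul_thetaBasis]
    split_ifs with hST
    · rw [hST, h, TensorProduct.tmul_smul, map_smul, coord_tmul_thetaBasis, if_pos rfl]
    · obtain ⟨ε', -, h'⟩ := exists_map_thetaBasis w S
      rw [h', TensorProduct.tmul_smul, map_smul, coord_tmul_thetaBasis,
        if_neg fun h => hST (Finset.map_injective _ h), map_zero, smul_zero, smul_zero]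

theorem coord_superRep_of_stable (w : Equiv.Perm (Fin n)) {T : Finset (Fin n)}
    (hT : ∀ x, w x ∈ T ↔ x ∈ T) (f : MvPolynomial (Fin n) ℚ) :
    coord T (superRep n w (f ⊗ₜ[ℚ] thetaBasis n T)) =
      signQ (w.subtypePerm hT) • rename w f := by
  rw [superRep_tmul, map_thetaBasis_of_stable w hT, TensorProduct.tmul_smul, map_smul,
    coord_tmul_thetaBasis, if_pos rfl]

theorem coord_superRep_of_not_stable (w : Equiv.Perm (Fin n)) {T : Finset (Fin n)}
    (hT : ¬ ∀ x, w x ∈ T ↔ x ∈ T) (f : MvPolynomial (Fin n) ℚ) :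
    coord T (superRep n w (f ⊗ₜ[ℚ] thetaBasis n T)) = 0 := by
  obtain ⟨ε, -, h⟩ := exists_map_thetaBasis w T
  rw [superRep_tmul, h, TensorProduct.tmul_smul, map_smul, coord_tmul_thetaBasis, if_neg,
    smul_zero]
  intro h1
  refine hT fun x => ?_
  conv_lhs => rw [← h1]
  simp

theorem coord_partialX (i : Fin n) (T : Finset (Fin n)) (v : Superspace n) :
    coord T (partialX i v) = pderiv i (coord T v) := by
  refine superspace_induction (p := fun v => coord T (partialX i v) = pderiv i (coord T v))
    (fun u v hu hv => ?_) (fun f S => ?_) v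
  · rw [map_add, map_add, map_add, map_add, hu, hv]
  · have : partialX i (f ⊗ₜ[ℚ] thetaBasis n S) = pderiv i f ⊗ₜ[ℚ] thetaBasis n S := rfl
    rw [this, coord_tmul_thetaBasis, coord_tmul_thetaBasis]
    split_ifs <;> simp

theorem tmul_thetaBasis_mem_bidegree {i : ℕ} {f : MvPolynomial (Fin n) ℚ}
    (hf : f ∈ homogeneousSubmodule (Fin n) ℚ i) (T : Finset (Fin n)) :
    f ⊗ₜ[ℚ] thetaBasis n T ∈ bidegreeSubmodule n i T.card :=
  ⟨⟨f, hf⟩ ⊗ₜ[ℚ] ⟨_, thetaBasis_mem T⟩, rfl⟩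

theorem mem_bidegree_iff {i j : ℕ} {v : Superspace n} : v ∈ bidegreeSubmodule n i j ↔
    ∀ T : Finset (Fin n), coord T v ∈ homogeneousSubmodule (Fin n) ℚ i ∧
      (T.card ≠ j → coord T v = 0) := by
  constructor
  · rintro ⟨t, rfl⟩ T
    induction t with
    | zero => simp
    | add a b ha hb =>
      rw [map_add, map_add]
      refine ⟨Submodule.add_mem _ ha.1 hb.1, fun h => ?_⟩
      rw [ha.2 h, hb.2 h, add_zero]
    | tmul f g =>
      rw [TensorProduct.map_tmul, coord_tmul]
      refine ⟨Submodule.smul_mem _ _ f.2, fun h => ?_⟩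
      rw [Submodule.subtype_apply, thetaBasis_repr_eq_zero (j := j) g.2 h, zero_smul]
  · intro h
    rw [← sum_coord_tmul v]
    refine Submodule.sum_mem _ fun T _ => ?_
    by_cases hT : T.card = j
    · exact hT ▸ tmul_thetaBasis_mem_bidegree (h T).1 T
    · rw [(h T).2 hT, TensorProduct.zero_tmul]
      exact Submodule.zero_mem _

theorem bidegree_finite (n i j : ℕ) : Module.Finite ℚ (bidegreeSubmodule n i j) := by
  rw [bidegreeSubmodule]
  infer_instance

end Coordinates

/-! ### Harmonic polynomials and coinvariants of the variables outside a set -/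

section Outside

variable {n : ℕ}

/-- The indices outside of `T`. -/
abbrev Outside (T : Finset (Fin n)) : Type := {x : Fin n // x ∉ T}

/-- The map that sets the variables with index in `T` to zero. -/
def killOn (T : Finset (Fin n)) : MvPolynomial (Fin n) ℚ →ₐ[ℚ] MvPolynomial (Outside T) ℚ :=
  killCompl (Subtype.val_injective (p := fun x => x ∉ T))

theorem killOn_rename (T : Finset (Fin n)) (f : MvPolynomial (Outside T) ℚ) :
    killOn T (rename Subtype.val f) = f := killCompl_rename_app _ f

theorem killOn_X_of_mem {T : Finset (Fin n)} {i : Fin n} (hi : i ∈ T) : killOn T (X i) = 0 := by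
  rw [killOn, killCompl, aeval_X, dif_neg]
  rintro ⟨x, rfl⟩
  exact x.2 hi

theorem killOn_X (T : Finset (Fin n)) (x : Outside T) : killOn T (X x.1) = X x := by
  rw [← killOn_rename T (X x), rename_X]

/-- The square-free monomials that meet T vanish, and the others are those of the remaining
variables. -/
theorem killOn_esymm (T : Finset (Fin n)) (d : ℕ) :
    killOn T (esymm (Fin n) ℚ d) = esymm (Outside T) ℚ d := by
  classical
  let v : Outside T ↪ Fin n := Function.Embedding.subtype _
  have h1 : esymm (Outside T) ℚ d =
      ∑ t ∈ Finset.powersetCard d (Finset.univ.map v), ∏ i ∈ t, killOn T (X i) := by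
    rw [Finset.powersetCard_map, Finset.sum_map, esymm]
    refine Finset.sum_congr rfl fun t _ => ?_
    change _ = ∏ i ∈ t.map v, killOn T (X i)
    rw [Finset.prod_map]
    exact Finset.prod_congr rfl fun i _ => (killOn_X T i).symm
  rw [h1, esymm, map_sum]
  simp only [map_prod]
  symm
  refine Finset.sum_subset (Finset.powersetCard_mono (Finset.subset_univ _)) fun t ht ht' => ?_
  rw [Finset.mem_powersetCard] at ht ht'
  have h2 : ¬ t ⊆ Finset.univ.map v := fun h => ht' ⟨h, ht.2⟩
  obtain ⟨i, hi, hi'⟩ := Finset.not_subset.1 h2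
  refine Finset.prod_eq_zero hi (killOn_X_of_mem ?_)
  by_contra h
  exact hi' (Finset.mem_map.2 ⟨⟨i, h⟩, Finset.mem_univ _, rfl⟩)

theorem isHomogeneous_killOn (T : Finset (Fin n)) {f : MvPolynomial (Fin n) ℚ} {d : ℕ}
    (hf : f.IsHomogeneous d) : (killOn T f).IsHomogeneous d := by
  have := hf.aeval (fun i => killOn T (X i)) (n := 1) fun i => by
    by_cases hi : i ∈ T
    · rw [killOn_X_of_mem hi]
      exact isHomogeneous_zero _ _ _
    · rw [killOn_X T ⟨i, hi⟩]
      exact isHomogeneous_X _ _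
  rw [one_mul] at this
  have h1 : aeval (fun i => killOn T (X i)) = killOn T := by
    refine algHom_ext fun i => ?_
    rw [aeval_X]
  rwa [h1] at this

theorem homogeneousComponent_rename {σ τ : Type*} (φ : σ → τ) (d : ℕ) (f : MvPolynomial σ ℚ) :
    homogeneousComponent d (rename φ f) = rename φ (homogeneousComponent d f) := by
  induction f using MvPolynomial.induction_on' with
  | add p q hp hq => simp only [map_add, hp, hq]
  | monomial s a =>
    have h : monomial s a ∈ homogeneousSubmodule σ ℚ s.degree := isHomogeneous_monomial _ rfl
    have h' : rename φ (monomial s a) ∈ homogeneousSubmodule τ ℚ s.degree :=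
      IsHomogeneous.rename_isHomogeneous h
    rw [homogeneousComponent_of_mem h, homogeneousComponent_of_mem h']
    split_ifs <;> simp

/-- The harmonic polynomials of the variables outside of `T`. -/
def outsideHarm (T : Finset (Fin n)) : Submodule ℚ (MvPolynomial (Fin n) ℚ) :=
  (harm (Outside T)).map (rename Subtype.val).toLinearMap

theorem mem_outsideHarm {T : Finset (Fin n)} {f : MvPolynomial (Fin n) ℚ} :
    f ∈ outsideHarm T ↔ ∃ h ∈ harm (Outside T), rename Subtype.val h = f := Iff.rfl

/-- The ideal generated by the variables in `T` and the coinvariant ideal. -/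
def outsideIdeal (T : Finset (Fin n)) : Ideal (MvPolynomial (Fin n) ℚ) :=
  (coinvIdeal (Outside T)).comap (killOn T)

theorem mem_outsideIdeal {T : Finset (Fin n)} {f : MvPolynomial (Fin n) ℚ} :
    f ∈ outsideIdeal T ↔ killOn T f ∈ coinvIdeal (Outside T) := Iff.rfl

theorem eq_zero_of_mem_outside {T : Finset (Fin n)} {f : MvPolynomial (Fin n) ℚ}
    (h1 : f ∈ outsideHarm T) (h2 : f ∈ outsideIdeal T) : f = 0 := by
  obtain ⟨h, hh, rfl⟩ := mem_outsideHarm.1 h1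
  rw [mem_outsideIdeal, killOn_rename] at h2
  rw [disjoint_harm_coinvIdeal hh h2, map_zero]

theorem exists_outsideHarm_sub_mem (T : Finset (Fin n)) (f : MvPolynomial (Fin n) ℚ) :
    ∃ h ∈ outsideHarm T, f - h ∈ outsideIdeal T := by
  obtain ⟨h, hh, hf⟩ := exists_harm_sub_mem_coinvIdeal (killOn T f)
  refine ⟨rename Subtype.val h, ⟨h, hh, rfl⟩, ?_⟩
  rwa [mem_outsideIdeal, map_sub, killOn_rename]

theorem homogeneousComponent_mem_outsideHarm (d : ℕ) {T : Finset (Fin n)}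
    {f : MvPolynomial (Fin n) ℚ} (hf : f ∈ outsideHarm T) :
    homogeneousComponent d f ∈ outsideHarm T := by
  obtain ⟨h, hh, rfl⟩ := mem_outsideHarm.1 hf
  rw [homogeneousComponent_rename]
  exact ⟨_, homogeneousComponent_mem_harm d hh, rfl⟩

theorem homogeneousComponent_mem_outsideIdeal (d : ℕ) {T : Finset (Fin n)}
    {f : MvPolynomial (Fin n) ℚ} (hf : f ∈ outsideIdeal T) :
    homogeneousComponent d f ∈ outsideIdeal T := by
  have h1 : killOn T (homogeneousComponent d f) = homogeneousComponent d (killOn T f) := by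
    conv_rhs => rw [← sum_homogeneousComponent f]
    rw [map_sum, map_sum]
    by_cases hd : d ∈ Finset.range (f.totalDegree + 1)
    · rw [Finset.sum_eq_single_of_mem d hd fun i _ hi => ?_]
      · exact (homogeneousComponent_of_mem
          (isHomogeneous_killOn T (homogeneousComponent_isHomogeneous d f))).trans
            (if_pos rfl) |>.symm
      · rw [homogeneousComponent_of_mem
          (isHomogeneous_killOn T (homogeneousComponent_isHomogeneous i f)), if_neg hi.symm]
    · rw [homogeneousComponent_eq_zero _ _ (by simpa using hd), map_zero]
      refine (Finset.sum_eq_zero fun i hi => ?_).symm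
      rw [homogeneousComponent_of_mem
        (isHomogeneous_killOn T (homogeneousComponent_isHomogeneous i f)), if_neg]
      rintro rfl
      exact hd hi
  rw [mem_outsideIdeal, h1]
  exact homogeneousComponent_mem_coinvIdeal d hf

theorem exists_outsideHarm_sub_mem_of_isHomogeneous (T : Finset (Fin n)) {d : ℕ}
    {f : MvPolynomial (Fin n) ℚ} (hf : f ∈ homogeneousSubmodule (Fin n) ℚ d) :
    ∃ h ∈ outsideHarm T, h ∈ homogeneousSubmodule (Fin n) ℚ d ∧ f - h ∈ outsideIdeal T := by
  obtain ⟨h, hh, hfh⟩ := exists_outsideHarm_sub_mem T f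
  refine ⟨_, homogeneousComponent_mem_outsideHarm d hh, homogeneousComponent_isHomogeneous d h, ?_⟩
  have := homogeneousComponent_mem_outsideIdeal d hfh
  rwa [map_sub, homogeneousComponent_of_mem hf, if_pos rfl] at this

theorem sub_rename_killOn_mem (T : Finset (Fin n)) (f : MvPolynomial (Fin n) ℚ) :
    f - rename Subtype.val (killOn T f) ∈ Ideal.span (X '' (T : Set (Fin n))) := by
  let I : Ideal (MvPolynomial (Fin n) ℚ) := Ideal.span (X '' (T : Set (Fin n)))
  have h : Ideal.Quotient.mkₐ ℚ I =
      (Ideal.Quotient.mkₐ ℚ I).comp ((rename Subtype.val).comp (killOn T)) := by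
    refine algHom_ext fun i => ?_
    rw [AlgHom.comp_apply, AlgHom.comp_apply]
    by_cases hi : i ∈ T
    · rw [killOn_X_of_mem hi, map_zero, map_zero]
      exact Ideal.Quotient.eq_zero_iff_mem.2 (Ideal.subset_span ⟨i, hi, rfl⟩)
    · rw [killOn_X T ⟨i, hi⟩, rename_X]
  exact Ideal.Quotient.eq.1 (DFunLike.congr_fun h f)

/-- The generators of the ideal of polynomials that are trivial outside of `T`. -/
theorem outsideIdeal_eq_span (T : Finset (Fin n)) : outsideIdeal T =
    Ideal.span (X '' (T : Set (Fin n)) ∪ Set.range fun d : ℕ => esymm (Fin n) ℚ (d + 1)) := by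
  apply le_antisymm
  · intro f hf
    have h1 := Ideal.span_mono (Set.subset_union_left (s := X '' (T : Set (Fin n)))
      (t := Set.range fun d : ℕ => esymm (Fin n) ℚ (d + 1))) (sub_rename_killOn_mem T f)
    -- The elementary symmetric polynomial of the outside variables differs from that of all
    -- variables by an element of the ideal of the variables in T.
    have h2 : coinvIdeal (Outside T) ≤ (Ideal.span (X '' (T : Set (Fin n)) ∪
        Set.range fun d : ℕ => esymm (Fin n) ℚ (d + 1))).comap
          (rename (Subtype.val : Outside T → Fin n)) := by
      refine Ideal.span_le.2 ?_
      rintro _ ⟨d, rfl⟩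
      have h3 := Ideal.span_mono (Set.subset_union_left (s := X '' (T : Set (Fin n)))
        (t := Set.range fun d : ℕ => esymm (Fin n) ℚ (d + 1)))
          (sub_rename_killOn_mem T (esymm (Fin n) ℚ (d + 1)))
      have h0 : esymm (Fin n) ℚ (d + 1) ∈ Ideal.span (X '' (T : Set (Fin n)) ∪
          Set.range fun d : ℕ => esymm (Fin n) ℚ (d + 1)) :=
        Ideal.subset_span (Or.inr ⟨d, rfl⟩)
      have h4 := Ideal.sub_mem _ h0 h3
      rw [sub_sub_cancel, killOn_esymm] at h4
      exact h4
    have h5 := Ideal.add_mem _ h1 (h2 hf)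
    rwa [sub_add_cancel] at h5
  · refine Ideal.span_le.2 ?_
    rintro _ (⟨i, hi, rfl⟩ | ⟨d, rfl⟩)
    · rw [SetLike.mem_coe, mem_outsideIdeal, killOn_X_of_mem hi]
      exact Ideal.zero_mem _
    · rw [SetLike.mem_coe, mem_outsideIdeal, killOn_esymm]
      exact esymm_mem_coinvIdeal (by omega)

/-- This is clear from the generators, though not from the definition by substitution. It makes the
sum of the I_T θ_T stable under multiplication by the θ-variables. -/
theorem outsideIdeal_mono {S T : Finset (Fin n)} (h : S ⊆ T) : outsideIdeal S ≤ outsideIdeal T := by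
  rw [outsideIdeal_eq_span, outsideIdeal_eq_span]
  exact Ideal.span_mono (Set.union_subset_union_left _ (Set.image_mono h))

theorem rename_mem_outsideHarm (w : Equiv.Perm (Fin n)) {T : Finset (Fin n)}
    {f : MvPolynomial (Fin n) ℚ} (hf : f ∈ outsideHarm T) :
    rename w f ∈ outsideHarm (T.map w.toEmbedding) := by
  obtain ⟨h, hh, rfl⟩ := mem_outsideHarm.1 hf
  let e : Outside T ≃ Outside (T.map w.toEmbedding) := w.subtypeEquiv fun x => by simp
  refine mem_outsideHarm.2 ⟨rename e h, rename_mem_harm e hh, ?_⟩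
  rw [rename_rename, rename_rename]
  rfl

theorem pderiv_mem_outsideHarm (i : Fin n) {T : Finset (Fin n)} {f : MvPolynomial (Fin n) ℚ}
    (hf : f ∈ outsideHarm T) : pderiv i f ∈ outsideHarm T := by
  obtain ⟨h, hh, rfl⟩ := mem_outsideHarm.1 hf
  by_cases hi : i ∈ T
  · classical
    rw [pderiv_eq_zero_of_notMem_vars]
    · exact zero_mem _
    · intro hv
      obtain ⟨x, -, hx⟩ := Finset.mem_image.1 (vars_rename _ _ hv)
      exact x.2 (hx ▸ hi)
  · have h1 := pderiv_mem_harm (⟨i, hi⟩ : Outside T) hh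
    have h2 := pderiv_rename (R := ℚ) (f := (Subtype.val : Outside T → Fin n))
      Subtype.val_injective ⟨i, hi⟩ h
    exact mem_outsideHarm.2 ⟨_, h1, h2.symm⟩

end Outside

/-! ### Coordinates of the ideal `J_n` -/

section IdealCoordinates

variable {n : ℕ}

theorem polyIncl_mul_tmul (f g : MvPolynomial (Fin n) ℚ) (u : ExteriorAlgebra ℚ (Fin n → ℚ)) :
    polyIncl n f * g ⊗ₜ[ℚ] u = (f * g) ⊗ₜ[ℚ] u := by
  rw [polyIncl, Algebra.TensorProduct.includeLeft_apply, Algebra.TensorProduct.tmul_mul_tmul,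
    one_mul]

theorem coord_mul_mem_outsideIdeal_left {v : Superspace n} (hv : ∀ T, coord T v ∈ outsideIdeal T)
    (u : Superspace n) (R : Finset (Fin n)) : coord R (u * v) ∈ outsideIdeal R := by
  refine superspace_induction (p := fun u => coord R (u * v) ∈ outsideIdeal R)
    (fun a b ha hb => ?_) (fun f S => ?_) u
  · rw [add_mul, map_add]
    exact Ideal.add_mem _ ha hb
  · rw [← sum_coord_tmul v, Finset.mul_sum, map_sum]
    refine Ideal.sum_mem _ fun T _ => ?_
    rw [Algebra.TensorProduct.tmul_mul_tmul]
    by_cases hST : Disjoint S T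
    · obtain ⟨ε, -, h⟩ := exists_thetaBasis_mul hST
      rw [h, TensorProduct.tmul_smul, map_smul, coord_tmul_thetaBasis]
      refine Submodule.smul_of_tower_mem _ _ ?_
      split_ifs with hR
      · exact Ideal.mul_mem_left _ _ (outsideIdeal_mono (hR ▸ Finset.subset_union_right) (hv T))
      · exact Ideal.zero_mem _
    · rw [thetaBasis_mul_of_not_disjoint hST, TensorProduct.tmul_zero, map_zero]
      exact Ideal.zero_mem _

theorem coord_mul_mem_outsideIdeal_right {v : Superspace n} (hv : ∀ T, coord T v ∈ outsideIdeal T)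
    (u : Superspace n) (R : Finset (Fin n)) : coord R (v * u) ∈ outsideIdeal R := by
  refine superspace_induction (p := fun u => coord R (v * u) ∈ outsideIdeal R)
    (fun a b ha hb => ?_) (fun f S => ?_) u
  · rw [mul_add, map_add]
    exact Ideal.add_mem _ ha hb
  · rw [← sum_coord_tmul v, Finset.sum_mul, map_sum]
    refine Ideal.sum_mem _ fun T _ => ?_
    rw [Algebra.TensorProduct.tmul_mul_tmul]
    by_cases hST : Disjoint T S
    · obtain ⟨ε, -, h⟩ := exists_thetaBasis_mul hST
      rw [h, TensorProduct.tmul_smul, map_smul, coord_tmul_thetaBasis]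
      refine Submodule.smul_of_tower_mem _ _ ?_
      split_ifs with hR
      · exact Ideal.mul_mem_right _ _ (outsideIdeal_mono (hR ▸ Finset.subset_union_left) (hv T))
      · exact Ideal.zero_mem _
    · rw [thetaBasis_mul_of_not_disjoint hST, TensorProduct.tmul_zero, map_zero]
      exact Ideal.zero_mem _

theorem xVar_mul_thetaVar (i : Fin n) :
    xVar i * thetaVar i = X i ⊗ₜ[ℚ] thetaBasis n {i} := by
  rw [xVar, thetaVar_eq, polyIncl_mul_tmul, mul_one]

theorem polyIncl_eq (f : MvPolynomial (Fin n) ℚ) : polyIncl n f = f ⊗ₜ[ℚ] thetaBasis n ∅ := by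
  rw [thetaBasis_empty, polyIncl, Algebra.TensorProduct.includeLeft_apply]

/-- It suffices to treat generators. For i in T, x_i θ_T is up to sign x_i θ_i times the monomial of
T without i; the e_d with d > n vanish. -/
theorem tmul_thetaBasis_mem_jTwoSided {T : Finset (Fin n)} {f : MvPolynomial (Fin n) ℚ}
    (hf : f ∈ outsideIdeal T) : f ⊗ₜ[ℚ] thetaBasis n T ∈ jTwoSided n := by
  rw [outsideIdeal_eq_span] at hf
  induction hf using Submodule.span_induction with
  | zero => rw [TensorProduct.zero_tmul]; exact TwoSidedIdeal.zero_mem _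
  | add a b _ _ ha hb => rw [TensorProduct.add_tmul]; exact TwoSidedIdeal.add_mem _ ha hb
  | smul a f _ hf =>
    rw [smul_eq_mul, ← polyIncl_mul_tmul]
    exact TwoSidedIdeal.mul_mem_left _ _ _ hf
  | mem f hf =>
    rcases hf with ⟨i, hi, rfl⟩ | ⟨d, rfl⟩
    · obtain ⟨ε, hε, h⟩ := exists_thetaBasis_mul
        (Finset.disjoint_singleton_left.2 (Finset.notMem_erase i T))
      rw [Finset.singleton_union, Finset.insert_erase hi] at h
      have h1 : X i ⊗ₜ[ℚ] thetaBasis n T =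
          (ε • 1 : Superspace n) *
            ((xVar i * thetaVar i) * (1 ⊗ₜ[ℚ] thetaBasis n (T.erase i))) := by
        rw [xVar_mul_thetaVar, Algebra.TensorProduct.tmul_mul_tmul, h, mul_one, smul_mul_assoc,
          one_mul, TensorProduct.tmul_smul, smul_smul, hε, one_smul]
      rw [h1]
      exact TwoSidedIdeal.mul_mem_left _ _ _ (TwoSidedIdeal.mul_mem_right _ _ _
        (TwoSidedIdeal.subset_span (Or.inl ⟨i, rfl⟩)))
    · by_cases hd : d + 1 ≤ n
      · have h1 := polyIncl_mul_tmul (esymm (Fin n) ℚ (d + 1)) 1 (thetaBasis n T)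
        rw [mul_one] at h1
        change esymm (Fin n) ℚ (d + 1) ⊗ₜ[ℚ] thetaBasis n T ∈ jTwoSided n
        rw [← h1]
        exact TwoSidedIdeal.mul_mem_right _ _ _
          (TwoSidedIdeal.subset_span (Or.inr ⟨d + 1, by omega, hd, rfl⟩))
      · have h1 : esymm (Fin n) ℚ (d + 1) = 0 := by
          rw [esymm, Finset.powersetCard_eq_empty.2 (by rw [Finset.card_univ, Fintype.card_fin]; omega),
            Finset.sum_empty]
        change esymm (Fin n) ℚ (d + 1) ⊗ₜ[ℚ] thetaBasis n T ∈ jTwoSided n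
        rw [h1, TensorProduct.zero_tmul]
        exact TwoSidedIdeal.zero_mem _

/-- The generators have their coordinates in the ideals I_T, a condition that multiplication on
either side preserves. -/
theorem mem_jTwoSided_iff {v : Superspace n} :
    v ∈ jTwoSided n ↔ ∀ T, coord T v ∈ outsideIdeal T := by
  constructor
  · intro hv
    rw [jTwoSided] at hv
    induction hv using TwoSidedIdeal.span_induction with
    | mem x hx =>
      intro T
      rcases hx with ⟨i, rfl⟩ | ⟨d, hd, -, rfl⟩
      · simp only [xVar_mul_thetaVar, coord_tmul_thetaBasis]
        split_ifs with h
        · rw [outsideIdeal_eq_span]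
          exact Ideal.subset_span (Or.inl ⟨i, by simp [← h], rfl⟩)
        · exact Ideal.zero_mem _
      · rw [polyIncl_eq, coord_tmul_thetaBasis]
        split_ifs with h
        · rw [outsideIdeal_eq_span]
          exact Ideal.subset_span (Or.inr ⟨d - 1, by simp [Nat.sub_add_cancel hd]⟩)
        · exact Ideal.zero_mem _
    | zero => intro T; rw [map_zero]; exact Ideal.zero_mem _
    | add x y _ _ hx hy => intro T; rw [map_add]; exact Ideal.add_mem _ (hx T) (hy T)
    | neg x _ hx => intro T; rw [map_neg]; exact Ideal.neg_mem_iff _ |>.2 (hx T)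
    | left_absorb a x _ hx => exact coord_mul_mem_outsideIdeal_left hx a
    | right_absorb b x _ hx => exact coord_mul_mem_outsideIdeal_right hx b
  · intro h
    rw [← sum_coord_tmul v]
    exact sum_mem fun T _ => tmul_thetaBasis_mem_jTwoSided (h T)

theorem sMk_eq_zero_iff {v : Superspace n} : sMk n v = 0 ↔ ∀ T, coord T v ∈ outsideIdeal T := by
  rw [← mem_jTwoSided_iff, ← TwoSidedIdeal.mem_asIdeal]
  exact Submodule.Quotient.mk_eq_zero _

end IdealCoordinates

/-! ### Coordinates of the space `M_n` -/

section SpaceCoordinates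

variable {n : ℕ}

theorem exists_prod_thetaVar {l : List (Fin n)} (hl : l.Nodup) :
    ∃ ε : ℚ, ε * ε = 1 ∧ (l.map thetaVar).prod = 1 ⊗ₜ[ℚ] (ε • thetaBasis n l.toFinset) := by
  induction l with
  | nil =>
    refine ⟨1, one_mul 1, ?_⟩
    rw [one_smul, List.toFinset_nil, thetaBasis_empty]
    rfl
  | cons i l ih =>
    obtain ⟨hi, hl⟩ := List.nodup_cons.1 hl
    obtain ⟨ε, hε, h⟩ := ih hl
    obtain ⟨ε', hε', h'⟩ := exists_thetaBasis_mul
      (S := {i}) (T := l.toFinset) (Finset.disjoint_singleton_left.2 (by simpa using hi))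
    refine ⟨ε * ε', by linear_combination ε' * ε' * hε + hε', ?_⟩
    rw [List.map_cons, List.prod_cons, h, thetaVar_eq, Algebra.TensorProduct.tmul_mul_tmul,
      mul_smul_comm, h', smul_smul, one_mul, List.toFinset_cons, Finset.insert_eq]

/-- The indices `≥ k`. -/
def upperSet (n k : ℕ) : Finset (Fin n) := Finset.univ.filter fun i => k ≤ (i : ℕ)

/-- The indices `< k`. -/
def lowerEquiv {k : ℕ} (hk : k ≤ n) : Fin k ≃ Outside (upperSet n k) where
  toFun j := ⟨Fin.castLE hk j, by simp [upperSet]⟩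
  invFun x := ⟨x.1, by
    have := x.2
    simpa [upperSet] using this⟩
  left_inv _ := rfl
  right_inv _ := rfl

theorem vandermondePoly_eq (k : Fin (n + 1)) : vandermondePoly n k =
    rename Subtype.val (rename (lowerEquiv (Nat.lt_succ_iff.1 k.2)) (vandermonde k)) := by
  rw [rename_rename, vandermonde, antisymmetrize, map_sum, vandermondePoly]
  refine Finset.sum_congr rfl fun w _ => ?_
  rw [map_smul, rename_rename, rename_monomial, monomial_eq, C_1, one_mul, signQ,
    Int.cast_smul_eq_zsmul, Finsupp.prod_mapDomain_index_inj, Finsupp.prod_fintype]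
  · rfl
  · simp
  · exact (Subtype.val_injective.comp (lowerEquiv _).injective).comp w.injective

theorem exists_rho_eq (k : Fin (n + 1)) : ∃ ε : ℚ, ε * ε = 1 ∧
    rho n k = ε • (vandermondePoly n k ⊗ₜ[ℚ] thetaBasis n (upperSet n k)) := by
  obtain ⟨ε, hε, h⟩ := exists_prod_thetaVar
    (l := (List.finRange n).filter fun i : Fin n => (k : ℕ) ≤ i) ((List.nodup_finRange n).filter _)
  refine ⟨ε, hε, ?_⟩
  have h1 : ((List.finRange n).filter fun i : Fin n => (k : ℕ) ≤ i).toFinset = upperSet n k := by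
    ext i
    simp [upperSet]
  rw [rho, h, h1, polyIncl_mul_tmul, mul_one, TensorProduct.tmul_smul]

/-- The superpolynomials whose coordinates are harmonic. -/
def coordHarm (n : ℕ) : Submodule ℚ (Superspace n) :=
  ⨅ T, (outsideHarm T).comap (coord T)

theorem mem_coordHarm {v : Superspace n} : v ∈ coordHarm n ↔ ∀ T, coord T v ∈ outsideHarm T := by
  simp [coordHarm]

/-- The superpolynomials with harmonic coordinates contain the ρ_{n,k} and have both closure
properties, so minimality applies. -/
theorem mSubmodule_le_coordHarm (n : ℕ) : mSubmodule n ≤ coordHarm n := by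
  refine sInf_le ⟨fun k => ?_, fun w f hf => ?_, fun i f hf => ?_⟩
  · obtain ⟨ε, -, h⟩ := exists_rho_eq k
    rw [h, mem_coordHarm]
    intro T
    rw [map_smul, coord_tmul_thetaBasis]
    refine Submodule.smul_mem _ _ ?_
    split_ifs with hT
    · rw [← hT, vandermondePoly_eq]
      refine ⟨_, rename_mem_harm _ ?_, rfl⟩
      rw [harm_eq_derivSpan (isVandermonde_vandermonde k)]
      exact self_mem_derivSpan _
    · exact zero_mem _
  · rw [mem_coordHarm] at hf ⊢
    intro T
    obtain ⟨S, rfl⟩ : ∃ S : Finset (Fin n), S.map w.toEmbedding = T :=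
      ⟨T.map w.symm.toEmbedding, by ext; simp⟩
    obtain ⟨ε, -, h⟩ := exists_coord_superRep w S
    rw [h]
    exact Submodule.smul_mem _ _ (rename_mem_outsideHarm w (hf S))
  · rw [mem_coordHarm] at hf ⊢
    intro T
    rw [coord_partialX]
    exact pderiv_mem_outsideHarm i (hf T)

/-- A permutation carries the set of indices ≥ n - |T| to T. For that set, the derivatives of
ρ_{n,k} already yield all harmonic polynomials. -/
theorem tmul_thetaBasis_mem_mSubmodule {T : Finset (Fin n)} {f : MvPolynomial (Fin n) ℚ}
    (hf : f ∈ outsideHarm T) : f ⊗ₜ[ℚ] thetaBasis n T ∈ mSubmodule n := by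
  classical
  rw [mSubmodule, Submodule.mem_sInf]
  rintro N ⟨hN1, hN2, hN3⟩
  obtain ⟨h, hh, rfl⟩ := mem_outsideHarm.1 hf
  have hTn : T.card ≤ n := by simpa using Finset.card_le_univ T
  let k : Fin (n + 1) := ⟨n - T.card, by omega⟩
  have hk : (k : ℕ) ≤ n := Nat.lt_succ_iff.1 k.2
  have hcard : Fintype.card (Outside (upperSet n k)) = Fintype.card (Outside T) := by
    rw [← Fintype.card_congr (lowerEquiv hk), Fintype.card_fin, Fintype.card_subtype_compl]
    simp [k]
  -- Any bijection of the complements will do; h is pulled back along it first and w brings it back.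
  let E : Outside (upperSet n k) ≃ Outside T := Fintype.equivOfCardEq hcard
  let w : Equiv.Perm (Fin n) := E.extendSubtype
  have hw1 : ∀ x : Outside (upperSet n k), w x = E x := fun x =>
    E.extendSubtype_apply_of_mem x x.2
  have hw2 : (upperSet n k).map w.toEmbedding = T := by
    refine Finset.eq_of_subset_of_card_le (fun x hx => ?_) ?_
    · obtain ⟨y, hy, rfl⟩ := Finset.mem_map.1 hx
      by_contra hx'
      exact E.extendSubtype_not_mem y (not_not.2 hy) hx'
    · rw [Finset.card_map]
      have h1 := Finset.card_compl (upperSet n k)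
      have h2 := Finset.card_compl T
      have h3 : (upperSet n k)ᶜ.card = Tᶜ.card := by
        rw [Fintype.card_subtype, Fintype.card_subtype] at hcard
        convert hcard using 2 <;> ext <;> simp
      have h4 : (upperSet n k).card ≤ n := by simpa using Finset.card_le_univ (upperSet n k)
      rw [Fintype.card_fin] at h1 h2
      omega
  let W : Submodule ℚ (MvPolynomial (Outside (upperSet n k)) ℚ) :=
    N.comap (((TensorProduct.mk ℚ _ _).flip (thetaBasis n (upperSet n k))) ∘ₗ
      (rename Subtype.val).toLinearMap)
  -- The harmonics are the smallest derivative-closed space containing the Vandermonde, and W is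
  -- such a space.
  have hW : harm (Outside (upperSet n k)) ≤ W := by
    rw [harm_eq_derivSpan ((isVandermonde_vandermonde k).rename (lowerEquiv hk))]
    refine derivSpan_le ?_ fun x g hg => ?_
    · obtain ⟨ε, hε, h1⟩ := exists_rho_eq k
      have h2 := N.smul_mem ε (hN1 k)
      rw [h1, smul_smul, hε, one_smul, vandermondePoly_eq] at h2
      exact h2
    · have h1 := hN3 x.1 _ hg
      change rename Subtype.val (pderiv x g) ⊗ₜ[ℚ] thetaBasis n (upperSet n k) ∈ N
      rw [← pderiv_rename Subtype.val_injective]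
      exact h1
  have h1 : rename Subtype.val (rename E.symm h) ⊗ₜ[ℚ] thetaBasis n (upperSet n k) ∈ N :=
    hW (rename_mem_harm E.symm hh)
  obtain ⟨ε, hε, h2⟩ := exists_map_thetaBasis w (upperSet n k)
  have h3 := N.smul_mem ε (hN2 w _ h1)
  rw [superRep_tmul, h2, hw2, TensorProduct.tmul_smul, smul_smul, hε, one_smul, rename_rename,
    rename_rename] at h3
  have h4 : (w ∘ Subtype.val) ∘ E.symm = (Subtype.val : Outside T → Fin n) := by
    funext x
    simp [hw1]
  rwa [h4] at h3

theorem mem_mSubmodule_iff {v : Superspace n} :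
    v ∈ mSubmodule n ↔ ∀ T, coord T v ∈ outsideHarm T := by
  refine ⟨fun h => mem_coordHarm.1 (mSubmodule_le_coordHarm n h), fun h => ?_⟩
  rw [← sum_coord_tmul v]
  exact sum_mem fun T _ => tmul_thetaBasis_mem_mSubmodule (h T)

end SpaceCoordinates

/-! ### The bigradings and the isomorphism -/

section Bigrading

variable {n : ℕ}

theorem mem_mSub_iff {v : Superspace n} :
    v ∈ (mSub n).toSubmodule ↔ ∀ T, coord T v ∈ outsideHarm T := mem_mSubmodule_iff

theorem mem_mPiece_iff {i j : ℕ} {v : (mSub n).toSubmodule} :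
    v ∈ (mPiece n i j).toSubmodule ↔ (v : Superspace n) ∈ bidegreeSubmodule n i j := Iff.rfl

theorem tmul_thetaBasis_mem_mSub {T : Finset (Fin n)} {f : MvPolynomial (Fin n) ℚ}
    (hf : f ∈ outsideHarm T) : f ⊗ₜ[ℚ] thetaBasis n T ∈ (mSub n).toSubmodule :=
  tmul_thetaBasis_mem_mSubmodule hf

/-- The projection to the part of bidegree `(i, j)`. -/
def bidegreeProj (n i j : ℕ) : Superspace n →ₗ[ℚ] Superspace n :=
  ∑ T with T.card = j, ((TensorProduct.mk ℚ (MvPolynomial (Fin n) ℚ) _).flip (thetaBasis n T)) ∘ₗ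
    homogeneousComponent i ∘ₗ coord T

theorem bidegreeProj_of_mem {i j : ℕ} {v : Superspace n} (hv : v ∈ bidegreeSubmodule n i j) :
    bidegreeProj n i j v = v := by
  rw [mem_bidegree_iff] at hv
  conv_rhs => rw [← sum_coord_tmul v]
  rw [bidegreeProj, LinearMap.sum_apply, Finset.sum_filter]
  refine Finset.sum_congr rfl fun T _ => ?_
  split_ifs with hT
  · change homogeneousComponent i (coord T v) ⊗ₜ[ℚ] thetaBasis n T = _
    rw [homogeneousComponent_of_mem (hv T).1, if_pos rfl]
  · rw [(hv T).2 hT, TensorProduct.zero_tmul]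

theorem bidegreeProj_of_mem_of_ne {d e : ℕ × ℕ} (hde : e ≠ d) {v : Superspace n}
    (hv : v ∈ bidegreeSubmodule n e.1 e.2) : bidegreeProj n d.1 d.2 v = 0 := by
  rw [mem_bidegree_iff] at hv
  rw [bidegreeProj, LinearMap.sum_apply]
  refine Finset.sum_eq_zero fun T hT => ?_
  rw [Finset.mem_filter] at hT
  change homogeneousComponent d.1 (coord T v) ⊗ₜ[ℚ] thetaBasis n T = 0
  by_cases h : T.card = e.2
  · rw [homogeneousComponent_of_mem (hv T).1, if_neg, TensorProduct.zero_tmul]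
    exact fun h1 => hde (Prod.ext h1.symm (h.symm.trans hT.2))
  · rw [(hv T).2 h, map_zero, TensorProduct.zero_tmul]

/-- A ℚ-module is a group even when only its monoid structure is given, negation being
multiplication by -1. -/
theorem isInternal_iff_iSupIndep_and_iSup_eq_top {V ι : Type*} [DecidableEq ι] [AddCommMonoid V]
    [Module ℚ V] (A : ι → Submodule ℚ V) :
    DirectSum.IsInternal A ↔ iSupIndep A ∧ iSup A = ⊤ := by
  let _ : AddCommGroup V := Module.addCommMonoidToAddCommGroup ℚ
  exact DirectSum.isInternal_submodule_iff_iSupIndep_and_iSup_eq_top A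

theorem isBigrading_mPiece (n : ℕ) : IsBigrading (mPiece n) where
  isInternal := by
    refine (isInternal_iff_iSupIndep_and_iSup_eq_top _).2 ⟨?_, ?_⟩
    · intro d
      rw [Submodule.disjoint_def]
      intro x hx hx'
      have h1 : (⨆ e, ⨆ (_ : e ≠ d), (mPiece n e.1 e.2).toSubmodule) ≤
          LinearMap.ker (bidegreeProj n d.1 d.2 ∘ₗ (mSub n).toSubmodule.subtype) :=
        iSup₂_le fun e he y hy => bidegreeProj_of_mem_of_ne he (mem_mPiece_iff.1 hy)
      have h2 : bidegreeProj n d.1 d.2 (x : Superspace n) = 0 := h1 hx'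
      rw [bidegreeProj_of_mem (mem_mPiece_iff.1 hx)] at h2
      exact Subtype.ext h2
    · rw [eq_top_iff]
      rintro ⟨v, hv⟩ -
      have hv' := mem_mSub_iff.1 hv
      have hmem : ∀ T i, homogeneousComponent i (coord T v) ⊗ₜ[ℚ] thetaBasis n T ∈
          (mSub n).toSubmodule := fun T i =>
        tmul_thetaBasis_mem_mSub (homogeneousComponent_mem_outsideHarm i (hv' T))
      have h1 : (⟨v, hv⟩ : (mSub n).toSubmodule) =
          ∑ T, ∑ i ∈ Finset.range ((coord T v).totalDegree + 1), ⟨_, hmem T i⟩ := by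
        refine Subtype.ext ?_
        simp only [Submodule.coe_sum]
        conv_lhs => rw [← sum_coord_tmul v]
        refine Finset.sum_congr rfl fun T _ => ?_
        rw [← TensorProduct.sum_tmul, sum_homogeneousComponent]
      rw [h1]
      refine Submodule.sum_mem _ fun T _ => Submodule.sum_mem _ fun i _ =>
        Submodule.mem_iSup_of_mem (i, T.card) ?_
      exact tmul_thetaBasis_mem_bidegree (homogeneousComponent_isHomogeneous _ _) T
  finite i j := by
    have h1 := bidegree_finite n i j
    have h2 : IsNoetherian ℚ (bidegreeSubmodule n i j) :=
      isNoetherian_of_isNoetherianRing_of_finite ℚ (bidegreeSubmodule n i j)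
    let g : (mPiece n i j).toSubmodule →ₗ[ℚ] bidegreeSubmodule n i j :=
      ((mSub n).toSubmodule.subtype ∘ₗ (mPiece n i j).toSubmodule.subtype).codRestrict
        (bidegreeSubmodule n i j) fun x => mem_mPiece_iff.1 x.2
    have hg : Function.Injective g := fun x y hxy =>
      Subtype.ext (Subtype.ext
        (congrArg (fun z : bidegreeSubmodule n i j => (z : Superspace n)) hxy))
    exact Module.Finite.of_injective g hg

/-- The natural map from `M_n` to `S_n`. -/
def mToS (n : ℕ) : (mSub n).toSubmodule →ₗ[ℚ] SQuot n :=
  (sMk n).domRestrict (mSub n).toSubmodule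

theorem mToS_apply (v : (mSub n).toSubmodule) : mToS n v = sMk n v := rfl

/-- A difference with coordinates in both H_T and I_T is zero. -/
theorem mToS_injective : Function.Injective (mToS n) := by
  rintro ⟨u, hu⟩ ⟨v, hv⟩ h
  rw [mToS_apply, mToS_apply, ← sub_eq_zero, ← map_sub, sMk_eq_zero_iff] at h
  rw [mem_mSub_iff] at hu hv
  refine Subtype.ext (coord_ext fun T => sub_eq_zero.1 ?_)
  rw [← map_sub]
  refine eq_zero_of_mem_outside ?_ (h T)
  rw [map_sub]
  exact sub_mem (hu T) (hv T)

/-- The preimage has prescribed coordinates, so that homogeneous representatives give a homogeneous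
preimage. -/
theorem exists_mToS_eq {v : Superspace n} {h : Finset (Fin n) → MvPolynomial (Fin n) ℚ}
    (h1 : ∀ T, h T ∈ outsideHarm T) (h2 : ∀ T, coord T v - h T ∈ outsideIdeal T) :
    ∃ u : (mSub n).toSubmodule, mToS n u = sMk n v ∧ ∀ T, coord T (u : Superspace n) = h T := by
  refine ⟨⟨∑ T, h T ⊗ₜ[ℚ] thetaBasis n T, mem_mSub_iff.2 fun T => ?_⟩, ?_, fun T => ?_⟩
  · rw [coord_sum_tmul]
    exact h1 T
  · rw [mToS_apply, eq_comm, ← sub_eq_zero, ← map_sub, sMk_eq_zero_iff]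
    intro T
    rw [map_sub, coord_sum_tmul]
    exact h2 T
  · exact coord_sum_tmul h T

theorem sMk_surjective (n : ℕ) : Function.Surjective (sMk n) := fun s =>
  Quotient.inductionOn' s fun v => ⟨v, rfl⟩

theorem mToS_surjective : Function.Surjective (mToS n) := by
  intro s
  obtain ⟨v, rfl⟩ := sMk_surjective n s
  choose h h1 h2 using fun T => exists_outsideHarm_sub_mem T (coord T v)
  obtain ⟨u, hu, -⟩ := exists_mToS_eq h1 h2
  exact ⟨u, hu⟩

/-- The isomorphism from `M_n` to `S_n`. -/
def mEquivS (n : ℕ) : (mSub n).toSubmodule ≃ₗ[ℚ] SQuot n :=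
  LinearEquiv.ofBijective (mToS n) ⟨mToS_injective, mToS_surjective⟩

theorem map_mPiece (i j : ℕ) :
    (mPiece n i j).toSubmodule.map (mEquivS n).toLinearMap = (sPiece n i j).toSubmodule := by
  apply le_antisymm
  · rintro _ ⟨v, hv, rfl⟩
    exact ⟨v, mem_mPiece_iff.1 hv, rfl⟩
  · rintro _ ⟨v, hv, rfl⟩
    rw [SetLike.mem_coe, mem_bidegree_iff] at hv
    have hex : ∀ T : Finset (Fin n), ∃ f, f ∈ outsideHarm T ∧ coord T v - f ∈ outsideIdeal T ∧
        (f ∈ homogeneousSubmodule (Fin n) ℚ i ∧ (T.card ≠ j → f = 0)) := by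
      intro T
      by_cases hT : T.card = j
      · obtain ⟨f, h1, h2, h3⟩ := exists_outsideHarm_sub_mem_of_isHomogeneous T (hv T).1
        exact ⟨f, h1, h3, h2, fun h => absurd hT h⟩
      · refine ⟨0, zero_mem _, ?_, zero_mem _, fun _ => rfl⟩
        rw [(hv T).2 hT, sub_zero]
        exact Ideal.zero_mem _
    choose h h1 h2 h3 using hex
    obtain ⟨u, hu, hu'⟩ := exists_mToS_eq h1 h2
    refine ⟨u, ?_, hu⟩
    rw [SetLike.mem_coe, mem_mPiece_iff, mem_bidegree_iff]
    intro T
    rw [hu']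
    exact h3 T

theorem bigradedIso_mPiece_sPiece (n : ℕ) : BigradedIso (mPiece n) (sPiece n) :=
  ⟨mEquivS n, fun _ _ => rfl, map_mPiece⟩

theorem isBigrading_sPiece (n : ℕ) : IsBigrading (sPiece n) := by
  have hM := isBigrading_mPiece n
  have h1 := (isInternal_iff_iSupIndep_and_iSup_eq_top _).1 hM.isInternal
  constructor
  · refine (isInternal_iff_iSupIndep_and_iSup_eq_top _).2 ?_
    have h2 : (fun d : ℕ × ℕ => (sPiece n d.1 d.2).toSubmodule) =
        Submodule.orderIsoMapComap (mEquivS n) ∘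
          fun d : ℕ × ℕ => (mPiece n d.1 d.2).toSubmodule :=
      funext fun d => (map_mPiece d.1 d.2).symm
    rw [h2]
    refine ⟨h1.1.map_orderIso _, ?_⟩
    have h3 := (Submodule.orderIsoMapComap (mEquivS n)).map_iSup
      fun d : ℕ × ℕ => (mPiece n d.1 d.2).toSubmodule
    rw [h1.2, map_top] at h3
    exact h3.symm
  · intro i j
    rw [← map_mPiece]
    have := hM.finite i j
    exact Module.Finite.map _ _

end Bigrading

/-! ### Characters of the bigraded pieces -/

section Character

variable {n : ℕ}

theorem trace_eq_sum_of_sum_comp_eq_id_of_addCommMonoid {V ι : Type*} [AddCommMonoid V] [Module ℚ V]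
    [Module.Finite ℚ V] [Fintype ι] {W : ι → Type*} [∀ x, AddCommGroup (W x)]
    [∀ x, Module ℚ (W x)] [∀ x, Module.Finite ℚ (W x)] (inc : ∀ x, W x →ₗ[ℚ] V)
    (prj : ∀ x, V →ₗ[ℚ] W x) (h : ∑ x, inc x ∘ₗ prj x = LinearMap.id) (f : V →ₗ[ℚ] V) :
    LinearMap.trace ℚ V f = ∑ x, LinearMap.trace ℚ (W x) (prj x ∘ₗ f ∘ₗ inc x) := by
  let _ : AddCommGroup V := Module.addCommMonoidToAddCommGroup ℚ
  exact trace_eq_sum_of_sum_comp_eq_id inc prj h f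

theorem rename_killOn_of_mem {T : Finset (Fin n)} {f : MvPolynomial (Fin n) ℚ}
    (hf : f ∈ outsideHarm T) : rename Subtype.val (killOn T f) = f := by
  obtain ⟨h, -, rfl⟩ := mem_outsideHarm.1 hf
  rw [killOn_rename]

/-- Harmonic polynomials times a `θ`-monomial. -/
def harmIncl (T : Finset (Fin n)) (i : ℕ) {r : ℕ} (hr : T.card = r) :
    harmPiece (Outside T) i →ₗ[ℚ] (mPiece n i r).toSubmodule :=
  ((((TensorProduct.mk ℚ (MvPolynomial (Fin n) ℚ) _).flip (thetaBasis n T)) ∘ₗ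
    (rename (R := ℚ) (Subtype.val : Outside T → Fin n)).toLinearMap ∘ₗ
      (harmPiece (Outside T) i).subtype).codRestrict (mSub n).toSubmodule fun h =>
        tmul_thetaBasis_mem_mSub (mem_outsideHarm.2 ⟨_, h.2.1, rfl⟩)).codRestrict
          (mPiece n i r).toSubmodule fun h =>
            hr ▸ tmul_thetaBasis_mem_bidegree (IsHomogeneous.rename_isHomogeneous h.2.2) T

theorem harmIncl_apply (T : Finset (Fin n)) (i : ℕ) {r : ℕ} (hr : T.card = r)
    (h : harmPiece (Outside T) i) :
    ((harmIncl T i hr h : (mSub n).toSubmodule) : Superspace n) =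
      rename Subtype.val (h : MvPolynomial (Outside T) ℚ) ⊗ₜ[ℚ] thetaBasis n T := rfl

/-- The coefficient of a `θ`-monomial, as a harmonic polynomial. -/
def harmCoord (T : Finset (Fin n)) (i r : ℕ) :
    (mPiece n i r).toSubmodule →ₗ[ℚ] harmPiece (Outside T) i :=
  ((killOn T).toLinearMap ∘ₗ coord T ∘ₗ (mSub n).toSubmodule.subtype ∘ₗ
    (mPiece n i r).toSubmodule.subtype).codRestrict (harmPiece (Outside T) i) fun v => by
      refine ⟨?_, isHomogeneous_killOn T (mem_bidegree_iff.1 (mem_mPiece_iff.1 v.2) T).1⟩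
      obtain ⟨h, hh, h1⟩ := mem_outsideHarm.1 (mem_mSub_iff.1 v.1.2 T)
      change killOn T (coord T (v.1 : Superspace n)) ∈ harm (Outside T)
      rw [← h1, killOn_rename]
      exact hh

theorem harmCoord_apply (T : Finset (Fin n)) (i r : ℕ) (v : (mPiece n i r).toSubmodule) :
    (harmCoord T i r v : MvPolynomial (Outside T) ℚ) = killOn T (coord T (v.1 : Superspace n)) :=
  rfl

/-- The permutation of the indices outside of a stable set. -/
def outsidePerm (w : Equiv.Perm (Fin n)) {T : Finset (Fin n)} (hT : ∀ x, w x ∈ T ↔ x ∈ T) :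
    Equiv.Perm (Outside T) := w.subtypePerm fun x => not_congr (hT x)

open Classical in
/-- The contribution of a set of `θ`-variables to the character. -/
def localTrace (T : Finset (Fin n)) (i : ℕ) (w : Equiv.Perm (Fin n)) : ℚ :=
  if hT : ∀ x, w x ∈ T ↔ x ∈ T then
    signQ (w.subtypePerm hT) * LinearMap.trace ℚ _ (harmAct i (outsidePerm w hT)) else 0

/-- If w does not stabilize T, it moves θ_T to another monomial and the diagonal block is zero.
Otherwise it acts by its sign on θ_T and by its restriction on the outside variables. -/
theorem trace_harmCoord_comp (T : Finset (Fin n)) (i : ℕ) {r : ℕ} (hr : T.card = r)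
    (w : Equiv.Perm (Fin n)) :
    LinearMap.trace ℚ _ (harmCoord T i r ∘ₗ (mPiece n i r).toRepresentation w ∘ₗ
      harmIncl T i hr) = localTrace T i w := by
  have key : ∀ h : harmPiece (Outside T) i, ((harmCoord T i r ∘ₗ
      (mPiece n i r).toRepresentation w ∘ₗ harmIncl T i hr) h : MvPolynomial (Outside T) ℚ) =
      killOn T (coord T (superRep n w (rename Subtype.val (h : MvPolynomial (Outside T) ℚ) ⊗ₜ[ℚ]
        thetaBasis n T))) := fun h => rfl
  rw [localTrace]
  split_ifs with hT
  · have h1 : harmCoord T i r ∘ₗ (mPiece n i r).toRepresentation w ∘ₗ harmIncl T i hr =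
        signQ (w.subtypePerm hT) • harmAct i (outsidePerm w hT) := by
      refine LinearMap.ext fun h => Subtype.ext ?_
      rw [key, coord_superRep_of_stable w hT, map_smul, rename_rename]
      change _ = signQ (w.subtypePerm hT) • rename (outsidePerm w hT)
        (h : MvPolynomial (Outside T) ℚ)
      rw [← killOn_rename T (rename (outsidePerm w hT) (h : MvPolynomial (Outside T) ℚ)),
        rename_rename]
      rfl
    rw [h1, map_smul, smul_eq_mul]
  · have h1 : harmCoord T i r ∘ₗ (mPiece n i r).toRepresentation w ∘ₗ harmIncl T i hr = 0 := by
      refine LinearMap.ext fun h => Subtype.ext ?_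
      rw [key, coord_superRep_of_not_stable w hT, map_zero]
      rfl
    rw [h1, map_zero]

theorem trace_mPiece (i r : ℕ) (w : Equiv.Perm (Fin n)) :
    LinearMap.trace ℚ _ ((mPiece n i r).toRepresentation w) =
      ∑ T : {T : Finset (Fin n) // T.card = r}, localTrace T.1 i w := by
  have := (isBigrading_mPiece n).finite i r
  rw [trace_eq_sum_of_sum_comp_eq_id_of_addCommMonoid
    (fun T : {T : Finset (Fin n) // T.card = r} => harmIncl T.1 i T.2)
    fun T => harmCoord T.1 i r]
  · exact Finset.sum_congr rfl fun T _ => trace_harmCoord_comp T.1 i T.2 w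
  · refine LinearMap.ext fun v => Subtype.ext (Subtype.ext ?_)
    have hv1 := mem_mSub_iff.1 v.1.2
    have hv2 := mem_bidegree_iff.1 (mem_mPiece_iff.1 v.2)
    rw [LinearMap.sum_apply, Submodule.coe_sum, Submodule.coe_sum, LinearMap.id_apply]
    have h1 : ∑ T with T.card = r, coord T (v.1 : Superspace n) ⊗ₜ[ℚ] thetaBasis n T =
        (v.1 : Superspace n) := by
      conv_rhs => rw [← sum_coord_tmul (v.1 : Superspace n)]
      refine Finset.sum_filter_of_ne fun T _ hT => ?_
      by_contra h
      exact hT (by rw [(hv2 T).2 h, TensorProduct.zero_tmul])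
    rw [Finset.sum_subtype (p := fun T : Finset (Fin n) => T.card = r) _ fun T => by simp] at h1
    refine Eq.trans (Finset.sum_congr rfl fun T _ => ?_) h1
    rw [LinearMap.comp_apply, harmIncl_apply, harmCoord_apply, rename_killOn_of_mem (hv1 T.1)]

end Character

/-! ### Frobenius images of the bigraded pieces -/

section FrobeniusImage

/-- The two permutations act disjointly, so cycle types add, and so do the numbers of fixed points.
-/
theorem parts_subtypeCongr {α : Type*} [Fintype α] [DecidableEq α] {p : α → Prop}
    [DecidablePred p] [Fintype {x // p x}] [Fintype {x // ¬ p x}] (u : Equiv.Perm {x // p x})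
    (v : Equiv.Perm {x // ¬ p x}) : (u.subtypeCongr v).partition.parts = u.partition.parts + v.partition.parts := by
  have h1 : u.subtypeCongr v = Equiv.Perm.ofSubtype u * Equiv.Perm.ofSubtype v := by
    ext x
    by_cases hx : p x
    · rw [Equiv.Perm.subtypeCongr.left_apply u v hx, Equiv.Perm.mul_apply,
        Equiv.Perm.ofSubtype_apply_of_not_mem v (not_not.2 hx),
        Equiv.Perm.ofSubtype_apply_of_mem u hx]
    · rw [Equiv.Perm.subtypeCongr.right_apply u v hx, Equiv.Perm.mul_apply,
        Equiv.Perm.ofSubtype_apply_of_mem v hx,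
        Equiv.Perm.ofSubtype_apply_of_not_mem u (v ⟨x, hx⟩).2]
  have h2 : (Equiv.Perm.ofSubtype u).Disjoint (Equiv.Perm.ofSubtype v) := by
    intro x
    by_cases hx : p x
    · exact Or.inr (Equiv.Perm.ofSubtype_apply_of_not_mem v (not_not.2 hx))
    · exact Or.inl (Equiv.Perm.ofSubtype_apply_of_not_mem u hx)
  have h3 : (u.subtypeCongr v).cycleType = u.cycleType + v.cycleType := by
    rw [h1, h2.cycleType_mul, Equiv.Perm.cycleType_ofSubtype, Equiv.Perm.cycleType_ofSubtype]
  have h4 := congrArg Multiset.sum h3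
  rw [Multiset.sum_add, Equiv.Perm.sum_cycleType, Equiv.Perm.sum_cycleType,
    Equiv.Perm.sum_cycleType] at h4
  have h5 : Fintype.card α = Fintype.card {x // p x} + Fintype.card {x // ¬ p x} := by
    rw [← Fintype.card_sum, Fintype.card_congr (Equiv.sumCompl p)]
  have h6 := Finset.card_le_univ u.support
  have h7 := Finset.card_le_univ v.support
  rw [Equiv.Perm.parts_partition, Equiv.Perm.parts_partition, Equiv.Perm.parts_partition, h3, h4,
    add_add_add_comm, ← Multiset.replicate_add]
  congr 2
  omega

variable {n : ℕ}

theorem subtypeCongr_stable {T : Finset (Fin n)} (u : Equiv.Perm {x // x ∈ T})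
    (v : Equiv.Perm (Outside T)) (x : Fin n) : u.subtypeCongr v x ∈ T ↔ x ∈ T := by
  by_cases hx : x ∈ T
  · rw [Equiv.Perm.subtypeCongr.left_apply u v hx]
    exact iff_of_true (u ⟨x, hx⟩).2 hx
  · rw [Equiv.Perm.subtypeCongr.right_apply u v hx]
    exact iff_of_false (v ⟨x, hx⟩).2 hx

theorem localTrace_subtypeCongr {T : Finset (Fin n)} (i : ℕ) (u : Equiv.Perm {x // x ∈ T})
    (v : Equiv.Perm (Outside T)) :
    localTrace T i (u.subtypeCongr v) = signQ u * LinearMap.trace ℚ _ (harmAct i v) := by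
  have h1 : (u.subtypeCongr v).subtypePerm (subtypeCongr_stable u v) = u := by
    ext x
    rw [Equiv.Perm.subtypePerm_apply]
    exact congrArg Fin.val (Equiv.Perm.subtypeCongr.left_apply u v x.2)
  have h2 : outsidePerm (u.subtypeCongr v) (subtypeCongr_stable u v) = v := by
    ext x
    rw [outsidePerm, Equiv.Perm.subtypePerm_apply]
    exact congrArg Fin.val (Equiv.Perm.subtypeCongr.right_apply u v x.2)
  rw [localTrace, dif_pos (subtypeCongr_stable u v), h1, h2]

theorem localTrace_eq_zero {T : Finset (Fin n)} (i : ℕ) {w : Equiv.Perm (Fin n)}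
    (hw : ∀ (u : Equiv.Perm {x // x ∈ T}) (v : Equiv.Perm (Outside T)), u.subtypeCongr v ≠ w) :
    localTrace T i w = 0 := by
  rw [localTrace, dif_neg]
  intro hT
  refine hw (w.subtypePerm hT) (outsidePerm w hT) (Equiv.ext fun x => ?_)
  by_cases hx : x ∈ T
  · rw [Equiv.Perm.subtypeCongr.left_apply _ _ hx]
    rfl
  · rw [Equiv.Perm.subtypeCongr.right_apply _ _ hx]
    rfl

theorem card_outside (T : Finset (Fin n)) : Fintype.card (Outside T) = n - T.card := by
  rw [Fintype.card_subtype_compl]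
  simp

/-- Only permutations that stabilize T contribute, and they are the pairs of permutations of T and
of its complement. Sign, character and power sums are multiplicative over such pairs, so the sum
factors. -/
theorem sum_localTrace_smul (T : Finset (Fin n)) (i : ℕ) :
    ∑ w : Equiv.Perm (Fin n), localTrace T i w • (w.partition.parts.map powerSum).prod =
      ((T.card.factorial * (n - T.card).factorial : ℕ) : ℚ) •
        (elemSym T.card * (frobPoly (n - T.card)).coeff i) := by
  have h1 := (sum_signQ_smul {x // x ∈ T}).trans (by rw [Fintype.card_coe] :
    _ = (T.card.factorial : ℚ) • elemSym T.card)
  have h2 := (sum_trace_harmAct_smul (Outside T) i).trans (by rw [card_outside] :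
    _ = ((n - T.card).factorial : ℚ) • (frobPoly (n - T.card)).coeff i)
  rw [Nat.cast_mul, ← smul_mul_smul_comm, ← h1, ← h2, Finset.sum_mul_sum, ← Finset.sum_product']
  symm
  refine Fintype.sum_of_injective
    (fun x : Equiv.Perm {x // x ∈ T} × Equiv.Perm (Outside T) => x.1.subtypeCongr x.2) ?_ _ _
    (fun w hw => ?_) fun x => ?_
  · intro x y hxy
    refine Equiv.Perm.subtypeCongrHom_injective (fun x => x ∈ T) hxy
  · rw [localTrace_eq_zero i fun u v h => hw ⟨(u, v), h⟩, zero_smul]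
  · rw [localTrace_subtypeCongr, parts_subtypeCongr, Multiset.map_add, Multiset.prod_add,
      smul_mul_smul_comm]

/-- Every r-subset contributes equally, and choose(n, r) · r! · (n - r)! = n! cancels the
normalization. For r > n there are no subsets. -/
theorem frob_mPiece (n i r : ℕ) : frob (mPiece n i r).toRepresentation =
    if r ≤ n then elemSym r * (frobPoly (n - r)).coeff i else 0 := by
  have h1 : ∑ w : Equiv.Perm (Fin n),
      LinearMap.trace ℚ _ ((mPiece n i r).toRepresentation w) •
        (w.partition.parts.map powerSum).prod =
      ((n.choose r * (r.factorial * (n - r).factorial) : ℕ) : ℚ) •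
        (elemSym r * (frobPoly (n - r)).coeff i) := by
    simp only [trace_mPiece, Finset.sum_smul]
    rw [Finset.sum_comm]
    have h2 : ∀ T : {T : Finset (Fin n) // T.card = r},
        ∑ w : Equiv.Perm (Fin n), localTrace T.1 i w • (w.partition.parts.map powerSum).prod =
        ((r.factorial * (n - r).factorial : ℕ) : ℚ) •
          (elemSym r * (frobPoly (n - r)).coeff i) := by
      rintro ⟨T, rfl⟩
      exact sum_localTrace_smul T i
    rw [Finset.sum_congr rfl fun T _ => h2 T, Finset.sum_const, Finset.card_univ,
      Fintype.card_finset_len, Fintype.card_fin, ← Nat.cast_smul_eq_nsmul ℚ, smul_smul,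
      ← Nat.cast_mul]
  rw [frob, h1]
  split_ifs with hr
  · rw [← mul_assoc, Nat.choose_mul_factorial_mul_factorial hr, smul_smul, inv_mul_cancel₀
      (by positivity), one_smul]
  · rw [Nat.choose_eq_zero_of_lt (not_le.1 hr), zero_mul, Nat.cast_zero, zero_smul, smul_zero]

end FrobeniusImage

end SuperVandermonde

end

theorem proposition4p5 (n : ℕ) :
    SuperVandermonde.IsBigrading (SuperVandermonde.mPiece n) ∧
    SuperVandermonde.IsBigrading (SuperVandermonde.sPiece n) ∧
    SuperVandermonde.BigradedIso (SuperVandermonde.mPiece n) (SuperVandermonde.sPiece n) ∧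
    SuperVandermonde.grFrob (SuperVandermonde.mRep n) (SuperVandermonde.mPiece n) =
      ∑ r ∈ Finset.range (n + 1),
        (PowerSeries.X : PowerSeries (PowerSeries SuperVandermonde.SymFun)) ^ r *
          PowerSeries.C (PowerSeries.C (SuperVandermonde.elemSym r) *
            ((SuperVandermonde.revQ (SuperVandermonde.hallLittlewoodQ' fun _ : Fin (n - r) => 1) :
              Polynomial SuperVandermonde.SymFun) : PowerSeries SuperVandermonde.SymFun)) := by
  refine ⟨SuperVandermonde.isBigrading_mPiece n, SuperVandermonde.isBigrading_sPiece n,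
    SuperVandermonde.bigradedIso_mPiece_sPiece n, ?_⟩
  refine PowerSeries.ext fun j => PowerSeries.ext fun i => ?_
  rw [SuperVandermonde.grFrob, PowerSeries.coeff_mk, PowerSeries.coeff_mk,
    SuperVandermonde.frob_mPiece, map_sum]
  simp only [SuperVandermonde.hallLittlewoodQ'_column, SuperVandermonde.reverse_columnPoly,
    PowerSeries.coeff_mul_C, PowerSeries.coeff_X_pow, ite_mul, one_mul, zero_mul]
  rw [Finset.sum_ite_eq]
  simp only [Finset.mem_range, Nat.lt_succ_iff]
  split_ifs
  · rw [PowerSeries.coeff_C_mul, Polynomial.coeff_coe]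
  · rw [map_zero]
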